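/- **Corollary.** Let $\mathcal A,\mathcal B,\mathcal C,\mathcal A',\mathcal B',\mathcal C'$ be abelian categories such that $\mathcal A,\mathcal B,\mathcal A',\mathcal B'$ have enough injectives. Let $$F:\mathcal A\to\mathcal B,\quad G:\mathcal B\to\mathcal C,\quad F':\mathcal A'\to\mathcal B',\quad G':\mathcal B'\to\mathcal C'$$ be additive left exact functors such that $F$ and $F'$ send injective objects to injective objects, let $$\kappa_{\mathcal A}:\mathcal A\to\mathcal A',\quad \kappa_{\mathcal B}:\mathcal B\to\mathcal B',\quad \kappa_{\mathcal C}:\mathcal C\to\mathcal C'$$ be additive exact functors, and let $N_F:\kappa_{\mathcal B}F\Rightarrow F'\kappa_{\mathcal A}$ and $N_G:\kappa_{\mathcal C}G\Rightarrow G'\kappa_{\mathcal B}$ be natural transformations (not necessarily isomorphisms). Put $$N_{GF}:\ \kappa_{\mathcal C}GF\xrightarrow{\ N_G F\ }G'\kappa_{\mathcal B}F\xrightarrow{\ G'N_F\ }G'F'\kappa_{\mathcal A}.$$ For a natural transformation $N:\kappa H\Rightarrow H'\kappa'$, where $H$ and $H'$ are additive functors whose sources have enough injectives and $\kappa,\kappa'$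 are exact, denote again by $N$ the unique natural transformation $\kappa\,RH\Rightarrow RH'\,\kappa'$ of functors on $\mathcal D^+$ that is compatible with $N$ and with the universal transformations $qH\Rightarrow RH\,q$ and $qH'\Rightarrow RH'\,q$ (where $q:\mathcal K^+\to\mathcal D^+$ is the localization), and also the induced transformations $\kappa\,R^nH\Rightarrow R^nH'\,\kappa'$. For $A\in\mathcal A$ let $$E_2^{p,q}(A)=R^pG(R^qF(A))\Rightarrow R^{p+q}(GF)(A)$$ be the Grothendieck spectral sequence of $GF$ (for $r\ge 2$; it is the spectral sequence of $RG$ for the canonical filtration of $RF(A)$ by truncations, with the convergence given by the canonical isomorphism $R(GF)\cong RG\,RF$), and for $A'\in\mathcal A'$ let $\tilde E_r^{p,q}(A')$ be the Grothendieck spectral sequence of $G'F'$. Then there are morphisms of spectral sequences $$\Phi_A:\ \kappa_{\mathcal C}\bigl(E_r^{p,q}(A)\bigr)\longrightarrow\tilde E_r^{p,q}(\kappa_{\mathcal A}A)\qquad(r\ge 2,\ A\in\mathcal A),$$ natural in $A$, such that for every $A\in\mathcal A$: 1. on the second page, $\Phi_A$ is, for all $p,q$, the composite $$\kappa_{\mathcal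 C}R^pG\,R^qF(A)\xrightarrow{\ N_G\ }R^pG'\,\kappa_{\mathcal B}R^qF(A)\xrightarrow{\ R^pG'(N_F)\ }R^pG'\,R^qF'(\kappa_{\mathcal A}A);$$ 2. $\Phi_A$ is compatible with $N_{GF}$ on the abutments: for every $n$, the morphism $$N_{GF}:\kappa_{\mathcal C}R^n(GF)(A)\to R^n(G'F')(\kappa_{\mathcal A}A)$$ respects the filtrations given by the convergence of the two spectral sequences, and for all $p,q$ with $p+q=n$ the morphism it induces on the graded pieces is the morphism $\kappa_{\mathcal C}(E_\infty^{p,q}(A))\to\tilde E_\infty^{p,q}(\kappa_{\mathcal A}A)$ induced by $\Phi_A$. -/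

import Mathlib

open CategoryTheory Limits Category Triangulated

namespace GrothendieckSS

section Derived

variable {A B : Type*} [Category* A] [Category* B] [Abelian A] [Abelian B]
  [HasDerivedCategory A] [HasDerivedCategory B]

variable (A) in
/-- The functor from bounded below complexes of injectives, up to homotopy, to `D⁺`. -/
noncomputable def injQh : HomotopyCategory.Plus (InjectiveObject A) ⥤ DerivedCategory.Plus A :=
  (InjectiveObject.ι A).mapHomotopyCategoryPlus ⋙ DerivedCategory.Plus.Qh

noncomputable instance : (injQh A).CommShift ℤ := by
  dsimp only [injQh]; infer_instance

instance : (injQh A).IsTriangulated := by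
  dsimp only [injQh]; infer_instance

instance [EnoughInjectives A] : (injQh A).EssSurj := by
  dsimp only [injQh]; infer_instance

lemma injQh_bijective (X Y : HomotopyCategory.Plus (InjectiveObject A)) :
    Function.Bijective ((injQh A).map : (X ⟶ Y) → _) := by
  have h := DerivedCategory.Plus.Qh_map_bijective_of_isKInjective
    ((InjectiveObject.ι A).mapHomotopyCategoryPlus.obj X)
    ((InjectiveObject.ι A).mapHomotopyCategoryPlus.obj Y)
    (by
      obtain ⟨Y, rfl⟩ := HomotopyCategory.Plus.quotient_obj_surjective Y
      exact inferInstanceAs (CochainComplex.IsKInjective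
        (((InjectiveObject.ι A).mapHomologicalComplex (.up ℤ)).obj Y.obj)))
  exact h.comp ((Functor.FullyFaithful.ofFullyFaithful
    (InjectiveObject.ι A).mapHomotopyCategoryPlus).map_bijective _ _)

instance : (injQh A).Full := ⟨fun {X Y} => (injQh_bijective X Y).2⟩
instance : (injQh A).Faithful := ⟨fun {X Y} => @(injQh_bijective X Y).1⟩
instance [EnoughInjectives A] : (injQh A).IsEquivalence where

instance [EnoughInjectives A] :
    (injQh A).IsLocalization (MorphismProperty.isomorphisms _) :=
  inferInstanceAs (((𝟭 _) ⋙ injQh A).IsLocalization _)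

instance [EnoughInjectives A] : (injQh A).mapArrow.EssSurj := inferInstance

variable (F : A ⥤ B) [F.Additive] [EnoughInjectives A]

instance (K : HomotopyCategory.Plus (InjectiveObject A)) : IsIso (F.rightDerivedFunctorPlusUnit.app
    ((InjectiveObject.ι A).mapHomotopyCategoryPlus.obj K)) :=
  (HomotopyCategory.Plus.localizerMorphism_derives
    (F.mapHomotopyCategoryPlus ⋙ DerivedCategory.Plus.Qh)).isIso_of_isRightDerivedFunctor
      F.rightDerivedFunctorPlusUnit K

/-- On bounded below complexes of injectives, `RF` is computed by applying `F` termwise. -/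
noncomputable def injLift :
    (InjectiveObject.ι A).mapHomotopyCategoryPlus ⋙ F.mapHomotopyCategoryPlus ⋙ DerivedCategory.Plus.Qh ≅ injQh A ⋙ F.rightDerivedFunctorPlus :=
  NatIso.ofComponents (fun K =>
    (asIso (F.rightDerivedFunctorPlusUnit.app
      ((InjectiveObject.ι A).mapHomotopyCategoryPlus.obj K)) :))
    (fun _ => F.rightDerivedFunctorPlusUnit.naturality _)

/-- `RF` lifts the functor which applies `F` termwise to complexes of injectives. -/
noncomputable instance : Localization.Lifting (injQh A) (MorphismProperty.isomorphisms _)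
    ((InjectiveObject.ι A).mapHomotopyCategoryPlus ⋙ F.mapHomotopyCategoryPlus ⋙ DerivedCategory.Plus.Qh)
    F.rightDerivedFunctorPlus := ⟨(injLift F).symm⟩

/-- The right derived functor `RF : D⁺(A) ⥤ D⁺(B)` commutes with shifts, in the way that
is compatible with the commutation of `F` with shifts on complexes of injectives. -/
noncomputable instance : F.rightDerivedFunctorPlus.CommShift ℤ :=
  Functor.commShiftOfLocalization (injQh A) (MorphismProperty.isomorphisms _) ℤ
    ((InjectiveObject.ι A).mapHomotopyCategoryPlus ⋙ F.mapHomotopyCategoryPlus ⋙ DerivedCategory.Plus.Qh) _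

instance : F.rightDerivedFunctorPlus.IsTriangulated := by
  let e := Localization.Lifting.iso (injQh A) (MorphismProperty.isomorphisms _)
    ((InjectiveObject.ι A).mapHomotopyCategoryPlus ⋙ F.mapHomotopyCategoryPlus ⋙ DerivedCategory.Plus.Qh)
    F.rightDerivedFunctorPlus
  have : NatTrans.CommShift e.hom ℤ := NatTrans.commShift_iso_hom_of_localization ..
  exact Functor.isTriangulated_of_precomp_iso e

end Derived

section HomologySpectral

open ComposableArrows

variable {D C ι : Type*} [Category* D] [Category* C] [Category* ι] [HasZeroObject D] [HasShift D ℤ]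
  [Preadditive D] [∀ (n : ℤ), (shiftFunctor D n).Additive] [Pretriangulated D] [Abelian C]
  (H : D ⥤ C) [H.IsHomological] [H.ShiftSequence ℤ]

/-- The spectral object in an abelian category obtained by applying a homological functor `H`
(and its shifts `Hⁿ`) to a spectral object in a triangulated category. -/
noncomputable def homologySpectralObjectObj (X : Triangulated.SpectralObject D ι) :
    Abelian.SpectralObject C ι where
  H n := X.ω₁ ⋙ H.shift n
  δ' n₀ n₁ h :=
    { app T := H.homologySequenceδ (X.ω₂.obj T) n₀ n₁ h
      naturality _ _ f := H.homologySequenceδ_naturality _ _ (X.ω₂.map f) n₀ n₁ h }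
  exact₁' n₀ n₁ h T :=
    (H.homologySequence_exact₁ _ (X.distinguished' T) n₀ n₁ h).exact_toComposableArrows
  exact₂' n T :=
    (H.homologySequence_exact₂ _ (X.distinguished' T) n).exact_toComposableArrows
  exact₃' n₀ n₁ h T :=
    (H.homologySequence_exact₃ _ (X.distinguished' T) n₀ n₁ h).exact_toComposableArrows

/-- Functoriality of `homologySpectralObjectObj`. -/
noncomputable def homologySpectralObject :
    Triangulated.SpectralObject D ι ⥤ Abelian.SpectralObject C ι where
  obj X := homologySpectralObjectObj H X
  map {X Y} φ :=
    { hom n := Functor.whiskerRight φ.hom (H.shift n)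
      comm n₀ n₁ h i j k f g := by
        change H.shiftMap (X.δ f g) n₀ n₁ _ ≫ (H.shift n₁).map _ =
          (H.shift n₀).map _ ≫ H.shiftMap (Y.δ f g) n₀ n₁ _
        rw [← H.shiftMap_comp', ← φ.comm, H.shiftMap_comp]
         }
  map_id _ := Abelian.SpectralObject.Hom.ext (funext fun _ => Functor.whiskerRight_id _)
  map_comp _ _ := Abelian.SpectralObject.Hom.ext (funext fun _ => Functor.whiskerRight_comp _ _ _)

end HomologySpectral

section Grothendieck

variable {A B C : Type*} [Category* A] [Category* B] [Category* C] [Abelian A] [Abelian B] [Abelian C]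
  [HasDerivedCategory A] [HasDerivedCategory B] [HasDerivedCategory C]
  (F : A ⥤ B) (G : B ⥤ C) [F.Additive] [G.Additive] [EnoughInjectives A] [EnoughInjectives B]

/-- The right derived functor `RⁿF : A ⥤ B`, that is `X ↦ Hⁿ(RF(X[0]))` where
`RF : D⁺(A) ⥤ D⁺(B)` is the total right derived functor of `F`
(it is zero when `n < 0`). -/
noncomputable def rightDer (n : ℤ) : A ⥤ B :=
  DerivedCategory.Plus.singleFunctor A 0 ⋙ F.rightDerivedFunctorPlus ⋙
    DerivedCategory.Plus.homologyFunctor B n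

/-- The spectral object behind the Grothendieck spectral sequence of `G ∘ F`: it sends `X : A`
to the system of all `Hⁿ(RG(τ^{≥ i} τ^{< j} RF(X)))` for `i ≤ j` in `ℤ ∪ {-∞, +∞}`, with the
long exact sequences attached to the truncation triangles. -/
noncomputable def grothendieckSpectralObject : A ⥤ Abelian.SpectralObject C EInt :=
  DerivedCategory.Plus.singleFunctor A 0 ⋙ F.rightDerivedFunctorPlus ⋙
    DerivedCategory.Plus.TStructure.t.spectralObjectFunctor ⋙
    G.rightDerivedFunctorPlus.mapTriangulatedSpectralObject EInt ⋙
    homologySpectralObject (DerivedCategory.Plus.homologyFunctor C 0)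

end Grothendieck

section SpectralSequenceFunctor

open ComposableArrows Abelian Abelian.SpectralObject

section

variable {C ι : Type*} [Category* C] [Category* ι] [Abelian C]
  {X Y Z : Abelian.SpectralObject C ι} (φ : X ⟶ Y) (ψ : Y ⟶ Z)

section
variable {i j k l : ι} (f₁ : i ⟶ j) (f₂ : j ⟶ k) (f₃ : k ⟶ l)
  (n₀ n₁ n₂ : ℤ) (hn₁ : n₀ + 1 = n₁ := by lia) (hn₂ : n₁ + 1 = n₂ := by lia)

/-- The morphism between the short complexes computing `E` that is induced by a morphism of
spectral objects. -/
noncomputable def scMap :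
    X.shortComplex f₁ f₂ f₃ n₀ n₁ n₂ hn₁ hn₂ ⟶ Y.shortComplex f₁ f₂ f₃ n₀ n₁ n₂ hn₁ hn₂ where
  τ₁ := (Abelian.SpectralObject.Hom.hom φ n₀).app (mk₁ f₃)
  τ₂ := (Abelian.SpectralObject.Hom.hom φ n₁).app (mk₁ f₂)
  τ₃ := (Abelian.SpectralObject.Hom.hom φ n₂).app (mk₁ f₁)
  comm₁₂ := (Abelian.SpectralObject.Hom.comm φ n₀ n₁ hn₁ f₂ f₃).symm
  comm₂₃ := (Abelian.SpectralObject.Hom.comm φ n₁ n₂ hn₂ f₁ f₂).symm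

/-- The morphism induced on `E` by a morphism of spectral objects. -/
noncomputable def EMap : X.E f₁ f₂ f₃ n₀ n₁ n₂ hn₁ hn₂ ⟶ Y.E f₁ f₂ f₃ n₀ n₁ n₂ hn₁ hn₂ :=
  ShortComplex.homologyMap (scMap φ f₁ f₂ f₃ n₀ n₁ n₂ hn₁ hn₂)

lemma EMap_id : EMap (𝟙 X) f₁ f₂ f₃ n₀ n₁ n₂ hn₁ hn₂ = 𝟙 _ :=
  ShortComplex.homologyMap_id _

lemma EMap_comp : EMap (φ ≫ ψ) f₁ f₂ f₃ n₀ n₁ n₂ hn₁ hn₂ =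
    EMap φ f₁ f₂ f₃ n₀ n₁ n₂ hn₁ hn₂ ≫ EMap ψ f₁ f₂ f₃ n₀ n₁ n₂ hn₁ hn₂ :=
  ShortComplex.homologyMap_comp (scMap φ f₁ f₂ f₃ n₀ n₁ n₂ hn₁ hn₂) (scMap ψ f₁ f₂ f₃ n₀ n₁ n₂ hn₁ hn₂)

variable {i' j' k' l' : ι} (f₁' : i' ⟶ j') (f₂' : j' ⟶ k') (f₃' : k' ⟶ l')
  (α : mk₃ f₁ f₂ f₃ ⟶ mk₃ f₁' f₂' f₃')

lemma map_EMap : X.map f₁ f₂ f₃ f₁' f₂' f₃' α n₀ n₁ n₂ hn₁ hn₂ ≫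
      EMap φ f₁' f₂' f₃' n₀ n₁ n₂ hn₁ hn₂ =
    EMap φ f₁ f₂ f₃ n₀ n₁ n₂ hn₁ hn₂ ≫ Y.map f₁ f₂ f₃ f₁' f₂' f₃' α n₀ n₁ n₂ hn₁ hn₂ := by
  have : X.shortComplexMap f₁ f₂ f₃ f₁' f₂' f₃' α n₀ n₁ n₂ hn₁ hn₂ ≫
      scMap φ f₁' f₂' f₃' n₀ n₁ n₂ hn₁ hn₂ =
    scMap φ f₁ f₂ f₃ n₀ n₁ n₂ hn₁ hn₂ ≫
      Y.shortComplexMap f₁ f₂ f₃ f₁' f₂' f₃' α n₀ n₁ n₂ hn₁ hn₂ := by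
    ext
    · exact (Abelian.SpectralObject.Hom.hom φ n₀).naturality _
    · exact (Abelian.SpectralObject.Hom.hom φ n₁).naturality _
    · exact (Abelian.SpectralObject.Hom.hom φ n₂).naturality _
  refine (ShortComplex.homologyMap_comp _ _).symm.trans (Eq.trans ?_
    (ShortComplex.homologyMap_comp _ _))
  rw [this]

lemma toCycles_πE_EMap (f₁₂ : i ⟶ k) (h₁₂ : f₁ ≫ f₂ = f₁₂) :
    X.toCycles f₁ f₂ f₁₂ h₁₂ n₁ ≫ X.πE f₁ f₂ f₃ n₀ n₁ n₂ hn₁ hn₂ ≫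
      EMap φ f₁ f₂ f₃ n₀ n₁ n₂ hn₁ hn₂ =
    (Abelian.SpectralObject.Hom.hom φ n₁).app (mk₁ f₁₂) ≫
      Y.toCycles f₁ f₂ f₁₂ h₁₂ n₁ ≫ Y.πE f₁ f₂ f₃ n₀ n₁ n₂ hn₁ hn₂ := by
  have h : (X.toCycles f₁ f₂ f₁₂ h₁₂ n₁ ≫ (X.cyclesIso f₁ f₂ f₃ n₀ n₁ n₂ hn₁ hn₂).inv) ≫
      ShortComplex.cyclesMap (scMap φ f₁ f₂ f₃ n₀ n₁ n₂ hn₁ hn₂) =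
      (Abelian.SpectralObject.Hom.hom φ n₁).app (mk₁ f₁₂) ≫
      (Y.toCycles f₁ f₂ f₁₂ h₁₂ n₁ ≫ (Y.cyclesIso f₁ f₂ f₃ n₀ n₁ n₂ hn₁ hn₂).inv) := by
    rw [← cancel_mono (ShortComplex.iCycles _)]
    simp only [assoc, ShortComplex.cyclesMap_i]
    rw [Y.cyclesIso_inv_i f₁ f₂ f₃ n₀ n₁ n₂ hn₁ hn₂]
    refine Eq.trans ?_ (whisker_eq _ (Y.toCycles_i f₁ f₂ f₁₂ h₁₂ n₁)).symm
    refine (whisker_eq _ (X.cyclesIso_inv_i_assoc f₁ f₂ f₃ n₀ n₁ n₂ hn₁ hn₂ _)).trans ?_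
    refine (X.toCycles_i_assoc f₁ f₂ f₁₂ h₁₂ n₁ _).trans ?_
    exact (Abelian.SpectralObject.Hom.hom φ n₁).naturality _
  have h' := h =≫ ShortComplex.homologyπ _
  simp only [assoc] at h'
  rw [← ShortComplex.homologyπ_naturality] at h'
  refine Eq.trans ?_ h'
  exact whisker_eq _ (assoc _ _ _)

end

lemma d_EMap {i₀ i₁ i₂ i₃ i₄ i₅ : ι} (f₁ : i₀ ⟶ i₁) (f₂ : i₁ ⟶ i₂) (f₃ : i₂ ⟶ i₃)
    (f₄ : i₃ ⟶ i₄) (f₅ : i₄ ⟶ i₅) (n₀ n₁ n₂ n₃ : ℤ)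
    (hn₁ : n₀ + 1 = n₁ := by lia) (hn₂ : n₁ + 1 = n₂ := by lia) (hn₃ : n₂ + 1 = n₃ := by lia) :
    X.d f₁ f₂ f₃ f₄ f₅ n₀ n₁ n₂ n₃ hn₁ hn₂ hn₃ ≫ EMap φ f₁ f₂ f₃ n₁ n₂ n₃ hn₂ hn₃ =
      EMap φ f₃ f₄ f₅ n₀ n₁ n₂ hn₁ hn₂ ≫ Y.d f₁ f₂ f₃ f₄ f₅ n₀ n₁ n₂ n₃ hn₁ hn₂ hn₃ := by
  rw [← cancel_epi (X.πE f₃ f₄ f₅ n₀ n₁ n₂ hn₁ hn₂),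
    ← cancel_epi (X.toCycles f₃ f₄ _ rfl n₁),
    X.toCycles_πE_d_assoc f₁ f₂ f₃ f₄ f₅ _ rfl _ rfl n₀ n₁ n₂ n₃ hn₁ hn₂ hn₃,
    toCycles_πE_EMap φ f₁ f₂ f₃ n₁ n₂ n₃ hn₂ hn₃]
  have h := toCycles_πE_EMap φ f₃ f₄ f₅ n₀ n₁ n₂ hn₁ hn₂ _ rfl =≫
    Y.d f₁ f₂ f₃ f₄ f₅ n₀ n₁ n₂ n₃ hn₁ hn₂ hn₃
  simp only [assoc] at h
  rw [h, Y.toCycles_πE_d f₁ f₂ f₃ f₄ f₅ _ rfl _ rfl n₀ n₁ n₂ n₃ hn₁ hn₂ hn₃]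
  exact (Abelian.SpectralObject.Hom.comm_assoc φ n₁ n₂ hn₂ _ _ _)
end
end SpectralSequenceFunctor

section SpectralSequenceFunctor

open ComposableArrows Abelian Abelian.SpectralObject

lemma liftCycles_homologyIso {C κ : Type*} [Category* C] [Abelian C] {c : ComplexShape κ}
    (K : HomologicalComplex C c) (i j k : κ) (hi : c.prev j = i) (hk : c.next j = k)
    (h : (K.sc' i j k).LeftHomologyData) (i' : h.K ⟶ K.X j) (e : i' = h.i)
    (w : i' ≫ K.d j k = 0) :
    K.liftCycles i' k hk w ≫ K.homologyπ j ≫ (K.homologyIsoSc' i j k hi hk).hom ≫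
      h.homologyIso.hom = h.π := by
  have h₁ : K.liftCycles i' k hk w ≫ ShortComplex.cyclesMap (K.isoSc' i j k hi hk).hom =
      h.cyclesIso.inv := by
    refine (cancel_mono (ShortComplex.iCycles _)).1 ?_
    refine Eq.trans ?_ (ShortComplex.LeftHomologyData.cyclesIso_inv_comp_iCycles _).symm
    rw [← e]
    refine (assoc _ _ _).trans ((whisker_eq _ (ShortComplex.cyclesMap_i _)).trans ?_)
    refine (K.liftCycles_i_assoc i' k hk w _).trans ?_
    subst hi hk
    exact comp_id _
  have h₂ : K.homologyπ j ≫ (K.homologyIsoSc' i j k hi hk).hom =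
      ShortComplex.cyclesMap (K.isoSc' i j k hi hk).hom ≫ (K.sc' i j k).homologyπ :=
    ShortComplex.homologyπ_naturality _
  have h₃ : (K.liftCycles i' k hk w ≫ ShortComplex.cyclesMap (K.isoSc' i j k hi hk).hom) ≫
      ((K.sc' i j k).homologyπ ≫ h.homologyIso.hom) = h.π := by
    rw [h₁, ShortComplex.LeftHomologyData.homologyπ_comp_homologyIso_hom, Iso.inv_hom_id_assoc]
  refine Eq.trans ?_ h₃
  exact (whisker_eq _ ((assoc _ _ _).symm.trans ((h₂ =≫ _).trans (assoc _ _ _)))).trans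
    (assoc _ _ _).symm

lemma comp_trans_trans_hom {C : Type*} [Category* C] {X₁ X₂ X₃ X₄ X₅ X₆ : C} (a : X₁ ⟶ X₂)
    (b : X₂ ⟶ X₃) (e₁ : X₃ ≅ X₄) (e₂ : X₄ ≅ X₅) (e₃ : X₅ ≅ X₆) :
    a ≫ b ≫ (e₁ ≪≫ e₂ ≪≫ e₃).hom = (a ≫ b ≫ e₁.hom ≫ e₂.hom) ≫ e₃.hom := by
  simp

variable {C ι κ : Type*} [Category* C] [Abelian C] [Preorder ι]
  {X Y Z : Abelian.SpectralObject C ι} (φ : X ⟶ Y) (ψ : Y ⟶ Z)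
  {c : ℤ → ComplexShape κ} {r₀ : ℤ} (data : SpectralSequenceDataCore ι c r₀)
  [X.HasSpectralSequence data] [Y.HasSpectralSequence data] [Z.HasSpectralSequence data]

section
variable (X)

/-- The objects of the `r`th page in terms of the spectral object. -/
noncomputable def pageIso (r : ℤ) (hr : r₀ ≤ r) (pq : κ) :
    ((X.spectralSequence data).page r).X pq ≅
      X.E (homOfLE (data.le₀₁ r pq)) (homOfLE (data.le₁₂ pq)) (homOfLE (data.le₂₃ r pq))
        (data.deg pq - 1) (data.deg pq) (data.deg pq + 1) :=
  X.spectralSequencePageXIso data r hr pq _ _ _ _ rfl rfl rfl rfl _ _ _ rfl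

variable (r r' : ℤ) (hrr' : r + 1 = r') (hr : r₀ ≤ r) (pq : κ)

/-- The inclusion of the cycles of the `r`th page, in terms of the spectral object. -/
noncomputable def pageι :
    X.E (homOfLE (data.le₀₁ r' pq)) (homOfLE (data.le₁₂ pq)) (homOfLE (data.le₂₃ r pq))
        (data.deg pq - 1) (data.deg pq) (data.deg pq + 1) ⟶
      X.E (homOfLE (data.le₀₁ r pq)) (homOfLE (data.le₁₂ pq)) (homOfLE (data.le₂₃ r pq))
        (data.deg pq - 1) (data.deg pq) (data.deg pq + 1) :=
  X.mapFourδ₁Toδ₀' _ _ _ _ _ (data.i₀_le r r' pq) _ _ _ _ _ _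

/-- The projection from the cycles of the `r`th page to the next page, in terms of the
spectral object. -/
noncomputable def pageπ :
    X.E (homOfLE (data.le₀₁ r' pq)) (homOfLE (data.le₁₂ pq)) (homOfLE (data.le₂₃ r pq))
        (data.deg pq - 1) (data.deg pq) (data.deg pq + 1) ⟶
      X.E (homOfLE (data.le₀₁ r' pq)) (homOfLE (data.le₁₂ pq)) (homOfLE (data.le₂₃ r' pq))
        (data.deg pq - 1) (data.deg pq) (data.deg pq + 1) :=
  X.mapFourδ₄Toδ₃' _ _ _ _ _ _ _ _ (data.i₃_le r r' pq) _ _ _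

/-- The left homology data of the `r`th page given by the next page. -/
noncomputable def leftData :
    (((X.spectralSequence data).page r hr).sc' ((c r).prev pq) pq ((c r).next pq)).LeftHomologyData :=
  (X.spectralSequenceHomologyData data r r' hrr' hr _ pq _ rfl rfl _ _ _ _ _ _ rfl rfl rfl rfl rfl
    rfl (data.deg pq - 1) (data.deg pq) (data.deg pq + 1) rfl).left

lemma leftData_i : (leftData X data r r' hrr' hr pq).i =
    pageι X data r r' hrr' hr pq ≫ (pageIso X data r hr pq).inv :=
  X.spectralSequenceHomologyData_left_i data r r' hrr' hr _ pq _ rfl rfl _ _ _ _ _ _ rfl rfl rfl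
    rfl rfl rfl (data.deg pq - 1) (data.deg pq) (data.deg pq + 1) rfl

lemma leftData_π : (leftData X data r r' hrr' hr pq).π =
    pageπ X data r r' hrr' hr pq :=
  X.spectralSequenceHomologyData_left_π data r r' hrr' hr _ pq _ rfl rfl _ _ _ _ _ _ rfl rfl rfl
    rfl rfl rfl (data.deg pq - 1) (data.deg pq) (data.deg pq + 1) rfl

lemma pageι_d : (pageι X data r r' hrr' hr pq ≫ (pageIso X data r hr pq).inv) ≫
    ((X.spectralSequence data).page r hr).d pq ((c r).next pq) = 0 := by
  rw [← leftData_i]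
  exact (leftData X data r r' hrr' hr pq).wi

/-- The identification of the cycles of the `r`th page. -/
noncomputable def pageCycles :
    X.E (homOfLE (data.le₀₁ r' pq)) (homOfLE (data.le₁₂ pq)) (homOfLE (data.le₂₃ r pq))
        (data.deg pq - 1) (data.deg pq) (data.deg pq + 1) ⟶
    ((X.spectralSequence data).page r hr).cycles pq :=
  ((X.spectralSequence data).page r hr).liftCycles (pageι X data r r' hrr' hr pq ≫ (pageIso X data r hr pq).inv) _ rfl
    (pageι_d X data r r' hrr' hr pq)

lemma pageCycles_homologyπ_iso :
    pageCycles X data r r' hrr' hr pq ≫ ((X.spectralSequence data).page r hr).homologyπ pq ≫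
      ((X.spectralSequence data).iso r r' pq hrr' hr).hom =
    pageπ X data r r' hrr' hr pq ≫ (pageIso X data r' (by lia) pq).inv := by
  have h := X.spectralSequence_iso data r r' hrr' hr _ pq _ rfl rfl _ _ _ _ _ _ rfl rfl rfl
    rfl rfl rfl (data.deg pq - 1) (data.deg pq) (data.deg pq + 1) rfl
  have h' := liftCycles_homologyIso ((X.spectralSequence data).page r hr) _ pq _ rfl rfl
    (leftData X data r r' hrr' hr pq) _ (leftData_i X data r r' hrr' hr pq).symm
    (pageι_d X data r r' hrr' hr pq)
  rw [h, ← leftData_π, ← h']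
  exact comp_trans_trans_hom _ _ _ _ _

instance : Epi (pageπ X data r r' hrr' hr pq) := by
  dsimp only [pageπ]; infer_instance

end
end SpectralSequenceFunctor

section SpectralSequenceFunctor

open ComposableArrows Abelian Abelian.SpectralObject

variable {C ι κ : Type*} [Category* C] [Abelian C] [Preorder ι]
  {X Y Z : Abelian.SpectralObject C ι} (φ : X ⟶ Y) (ψ : Y ⟶ Z)
  {c : ℤ → ComplexShape κ} {r₀ : ℤ} (data : SpectralSequenceDataCore ι c r₀)
  [X.HasSpectralSequence data] [Y.HasSpectralSequence data] [Z.HasSpectralSequence data]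

/-- The morphism induced in each bidegree of the `r`th page by a morphism of spectral objects. -/
noncomputable def pageMapX (r : ℤ) (hr : r₀ ≤ r) (pq : κ) :
    ((X.spectralSequence data).page r).X pq ⟶ ((Y.spectralSequence data).page r).X pq :=
  (pageIso X data r hr pq).hom ≫ EMap φ _ _ _ _ _ _ ≫ (pageIso Y data r hr pq).inv

lemma pageMapX_comp_spectralSequencePageXIso_hom (r : ℤ) (hr : r₀ ≤ r) (pq : κ)
    (i₀ i₁ i₂ i₃ : ι) (h₀ : i₀ = data.i₀ r pq)
    (h₁ : i₁ = data.i₁ pq) (h₂ : i₂ = data.i₂ pq)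
    (h₃ : i₃ = data.i₃ r pq)
    (n₀ n₁ n₂ : ℤ) (h : n₁ = data.deg pq)
    (hn₁ : n₀ + 1 = n₁) (hn₂ : n₁ + 1 = n₂) :
    pageMapX φ data r hr pq ≫
      (Y.spectralSequencePageXIso data r hr pq i₀ i₁ i₂ i₃ h₀ h₁ h₂ h₃ n₀ n₁ n₂ h hn₁ hn₂).hom =
      (X.spectralSequencePageXIso data r hr pq i₀ i₁ i₂ i₃ h₀ h₁ h₂ h₃ n₀ n₁ n₂ h hn₁ hn₂).hom ≫
      EMap φ _ _ _ n₀ n₁ n₂ hn₁ hn₂ := by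
  obtain rfl : n₀ = n₁ - 1 := by lia
  subst h hn₂ h₀ h₁ h₂ h₃
  exact (assoc _ _ _).trans (whisker_eq _ ((assoc _ _ _).trans
    ((whisker_eq _ (Iso.inv_hom_id _)).trans (comp_id _))))

/-- The morphism induced on the `r`th page by a morphism of spectral objects. -/
noncomputable def pageMap (r : ℤ) (hr : r₀ ≤ r) :
    (X.spectralSequence data).page r ⟶ (Y.spectralSequence data).page r where
  f pq := pageMapX φ data r hr pq
  comm' pq pq' hpq := by
    have hX := X.spectralSequence_page_d_eq data r hr pq pq' hpq (homOfLE (data.le₀₁ r pq'))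
        (homOfLE (data.le₁₂' pq' rfl (data.hc₀₂ r pq pq' hpq)))
        (homOfLE (data.le₀₁ r pq)) (homOfLE (data.le₁₂ pq)) (homOfLE (data.le₂₃ r pq))
        rfl rfl rfl rfl rfl rfl
        (data.deg pq - 1) (data.deg pq) (data.deg pq + 1) (data.deg pq + 2) rfl
    have hY := Y.spectralSequence_page_d_eq data r hr pq pq' hpq (homOfLE (data.le₀₁ r pq'))
        (homOfLE (data.le₁₂' pq' rfl (data.hc₀₂ r pq pq' hpq)))
        (homOfLE (data.le₀₁ r pq)) (homOfLE (data.le₁₂ pq)) (homOfLE (data.le₂₃ r pq))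
        rfl rfl rfl rfl rfl rfl
        (data.deg pq - 1) (data.deg pq) (data.deg pq + 1) (data.deg pq + 2) rfl
    rw [hX, hY, ← cancel_mono (Y.spectralSequencePageXIso data r hr pq' _ _ _ _ rfl rfl
      (data.hc₀₂ r pq pq' hpq) (data.hc₁₃ r pq pq' hpq) _ _ (data.deg pq + 2)
      (data.hc r pq pq' hpq) rfl (by lia)).hom]
    simp only [assoc, Iso.inv_hom_id, comp_id]
    rw [pageMapX_comp_spectralSequencePageXIso_hom φ data]
    rw [Iso.inv_hom_id_assoc, d_EMap φ _ _ _ _ _ (data.deg pq - 1) (data.deg pq) (data.deg pq + 1) (data.deg pq + 2)]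
    rw [← assoc, pageMapX_comp_spectralSequencePageXIso_hom φ data, assoc]

/-- The morphism of spectral sequences induced by a morphism of spectral objects. -/
noncomputable def spectralSequenceMap :
    X.spectralSequence data ⟶ Y.spectralSequence data where
  hom r hr := pageMap φ data r hr
  comm r r' pq hrr' hr := by
    have : Epi (pageCycles X data r r' hrr' hr pq ≫
        ((X.spectralSequence data).page r hr).homologyπ pq) := by
      have h := pageCycles_homologyπ_iso X data r r' hrr' hr pq
      have h' : Epi ((pageCycles X data r r' hrr' hr pq ≫
        ((X.spectralSequence data).page r hr).homologyπ pq) ≫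
          ((X.spectralSequence data).iso r r' pq hrr' hr).hom) := by
        rw [assoc, h]; infer_instance
      have := epi_comp ((pageCycles X data r r' hrr' hr pq ≫
        ((X.spectralSequence data).page r hr).homologyπ pq) ≫
          ((X.spectralSequence data).iso r r' pq hrr' hr).hom)
          ((X.spectralSequence data).iso r r' pq hrr' hr).inv
      simpa using this
    rw [← cancel_epi (pageCycles X data r r' hrr' hr pq ≫
        ((X.spectralSequence data).page r hr).homologyπ pq)]
    have h₁ : pageCycles X data r r' hrr' hr pq ≫
        HomologicalComplex.cyclesMap (pageMap φ data r hr) pq =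
        EMap φ _ _ _ _ _ _ ≫ pageCycles Y data r r' hrr' hr pq := by
      rw [← cancel_mono (HomologicalComplex.iCycles _ _)]
      simp only [assoc, HomologicalComplex.cyclesMap_i, pageCycles,
        HomologicalComplex.liftCycles_i, HomologicalComplex.liftCycles_i_assoc]
      change pageι X data r r' hrr' hr pq ≫ (pageIso X data r hr pq).inv ≫
        (pageIso X data r hr pq).hom ≫ EMap φ _ _ _ _ _ _ ≫ (pageIso Y data r hr pq).inv = _
      rw [Iso.inv_hom_id_assoc]
      exact (assoc _ _ _).symm.trans ((map_EMap φ _ _ _ _ _ _ _ _ _ _ _ _ =≫ _).trans (assoc _ _ _))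
    simp only [assoc]
    rw [HomologicalComplex.homologyπ_naturality_assoc, reassoc_of% h₁,
      pageCycles_homologyπ_iso, reassoc_of% (pageCycles_homologyπ_iso X data r r' hrr' hr pq)]
    change _ = pageπ X data r r' hrr' hr pq ≫ (pageIso X data r' (by lia) pq).inv ≫
        (pageIso X data r' (by lia) pq).hom ≫ EMap φ _ _ _ _ _ _ ≫ (pageIso Y data r' (by lia) pq).inv
    rw [Iso.inv_hom_id_assoc]
    exact (assoc _ _ _).symm.trans (((map_EMap φ _ _ _ _ _ _ _ _ _ _ _ _).symm =≫ _).trans (assoc _ _ _))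

lemma spectralSequenceMap_id : spectralSequenceMap (𝟙 X) data = 𝟙 _ := by
  ext r hr pq
  change (pageIso X data r hr pq).hom ≫ EMap (𝟙 X) _ _ _ _ _ _ ≫ (pageIso X data r hr pq).inv = 𝟙 _
  rw [EMap_id _ _ _ (data.deg pq - 1) (data.deg pq) (data.deg pq + 1), id_comp, Iso.hom_inv_id]

lemma spectralSequenceMap_comp : spectralSequenceMap (φ ≫ ψ) data =
    spectralSequenceMap φ data ≫ spectralSequenceMap ψ data := by
  ext r hr pq
  change (pageIso X data r hr pq).hom ≫ EMap (φ ≫ ψ) _ _ _ _ _ _ ≫ (pageIso Z data r hr pq).inv =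
    ((pageIso X data r hr pq).hom ≫ EMap φ _ _ _ _ _ _ ≫ (pageIso Y data r hr pq).inv) ≫
    ((pageIso Y data r hr pq).hom ≫ EMap ψ _ _ _ _ _ _ ≫ (pageIso Z data r hr pq).inv)
  rw [EMap_comp φ ψ _ _ _ (data.deg pq - 1) (data.deg pq) (data.deg pq + 1)]
  simp

variable (C) in
/-- The `E₂` cohomological spectral sequence of a spectral object indexed by `ℤ ∪ {-∞, +∞}`,
as a functor. -/
noncomputable def E₂SpectralSequenceFunctor :
    Abelian.SpectralObject C EInt ⥤ E₂CohomologicalSpectralSequence C where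
  obj Y := Y.E₂SpectralSequence
  map φ := spectralSequenceMap φ _
  map_id _ := spectralSequenceMap_id _
  map_comp _ _ := spectralSequenceMap_comp _ _ _

end SpectralSequenceFunctor

section MapSpectralSequence

variable {C D κ : Type*} [Category* C] [Category* D] [Abelian C] [Abelian D]
  (K : C ⥤ D) [K.Additive] [PreservesFiniteLimits K] [PreservesFiniteColimits K]

/-- An exact functor commutes with the homology of complexes. -/
noncomputable def mapHomologyIso {c : ComplexShape κ} (L : HomologicalComplex C c) (i : κ) :
    ((K.mapHomologicalComplex c).obj L).homology i ≅ K.obj (L.homology i) :=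
  (L.sc i).mapHomologyIso K

lemma mapHomologyIso_hom_naturality {c : ComplexShape κ} {L L' : HomologicalComplex C c}
    (f : L ⟶ L') (i : κ) :
    HomologicalComplex.homologyMap ((K.mapHomologicalComplex c).map f) i ≫
      (mapHomologyIso K L' i).hom =
    (mapHomologyIso K L i).hom ≫ K.map (HomologicalComplex.homologyMap f i) :=
  ShortComplex.mapHomologyIso_hom_naturality
    ((HomologicalComplex.shortComplexFunctor C c i).map f) K

variable {c : ℤ → ComplexShape κ} {r₀ : ℤ}

/-- The image of a spectral sequence under an exact functor: the functor is applied to all the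
pages, and to the identifications of each page with the homology of the previous one. -/
noncomputable def mapSpectralSequence : SpectralSequence C c r₀ ⥤ SpectralSequence D c r₀ where
  obj E :=
    { page r hr := (K.mapHomologicalComplex (c r)).obj (E.page r)
      iso r r' pq hrr' hr := mapHomologyIso K (E.page r) pq ≪≫ K.mapIso (E.iso r r' pq) }
  map {E E'} f :=
    { hom r hr := (K.mapHomologicalComplex (c r)).map (f.hom r)
      comm r r' pq hrr' hr := by
        refine (assoc _ _ _).symm.trans ((mapHomologyIso_hom_naturality K (f.hom r) pq =≫
          K.map (E'.iso r r' pq).hom).trans ?_)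
        refine (assoc _ _ _).trans (Eq.trans (whisker_eq _ ?_) (assoc _ _ _).symm)
        refine (K.map_comp _ _).symm.trans (Eq.trans ?_ (K.map_comp _ _))
        exact congrArg K.map (f.comm r r' pq hrr' hr) }
  map_id E := by
    ext r hr
    exact congrArg (fun g => HomologicalComplex.Hom.f g _) ((K.mapHomologicalComplex (c r)).map_id _)
  map_comp f g := by
    ext r hr
    exact congrArg (fun g => HomologicalComplex.Hom.f g _)
      ((K.mapHomologicalComplex (c r)).map_comp _ _)

end MapSpectralSequence

section
variable {A B C : Type*} [Category* A] [Category* B] [Category* C] [Abelian A] [Abelian B] [Abelian C]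
  [HasDerivedCategory A] [HasDerivedCategory B] [HasDerivedCategory C]
  (F : A ⥤ B) (G : B ⥤ C) [F.Additive] [G.Additive] [EnoughInjectives A] [EnoughInjectives B]

/-- The Grothendieck spectral sequence `E_r^{p,q}(X)`, `r ≥ 2`, of the composition `G ∘ F`, as a
functor of `X : A`. It is the spectral sequence of the functor `RG` for the canonical filtration
of `RF(X)` by its truncations, i.e. the hypercohomology spectral sequence of `G` at `RF(X)`. Its
second page is `R^pG(R^qF(X))` (see `page2Iso`) and it converges to `R^{p+q}(GF)(X)`
(see `grothendieckConvergence`) when `F` preserves injective objects. -/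
noncomputable def grothendieckSS : A ⥤ E₂CohomologicalSpectralSequence C :=
  grothendieckSpectralObject F G ⋙ E₂SpectralSequenceFunctor C

end

section Truncation

variable {B : Type*} [Category* B] [Abelian B] [HasDerivedCategory B]

open DerivedCategory DerivedCategory.Plus.TStructure

/-- The homology in degree `q` of the truncation `τ_{< q + 1}` -/
lemma isIso_homology_truncLTι (X : Plus B) (q : ℤ) :
    IsIso ((Plus.homologyFunctor B q).map ((t.truncLTι (q + 1)).app X)) := by
  have hT := t.triangleLTGE_distinguished (q + 1) X
  have h₀ := ((Plus.homologyFunctor B 0).homologySequence_mono_shift_map_mor₁_iff _ hT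
    (q - 1) q (by lia)).2
    ((Plus.isZero_homology_of_isGE ((t.truncGE (q + 1)).obj X) (q + 1) (q - 1) (by lia)).eq_of_src _ _)
  have h₁ := ((Plus.homologyFunctor B 0).homologySequence_epi_shift_map_mor₁_iff _ hT
    q).2
    ((Plus.isZero_homology_of_isGE ((t.truncGE (q + 1)).obj X) (q + 1) q (by lia)).eq_of_tgt _ _)
  have h₀' : Mono ((Plus.homologyFunctor B q).map ((t.truncLTι (q + 1)).app X)) := h₀
  have h₁' : Epi ((Plus.homologyFunctor B q).map ((t.truncLTι (q + 1)).app X)) := h₁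
  exact isIso_of_mono_of_epi _

lemma isIso_homology_truncGEπ (X : Plus B) (q : ℤ) :
    IsIso ((Plus.homologyFunctor B q).map ((t.truncGEπ q).app X)) := by
  have hT := t.triangleLTGE_distinguished q X
  have h₀ := ((Plus.homologyFunctor B 0).homologySequence_mono_shift_map_mor₂_iff _ hT
    q).2
    ((Plus.isZero_homology_of_isLE ((t.truncLT q).obj X) (q - 1) q (by lia)).eq_of_src _ _)
  have h₁ := ((Plus.homologyFunctor B 0).homologySequence_epi_shift_map_mor₂_iff _ hT
    q (q + 1) rfl).2
    ((Plus.isZero_homology_of_isLE ((t.truncLT q).obj X) (q - 1) (q + 1) (by lia)).eq_of_tgt _ _)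
  have h₀' : Mono ((Plus.homologyFunctor B q).map ((t.truncGEπ q).app X)) := h₀
  have h₁' : Epi ((Plus.homologyFunctor B q).map ((t.truncGEπ q).app X)) := h₁
  exact isIso_of_mono_of_epi _

/-- The homology in degree `q` of `τ_{≥ q} τ_{< q + 1} X` is the homology of `X` -/
noncomputable def homologyTruncIso (X : Plus B) (q : ℤ) :
    (Plus.homologyFunctor B q).obj ((t.truncGE q).obj ((t.truncLT (q + 1)).obj X)) ≅
      (Plus.homologyFunctor B q).obj X :=
  haveI := isIso_homology_truncLTι X q
  haveI := isIso_homology_truncGEπ ((t.truncLT (q + 1)).obj X) q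
  (asIso ((Plus.homologyFunctor B q).map
      ((t.truncGEπ q).app ((t.truncLT (q + 1)).obj X)))).symm ≪≫
    asIso ((Plus.homologyFunctor B q).map ((t.truncLTι (q + 1)).app X))

variable (B) in
/-- `H^q(Y[-q]) = Y`. -/
noncomputable def homologySingleIso (q : ℤ) :
    Plus.singleFunctor B q ⋙ Plus.homologyFunctor B q ≅ 𝟭 B :=
  singleFunctorCompHomologyFunctorIso B q

lemma exists_iso_single (X : Plus B) (q : ℤ) [X.IsGE q] [X.IsLE q] :
    ∃ (Y : B), Nonempty (X ≅ (Plus.singleFunctor B q).obj Y) := by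
  obtain ⟨Y, ⟨e⟩⟩ := DerivedCategory.exists_iso_singleFunctor_obj_of_isGE_of_isLE
    (Plus.ι.obj X) q
  exact ⟨Y, ⟨Plus.ι.preimageIso e⟩⟩

/-- An object `X` whose homology is concentrated in degree `q` is identified to the single
complex with value `H^q(X)`: this isomorphism `e` is the unique isomorphism which induces
the identity on `H^q`. -/
noncomputable def isoSingleHomology (X : Plus B) (q : ℤ) [X.IsGE q] [X.IsLE q] :
    X ≅ (Plus.singleFunctor B q).obj ((Plus.homologyFunctor B q).obj X) :=
  (exists_iso_single X q).choose_spec.some ≪≫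
    (Plus.singleFunctor B q).mapIso (((homologySingleIso B q).app _).symm ≪≫
      (Plus.homologyFunctor B q).mapIso (exists_iso_single X q).choose_spec.some.symm)

lemma homologyFunctor_map_isoSingleHomology (X : Plus B) (q : ℤ) [X.IsGE q] [X.IsLE q] :
    (Plus.homologyFunctor B q).map (isoSingleHomology X q).hom ≫
      (homologySingleIso B q).hom.app _ = 𝟙 _ := by
  have h := (homologySingleIso B q).hom.naturality (((homologySingleIso B q).app _).symm ≪≫
      (Plus.homologyFunctor B q).mapIso (exists_iso_single X q).choose_spec.some.symm).hom
  dsimp only [isoSingleHomology, Iso.trans_hom, Functor.mapIso_hom]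
  rw [Functor.map_comp, assoc]
  refine (whisker_eq _ h).trans ?_
  dsimp only [Iso.trans_hom, Iso.symm_hom, Iso.app_inv, Functor.mapIso_hom, Functor.id_map]
  refine (whisker_eq _ ((homologySingleIso B q).hom_inv_id_app_assoc _ _)).trans ?_
  rw [← Functor.map_comp, Iso.hom_inv_id, CategoryTheory.Functor.map_id]

end Truncation

section
variable {A B C : Type*} [Category* A] [Category* B] [Category* C] [Abelian A] [Abelian B] [Abelian C]
  [HasDerivedCategory A] [HasDerivedCategory B] [HasDerivedCategory C]
  (F : A ⥤ B) (G : B ⥤ C) [F.Additive] [G.Additive] [EnoughInjectives A] [EnoughInjectives B]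

open DerivedCategory DerivedCategory.Plus.TStructure Abelian.SpectralObject

/-- The identification `H^{p+q}(RG(Y[-q])) = R^pG(Y)`, natural in `Y`. -/
noncomputable def rightDerSingleIso (p q n : ℤ) (h : p + q = n) :
    Plus.singleFunctor B q ⋙ G.rightDerivedFunctorPlus ⋙ Plus.homologyFunctor C n ≅
      rightDer G p :=
  Functor.isoWhiskerRight ((Plus.singleFunctors B).shiftIso (-q) q 0 (by lia)).symm _ ≪≫
  Functor.associator _ _ _ ≪≫ Functor.isoWhiskerLeft (Plus.singleFunctor B 0)
    ((Functor.associator _ _ _).symm ≪≫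
    Functor.isoWhiskerRight (G.rightDerivedFunctorPlus.commShiftIso (-q)) _ ≪≫
    Functor.associator _ _ _ ≪≫ Functor.isoWhiskerLeft G.rightDerivedFunctorPlus
      ((Plus.homologyFunctor C 0).shiftIso (-q) n p (by lia)))

/-- The identification `E_2^{p,q}(X) = R^pG(R^qF(X))` of the second page: by construction
`E_2^{p,q}(X)` is `H^{p+q}(RG(τ^{≥ q} τ^{< q+1} RF(X)))`, and `τ^{≥ q} τ^{< q+1} RF(X)` is
canonically isomorphic to `R^qF(X)[-q]`. -/
noncomputable def page2Iso (X : A) (p q : ℤ) :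
    (((grothendieckSS F G).obj X).page 2).X (p, q) ≅ (rightDer G p).obj ((rightDer F q).obj X) :=
  spectralSequenceFirstPageXIso ((grothendieckSpectralObject F G).obj X) coreE₂Cohomological (p, q)
    (q : EInt) ((q + 1 : ℤ) : EInt) rfl rfl (p + q) rfl ≪≫
  (G.rightDerivedFunctorPlus ⋙ Plus.homologyFunctor C (p + q)).mapIso
    ((isoSingleHomology ((t.truncGE q).obj ((t.truncLT (q + 1)).obj
      (F.rightDerivedFunctorPlus.obj ((Plus.singleFunctor A 0).obj X)))) q) ≪≫
      (Plus.singleFunctor B q).mapIso (homologyTruncIso _ q)) ≪≫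
  (rightDerSingleIso G p q (p + q) rfl).app _

end

section ExactFunctor

variable {A B : Type*} [Category* A] [Category* B] [Abelian A] [Abelian B]
  [HasDerivedCategory A] [HasDerivedCategory B]
  (K : A ⥤ B) [K.Additive] [PreservesFiniteLimits K] [PreservesFiniteColimits K]

open DerivedCategory

/-- The functor `D⁺(A) ⥤ D⁺(B)` induced by an exact functor `K : A ⥤ B` (`K` is applied termwise
to complexes): an exact functor is its own derived functor. -/
noncomputable def mapPlus : Plus A ⥤ Plus B :=
  (DerivedCategory.TStructure.t (C := B)).plus.lift (Plus.ι ⋙ K.mapDerivedCategory) (by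
    rintro ⟨X, n, L, e, h⟩
    exact ⟨n, (K.mapHomologicalComplex _).obj L,
      K.mapDerivedCategory.mapIso e ≪≫ K.mapDerivedCategoryFactors.app L,
      inferInstanceAs (CochainComplex.IsStrictlyGE ((K.mapHomologicalComplex _).obj L) n)⟩)

/-- `mapPlus K` is induced by the functor which applies `K` termwise. -/
noncomputable def mapPlusFactors :
    Plus.Qh ⋙ mapPlus K ≅ K.mapHomotopyCategoryPlus ⋙ Plus.Qh :=
  Functor.fullyFaithfulCancelRight Plus.ι
    (Functor.isoWhiskerLeft (HomotopyCategory.Plus.ι A) K.mapDerivedCategoryFactorsh :)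

/-- `mapPlus K` commutes with the functors `X ↦ X[-n]`. -/
noncomputable def mapPlusSingle (n : ℤ) :
    Plus.singleFunctor A n ⋙ mapPlus K ≅ K ⋙ Plus.singleFunctor B n :=
  Functor.fullyFaithfulCancelRight Plus.ι (K.mapDerivedCategorySingleFunctor n :)

/-- An exact functor commutes with the cohomology of complexes. -/
noncomputable def QmapDerivedCategoryHomology (n : ℤ) :
    DerivedCategory.Q ⋙ K.mapDerivedCategory ⋙ homologyFunctor B n ≅
      DerivedCategory.Q ⋙ homologyFunctor A n ⋙ K :=
  (Functor.associator _ _ _).symm ≪≫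
    Functor.isoWhiskerRight K.mapDerivedCategoryFactors _ ≪≫ Functor.associator _ _ _ ≪≫
    Functor.isoWhiskerLeft (K.mapHomologicalComplex _) (homologyFunctorFactors B n) ≪≫
    (NatIso.ofComponents (fun L => mapHomologyIso K L n)
      (fun f => mapHomologyIso_hom_naturality K f n) :
        K.mapHomologicalComplex _ ⋙ HomologicalComplex.homologyFunctor B (ComplexShape.up ℤ) n ≅
        HomologicalComplex.homologyFunctor A (ComplexShape.up ℤ) n ⋙ K) ≪≫
    Functor.isoWhiskerRight (homologyFunctorFactors A n).symm K ≪≫ Functor.associator _ _ _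

/-- An exact functor commutes with cohomology on the derived category. -/
noncomputable def mapDerivedCategoryHomology (n : ℤ) :
    K.mapDerivedCategory ⋙ homologyFunctor B n ≅ homologyFunctor A n ⋙ K :=
  letI : Localization.Lifting DerivedCategory.Q (HomologicalComplex.quasiIso A (.up ℤ))
    (DerivedCategory.Q ⋙ K.mapDerivedCategory ⋙ homologyFunctor B n)
    (K.mapDerivedCategory ⋙ homologyFunctor B n) := ⟨Iso.refl _⟩
  letI : Localization.Lifting DerivedCategory.Q (HomologicalComplex.quasiIso A (.up ℤ))
    (DerivedCategory.Q ⋙ homologyFunctor A n ⋙ K)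
    (homologyFunctor A n ⋙ K) := ⟨Iso.refl _⟩
  Localization.liftNatIso DerivedCategory.Q (HomologicalComplex.quasiIso A (.up ℤ))
    (DerivedCategory.Q ⋙ K.mapDerivedCategory ⋙ homologyFunctor B n)
    (DerivedCategory.Q ⋙ homologyFunctor A n ⋙ K) _ _ (QmapDerivedCategoryHomology K n)

/-- An exact functor commutes with cohomology on `D⁺`. -/
noncomputable def mapPlusHomology (n : ℤ) :
    mapPlus K ⋙ Plus.homologyFunctor B n ≅ Plus.homologyFunctor A n ⋙ K :=
  (Functor.isoWhiskerLeft Plus.ι (mapDerivedCategoryHomology K n) :)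

end ExactFunctor

section Derived

variable {A B : Type*} [Category* A] [Category* B] [Abelian A] [Abelian B]
  [HasDerivedCategory A] [HasDerivedCategory B]
  (F : A ⥤ B) [F.Additive] [EnoughInjectives A] {E : Type*} [Category* E]

open DerivedCategory

/-- If `RF` is the right derived functor of `F`, then `RF ⋙ T` is the right derived functor of
`F` followed by `T`, with this unit. -/
noncomputable def unitComp (T : Plus B ⥤ E) :
    F.mapHomotopyCategoryPlus ⋙ Plus.Qh ⋙ T ⟶ Plus.Qh ⋙ F.rightDerivedFunctorPlus ⋙ T :=
  Functor.whiskerRight F.rightDerivedFunctorPlusUnit T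

instance (T : Plus B ⥤ E) : (F.rightDerivedFunctorPlus ⋙ T).IsRightDerivedFunctor
    (unitComp F T) (HomotopyCategory.Plus.quasiIso A) :=
  (HomotopyCategory.Plus.localizerMorphism_derives
    (F.mapHomotopyCategoryPlus ⋙ Plus.Qh ⋙ T)).isRightDerivedFunctor_of_isIso (unitComp F T)
      (fun K => inferInstanceAs (IsIso (T.map (F.rightDerivedFunctorPlusUnit.app
        ((InjectiveObject.ι A).mapHomotopyCategoryPlus.obj K)))))

/-- The natural transformation induced on bounded below homotopy categories. -/
noncomputable def mapHPlus {F F' : A ⥤ B} [F.Additive] [F'.Additive] (α : F ⟶ F') :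
    F.mapHomotopyCategoryPlus ⟶ F'.mapHomotopyCategoryPlus where
  app K := ObjectProperty.homMk ((NatTrans.mapHomotopyCategory α (.up ℤ)).app K.obj)
  naturality K L f := by
    ext
    exact (NatTrans.mapHomotopyCategory α (.up ℤ)).naturality f.hom

end Derived

section Square

variable {A B A' B' : Type*} [Category* A] [Category* B] [Category* A'] [Category* B']
  [Abelian A] [Abelian B] [Abelian A'] [Abelian B']
  [HasDerivedCategory A] [HasDerivedCategory B] [HasDerivedCategory A'] [HasDerivedCategory B']
  [EnoughInjectives A] [EnoughInjectives A']
  {F : A ⥤ B} {F' : A' ⥤ B'} {KA : A ⥤ A'} {KB : B ⥤ B'}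
  [F.Additive] [F'.Additive] [KA.Additive] [KB.Additive]
  [PreservesFiniteLimits KA] [PreservesFiniteColimits KA]
  [PreservesFiniteLimits KB] [PreservesFiniteColimits KB]
  (N : F ⋙ KB ⟶ KA ⋙ F')

open DerivedCategory

/-- The natural transformation `q KB F ⟶ q F' KA ⟶ RF' q KA = RF' KA q` of functors on the
bounded below homotopy category of `A`, given by `N` and the unit of `RF'`. -/
noncomputable def derivedNatTransAux :
    F.mapHomotopyCategoryPlus ⋙ Plus.Qh ⋙ mapPlus KB ⟶
      Plus.Qh ⋙ mapPlus KA ⋙ F'.rightDerivedFunctorPlus :=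
  Functor.whiskerLeft _ (mapPlusFactors KB).hom ≫
  Functor.whiskerRight ((Functor.mapHomotopyCategoryPlusCompIso (Iso.refl (F ⋙ KB))).hom ≫
    mapHPlus N ≫ (Functor.mapHomotopyCategoryPlusCompIso (Iso.refl (KA ⋙ F'))).inv) Plus.Qh ≫
  Functor.whiskerLeft KA.mapHomotopyCategoryPlus F'.rightDerivedFunctorPlusUnit ≫
  Functor.whiskerRight (mapPlusFactors KA).inv F'.rightDerivedFunctorPlus

/-- The natural transformation `KB ∘ RF ⟶ RF' ∘ KA` of functors `D⁺(A) ⥤ D⁺(B')` induced by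
`N : KB ∘ F ⟶ F' ∘ KA`. It is the unique one which is compatible with `N` and with the
units of `RF` and `RF'`, as given by the universal property of the right derived functor
`KB ∘ RF` of `KB ∘ F`. -/
noncomputable def derivedNatTrans :
    F.rightDerivedFunctorPlus ⋙ mapPlus KB ⟶ mapPlus KA ⋙ F'.rightDerivedFunctorPlus :=
  (F.rightDerivedFunctorPlus ⋙ mapPlus KB).rightDerivedDesc (unitComp F (mapPlus KB))
    (HomotopyCategory.Plus.quasiIso A) _ (derivedNatTransAux N)

/-- The natural transformation `KB(RⁿF(X)) ⟶ RⁿF'(KA(X))` induced by `N : KB ∘ F ⟶ F' ∘ KA`. -/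
noncomputable def rightDerNatTrans (n : ℤ) :
    rightDer F n ⋙ KB ⟶ KA ⋙ rightDer F' n :=
  Functor.whiskerLeft (Plus.singleFunctor A 0) (
    Functor.whiskerLeft F.rightDerivedFunctorPlus (mapPlusHomology KB n).inv ≫
    Functor.whiskerRight (derivedNatTrans N) (Plus.homologyFunctor B' n)) ≫
  Functor.whiskerRight (mapPlusSingle KA 0).hom
    (F'.rightDerivedFunctorPlus ⋙ Plus.homologyFunctor B' n)

end Square

section Composition

variable {A B C : Type*} [Category* A] [Category* B] [Category* C] [Abelian A] [Abelian B] [Abelian C]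
  [HasDerivedCategory A] [HasDerivedCategory B] [HasDerivedCategory C]
  [EnoughInjectives A] [EnoughInjectives B]
  (F : A ⥤ B) (G : B ⥤ C) [F.Additive] [G.Additive]

open DerivedCategory

/-- The natural transformation `q (GF) ⟶ RG q F ⟶ RG RF q` given by the units. -/
noncomputable def rightDerivedCompAux :
    (F ⋙ G).mapHomotopyCategoryPlus ⋙ Plus.Qh ⟶
      Plus.Qh ⋙ F.rightDerivedFunctorPlus ⋙ G.rightDerivedFunctorPlus :=
  Functor.whiskerRight (Functor.mapHomotopyCategoryPlusCompIso (Iso.refl (F ⋙ G))).inv Plus.Qh ≫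
  Functor.whiskerLeft F.mapHomotopyCategoryPlus G.rightDerivedFunctorPlusUnit ≫
  Functor.whiskerRight F.rightDerivedFunctorPlusUnit G.rightDerivedFunctorPlus

/-- The canonical natural transformation `R(GF) ⟶ RG ∘ RF`, which is unique to be compatible
with the units. It is an isomorphism when `F` preserves injective objects. -/
noncomputable def rightDerivedComp :
    (F ⋙ G).rightDerivedFunctorPlus ⟶ F.rightDerivedFunctorPlus ⋙ G.rightDerivedFunctorPlus :=
  (F ⋙ G).rightDerivedFunctorPlus.rightDerivedDesc (F ⋙ G).rightDerivedFunctorPlusUnit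
    (HomotopyCategory.Plus.quasiIso A) _ (rightDerivedCompAux F G)

variable [F.PreservesInjectiveObjects]

/-- The functor induced on the full subcategories of injective objects. -/
noncomputable def mapInj : InjectiveObject A ⥤ InjectiveObject B :=
  ObjectProperty.lift _ (InjectiveObject.ι A ⋙ F) (fun I => F.injective_obj I.obj)

instance : (mapInj F).Additive where
  map_add {_ _ f g} := by ext; exact F.map_add

instance (K : HomotopyCategory.Plus (InjectiveObject A)) :
    IsIso ((rightDerivedCompAux F G).app ((InjectiveObject.ι A).mapHomotopyCategoryPlus.obj K)) := by
  have e : F.mapHomotopyCategoryPlus.obj ((InjectiveObject.ι A).mapHomotopyCategoryPlus.obj K) ≅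
    (InjectiveObject.ι B).mapHomotopyCategoryPlus.obj ((mapInj F).mapHomotopyCategoryPlus.obj K) :=
    (Functor.mapHomotopyCategoryPlusCompIso (Iso.refl (InjectiveObject.ι A ⋙ F))).app K ≪≫
      ((Functor.mapHomotopyCategoryPlusCompIso (F := mapInj F) (G := InjectiveObject.ι B)
        (H := InjectiveObject.ι A ⋙ F) (Iso.refl _)).app K).symm
  have h₁ : IsIso (G.rightDerivedFunctorPlusUnit.app (F.mapHomotopyCategoryPlus.obj
      ((InjectiveObject.ι A).mapHomotopyCategoryPlus.obj K))) := by
    rw [NatTrans.isIso_app_iff_of_iso _ e]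
    infer_instance
  have h₂ : IsIso (G.rightDerivedFunctorPlus.map (F.rightDerivedFunctorPlusUnit.app
      ((InjectiveObject.ι A).mapHomotopyCategoryPlus.obj K))) := inferInstance
  have h₃ : IsIso (Plus.Qh.map ((Functor.mapHomotopyCategoryPlusCompIso
    (Iso.refl (F ⋙ G))).inv.app ((InjectiveObject.ι A).mapHomotopyCategoryPlus.obj K))) :=
    inferInstance
  exact @IsIso.comp_isIso _ _ _ _ _ _ _ h₃ (@IsIso.comp_isIso _ _ _ _ _ _ _ h₁ h₂)

instance : IsIso (rightDerivedComp F G) := by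
  have := (HomotopyCategory.Plus.localizerMorphism_derives
    ((F ⋙ G).mapHomotopyCategoryPlus ⋙ Plus.Qh)).isRightDerivedFunctor_of_isIso
      (rightDerivedCompAux F G) (fun K => inferInstanceAs (IsIso ((rightDerivedCompAux F G).app
        ((InjectiveObject.ι A).mapHomotopyCategoryPlus.obj K))))
  exact (Functor.isRightDerivedFunctor_iff_isIso_rightDerivedDesc _
    (F ⋙ G).rightDerivedFunctorPlusUnit (HomotopyCategory.Plus.quasiIso A) _
      (rightDerivedCompAux F G)).1 this

/-- `Rⁿ(GF)(X) ≅ Hⁿ(RG(RF(X)))`, induced by the canonical isomorphism `R(GF) ≅ RG ∘ RF`. -/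
noncomputable def rightDerCompIso (n : ℤ) :
    rightDer (F ⋙ G) n ≅ Plus.singleFunctor A 0 ⋙ (F.rightDerivedFunctorPlus ⋙
      G.rightDerivedFunctorPlus) ⋙ Plus.homologyFunctor C n :=
  Functor.isoWhiskerLeft (Plus.singleFunctor A 0)
    (Functor.isoWhiskerRight (asIso (rightDerivedComp F G)) (Plus.homologyFunctor C n))

end Composition

section Convergence

variable {C D : Type*} [Category* C] [Category* D] [Abelian C] [Abelian D]

/-- The data of a convergence `E_r^{p,q} ⇒ H^{p+q}` of a cohomological spectral sequence:
a finite decreasing filtration of each `Hⁿ`, and identifications of its graded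
pieces with the limit terms `E_∞^{p,q}`. Here, each bidegree `(p, q)` has a bound from which on all
the differentials to and from `E_r^{p,q}` vanish, so that `E_∞^{p,q}` is `E_r^{p,q}` for
any `r` beyond it; the identifications for different `r` have to be compatible. -/
structure Convergence (E : E₂CohomologicalSpectralSequence C) (H : ℤ → C) where
  /-- the step `F^p` of the filtration of `Hⁿ` -/
  fil (n p : ℤ) : C
  /-- the inclusion `F^p ⟶ Hⁿ` -/
  ι (n p : ℤ) : fil n p ⟶ H n
  mono_ι (n p : ℤ) : Mono (ι n p)
  /-- the inclusion `F^{p+1} ⟶ F^p` -/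
  sub (n p : ℤ) : fil n (p + 1) ⟶ fil n p
  sub_ι (n p : ℤ) : sub n p ≫ ι n p = ι n (p + 1)
  exhaustive (n : ℤ) : ∃ p, IsIso (ι n p)
  separated (n : ℤ) : ∃ p, IsZero (fil n p)
  /-- a page from which on the differentials at the bidegree `(p, q)` vanish -/
  bound (p q : ℤ) : ℤ
  two_le_bound (p q : ℤ) : 2 ≤ bound p q
  d_from (p q r : ℤ) (hr : bound p q ≤ r) (pq' : ℤ × ℤ) :
    (E.page r ((two_le_bound p q).trans hr)).d (p, q) pq' = 0
  d_to (p q r : ℤ) (hr : bound p q ≤ r) (pq' : ℤ × ℤ) :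
    (E.page r ((two_le_bound p q).trans hr)).d pq' (p, q) = 0
  /-- the projection `F^p H^{p+q} ⟶ E_r^{p,q} = E_∞^{p,q}` -/
  π (n p q r : ℤ) (h : p + q = n) (hr : bound p q ≤ r) :
    fil n p ⟶ (E.page r ((two_le_bound p q).trans hr)).X (p, q)
  sub_π (n p q r : ℤ) (h : p + q = n) (hr : bound p q ≤ r) : sub n p ≫ π n p q r h hr = 0
  /-- the exact sequence `0 ⟶ F^{p+1} ⟶ F^p ⟶ E_∞^{p,q} ⟶ 0` -/
  shortExact (n p q r : ℤ) (h : p + q = n) (hr : bound p q ≤ r) :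
    (ShortComplex.mk _ _ (sub_π n p q r h hr)).ShortExact
  /-- compatibility with the identification of `E_{r+1}^{p,q}` with the homology of `E_r` -/
  π_succ (n p q r r' : ℤ) (h : p + q = n) (hr : bound p q ≤ r) (hrr' : r + 1 = r') :
    (E.page r ((two_le_bound p q).trans hr)).liftCycles (π n p q r h hr) _ rfl
      (by rw [d_from p q r hr, comp_zero]) ≫
    (E.page r ((two_le_bound p q).trans hr)).homologyπ (p, q) ≫
      (E.iso r r' (p, q) hrr' ((two_le_bound p q).trans hr)).hom = π n p q r' h (by lia)

namespace Convergence

variable {E : E₂CohomologicalSpectralSequence C} {H : ℤ → C}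

/-- Transport of the abutment along isomorphisms. -/
@[simps]
noncomputable def ofIso (c : Convergence E H) {H' : ℤ → C} (e : ∀ n, H n ≅ H' n) :
    Convergence E H' where
  fil := c.fil
  ι n p := c.ι n p ≫ (e n).hom
  mono_ι n p := by
    have := c.mono_ι n p
    infer_instance
  sub := c.sub
  sub_ι n p := by rw [← assoc, c.sub_ι]
  exhaustive n := by
    obtain ⟨p, hp⟩ := c.exhaustive n
    exact ⟨p, inferInstance⟩
  separated := c.separated
  bound := c.bound
  two_le_bound := c.two_le_bound
  d_from := c.d_from
  d_to := c.d_to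
  π := c.π
  sub_π := c.sub_π
  shortExact := c.shortExact
  π_succ := c.π_succ

lemma sc_liftCycles_mapHomologyIso (K : C ⥤ D) [K.Additive]
    [PreservesFiniteLimits K] [PreservesFiniteColimits K] (S : ShortComplex C) {X : C}
    (f : X ⟶ S.X₂) (w : f ≫ S.g = 0) (w' : K.map f ≫ (S.map K).g = 0) :
    (S.map K).liftCycles (K.map f) w' ≫ (S.map K).homologyπ ≫ (S.mapHomologyIso K).hom =
      K.map (S.liftCycles f w ≫ S.homologyπ) := by
  have h₁ : (S.map K).liftCycles (K.map f) w' ≫ (S.mapCyclesIso K).hom =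
      K.map (S.liftCycles f w) := by
    rw [← cancel_mono (K.map S.iCycles), assoc, ShortComplex.mapCyclesIso_hom_iCycles,
      ← K.map_comp, ShortComplex.liftCycles_i]
    exact ShortComplex.liftCycles_i _ _ _
  have h₂ : (S.map K).homologyπ ≫ (S.mapHomologyIso K).hom =
      (S.mapCyclesIso K).hom ≫ K.map S.homologyπ := by
    rw [S.leftHomologyData.mapHomologyIso_eq K, S.leftHomologyData.mapCyclesIso_eq K]
    refine (ShortComplex.LeftHomologyData.homologyπ_comp_homologyIso_hom_assoc _
      (S.leftHomologyData.map K) (K.map S.leftHomologyData.homologyIso.inv)).trans ?_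
    refine Eq.trans (whisker_eq _ ?_) (assoc _ _ _).symm
    refine (K.map_comp _ _).symm.trans (Eq.trans ?_ (K.map_comp _ _))
    rw [ShortComplex.LeftHomologyData.π_comp_homologyIso_inv]
    rfl
  refine (whisker_eq _ h₂).trans ((assoc _ _ _).symm.trans ?_)
  exact (h₁ =≫ _).trans (K.map_comp _ _).symm

lemma liftCycles_mapHomologyIso {κ : Type*} {s : ComplexShape κ} (K : C ⥤ D) [K.Additive]
    [PreservesFiniteLimits K] [PreservesFiniteColimits K] (L : HomologicalComplex C s)
    {X : C} (i j : κ) (f : X ⟶ L.X i) (hj : s.next i = j) (w : f ≫ L.d i j = 0)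
    (w' : K.map f ≫ ((K.mapHomologicalComplex s).obj L).d i j = 0) :
    ((K.mapHomologicalComplex s).obj L).liftCycles (K.map f) j hj w' ≫
      ((K.mapHomologicalComplex s).obj L).homologyπ i ≫ (mapHomologyIso K L i).hom =
    K.map (L.liftCycles f j hj w ≫ L.homologyπ i) := by
  subst hj
  exact sc_liftCycles_mapHomologyIso K (L.sc i) f w w'

/-- The convergence `K(E_r^{p,q}) ⇒ K(H^{p+q})` obtained by applying an exact functor `K`. -/
noncomputable def map (c : Convergence E H) (K : C ⥤ D) [K.Additive]
    [PreservesFiniteLimits K] [PreservesFiniteColimits K] :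
    Convergence ((mapSpectralSequence K).obj E) (fun n => K.obj (H n)) where
  fil n p := K.obj (c.fil n p)
  ι n p := K.map (c.ι n p)
  mono_ι n p := by
    have := c.mono_ι n p
    infer_instance
  sub n p := K.map (c.sub n p)
  sub_ι n p := by rw [← K.map_comp, c.sub_ι]
  exhaustive n := by
    obtain ⟨p, hp⟩ := c.exhaustive n
    exact ⟨p, inferInstance⟩
  separated n := by
    obtain ⟨p, hp⟩ := c.separated n
    exact ⟨p, K.map_isZero hp⟩
  bound := c.bound
  two_le_bound := c.two_le_bound
  d_from p q r hr pq' := (K.congr_map (c.d_from p q r hr pq')).trans (K.map_zero _ _)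
  d_to p q r hr pq' := (K.congr_map (c.d_to p q r hr pq')).trans (K.map_zero _ _)
  π n p q r h hr := K.map (c.π n p q r h hr)
  sub_π n p q r h hr := by
    refine (K.map_comp _ _).symm.trans ?_
    exact (K.congr_map (c.sub_π n p q r h hr)).trans (K.map_zero _ _)
  shortExact n p q r h hr := (c.shortExact n p q r h hr).map_of_exact K
  π_succ n p q r r' h hr hrr' := by
    have h₁ := liftCycles_mapHomologyIso K (E.page r ((c.two_le_bound p q).trans hr)) (p, q) _
      (c.π n p q r h hr) rfl (by rw [c.d_from p q r hr, comp_zero])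
      ((whisker_eq _ ((K.congr_map (c.d_from p q r hr _)).trans (K.map_zero _ _))).trans comp_zero)
    have h₂ := K.congr_map (c.π_succ n p q r r' h hr hrr')
    refine Eq.trans ?_ h₂
    refine Eq.trans ?_ ((K.congr_map (assoc _ _ _)).symm.trans (K.map_comp _ _)).symm
    refine Eq.trans ?_ (h₁ =≫ _)
    exact (whisker_eq _ (assoc _ _ _).symm).trans (assoc _ _ _).symm

/-- A morphism `Φ` of converging spectral sequences and a family of morphisms `φ n` between the
abutments are compatible if the `φ n` preserve the filtrations and induce on the
graded pieces the morphisms given by `Φ` on the limit terms. -/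
def Compatible {E' : E₂CohomologicalSpectralSequence C} {H' : ℤ → C} (c : Convergence E H)
    (c' : Convergence E' H') (Φ : E ⟶ E') (φ : ∀ n, H n ⟶ H' n) : Prop :=
  ∃ (f : ∀ n p, c.fil n p ⟶ c'.fil n p),
    (∀ n p, f n p ≫ c'.ι n p = c.ι n p ≫ φ n) ∧
    ∀ (n p q r : ℤ) (h : p + q = n) (hr : c.bound p q ≤ r) (hr' : c'.bound p q ≤ r),
      c.π n p q r h hr ≫ (SpectralSequence.Hom.hom Φ r ((c.two_le_bound p q).trans hr)).f (p, q) =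
        f n p ≫ c'.π n p q r h hr'

end Convergence

end Convergence

section SSConvergence

open ComposableArrows Abelian Abelian.SpectralObject

variable {C : Type*} [Category* C] [Abelian C] (Y : Abelian.SpectralObject C EInt)

lemma i₀_le (pq : ℤ × ℤ) (r : ℤ) (hr : 2 ≤ r) :
    ((pq.2 - r + 2 : ℤ) : EInt) ≤ (pq.2 : EInt) := coreE₂Cohomological.le₀₁ r pq

lemma i₁_le (pq : ℤ × ℤ) : (pq.2 : EInt) ≤ ((pq.2 + 1 : ℤ) : EInt) := coreE₂Cohomological.le₁₂ pq

lemma i₂_le (pq : ℤ × ℤ) (r : ℤ) (hr : 2 ≤ r) :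
    ((pq.2 + 1 : ℤ) : EInt) ≤ ((pq.2 + r - 1 : ℤ) : EInt) := coreE₂Cohomological.le₂₃ r pq

lemma le₀₁ (pq : ℤ × ℤ) (r : ℤ) (hr : 2 ≤ r) (i₁ : EInt) (h₁ : i₁ = (pq.2 : EInt)) :
    ((pq.2 - r + 2 : ℤ) : EInt) ≤ i₁ := by rw [h₁]; exact i₀_le pq r hr

lemma le₁₂ (pq : ℤ × ℤ) (i₁ i₂ : EInt) (h₁ : i₁ = (pq.2 : EInt))
    (h₂ : i₂ = ((pq.2 + 1 : ℤ) : EInt)) : i₁ ≤ i₂ := by rw [h₁, h₂]; exact i₁_le pq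

lemma le₂₃ (pq : ℤ × ℤ) (r : ℤ) (hr : 2 ≤ r) (i₂ : EInt) (h₂ : i₂ = ((pq.2 + 1 : ℤ) : EInt)) :
    i₂ ≤ ((pq.2 + r - 1 : ℤ) : EInt) := by rw [h₂]; exact i₂_le pq r hr

section

variable (pq : ℤ × ℤ) (r : ℤ) (hr : 2 ≤ r) (i₁ i₂ : EInt) (h₁ : i₁ = (pq.2 : EInt))
  (h₂ : i₂ = ((pq.2 + 1 : ℤ) : EInt)) (n : ℤ) (hn : n = pq.1 + pq.2)
  (hz₀ : IsZero ((Y.H (n + 1)).obj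
    (mk₁ (homOfLE (bot_le : ⊥ ≤ ((pq.2 - r + 2 : ℤ) : EInt))))))
  (hz₃ : IsZero ((Y.H (n - 1)).obj (mk₁ (homOfLE (le_top : ((pq.2 + r - 1 : ℤ) : EInt) ≤ ⊤)))))

/-- The identification of the infinite page with the `r`th page. -/
noncomputable def infPageIso :
    Y.E (homOfLE (bot_le : ⊥ ≤ i₁)) (homOfLE (le₁₂ pq i₁ i₂ h₁ h₂)) (homOfLE (le_top : i₂ ≤ ⊤))
      (n - 1) n (n + 1) ≅
    (Y.E₂SpectralSequence.page r hr).X pq :=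
  Y.isoMapFourδ₁Toδ₀' ⊥ ((pq.2 - r + 2 : ℤ) : EInt) i₁ i₂ ⊤ bot_le (le₀₁ pq r hr i₁ h₁)
    (le₁₂ pq i₁ i₂ h₁ h₂) le_top (n - 1) n (n + 1) hz₀ ≪≫
  (Y.isoMapFourδ₄Toδ₃' ((pq.2 - r + 2 : ℤ) : EInt) i₁ i₂ ((pq.2 + r - 1 : ℤ) : EInt) ⊤
    (le₀₁ pq r hr i₁ h₁) (le₁₂ pq i₁ i₂ h₁ h₂) (le₂₃ pq r hr i₂ h₂) le_top (n - 1) n (n + 1) hz₃).symm ≪≫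
  (Y.spectralSequencePageXIso coreE₂Cohomological r hr pq _ i₁ i₂ _ rfl h₁ h₂ rfl (n - 1) n (n + 1)
    hn).symm

end

section

variable {Y} {a i₀' i₀ i₁ i₂ i₃ i₃' b : EInt} (h₀ : a ≤ i₀') (h₀' : i₀' ≤ i₀) (h₁ : i₀ ≤ i₁)
  (h₂ : i₁ ≤ i₂) (h₃ : i₂ ≤ i₃) (h₃' : i₃ ≤ i₃') (h₄ : i₃' ≤ b) (n₀ n₁ n₂ : ℤ)
  (hn₁ : n₀ + 1 = n₁) (hn₂ : n₁ + 1 = n₂)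

lemma infPageIso_aux₁
    (hz : IsZero ((Y.H n₀).obj (mk₁ (homOfLE (h₃'.trans h₄))))) :
    Y.mapFourδ₁Toδ₀' a i₀ i₁ i₂ b (h₀.trans h₀') h₁ h₂ (h₃.trans (h₃'.trans h₄))
        n₀ n₁ n₂ hn₁ hn₂ ≫
      (Y.isoMapFourδ₄Toδ₃' i₀ i₁ i₂ i₃ b h₁ h₂ h₃ (h₃'.trans h₄) n₀ n₁ n₂ hz hn₁ hn₂).inv =
    (Y.mapFourδ₁Toδ₀' a i₀' i₁ i₂ b h₀ (h₀'.trans h₁) h₂ (h₃.trans (h₃'.trans h₄))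
        n₀ n₁ n₂ hn₁ hn₂ ≫
      (Y.isoMapFourδ₄Toδ₃' i₀' i₁ i₂ i₃ b (h₀'.trans h₁) h₂ h₃ (h₃'.trans h₄)
        n₀ n₁ n₂ hz hn₁ hn₂).inv) ≫
      Y.mapFourδ₁Toδ₀' i₀' i₀ i₁ i₂ i₃ h₀' h₁ h₂ h₃ n₀ n₁ n₂ hn₁ hn₂ := by
  refine (Iso.comp_inv_eq _).2 ?_
  refine Eq.trans ?_ (assoc _ _ _).symm
  refine Eq.trans ?_ (whisker_eq _ (Y.mapFourδ₁Toδ₀'_mapFourδ₃Toδ₃' i₀' i₀ i₁ i₂ i₃ b h₀' h₁ h₂ h₃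
    (h₃'.trans h₄) n₀ n₁ n₂ hn₁ hn₂).symm)
  refine Eq.trans ?_ (assoc _ _ _).symm
  refine Eq.trans ?_ (whisker_eq _ (Y.isoMapFourδ₄Toδ₄'_inv_hom_id_assoc i₀' i₁ i₂ i₃ b
    (h₀'.trans h₁) h₂ h₃ (h₃'.trans h₄) n₀ n₁ n₂ hz hn₁ hn₂ _).symm)
  exact (Y.mapFourδ₁Toδ₀'_comp a i₀' i₀ i₁ i₂ b h₀ h₀' h₁ h₂ (h₃.trans (h₃'.trans h₄))
    n₀ n₁ n₂ hn₁ hn₂).symm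

lemma infPageIso_aux₂
    (hz : IsZero ((Y.H n₀).obj (mk₁ (homOfLE (h₃'.trans h₄)))))
    (hz' : IsZero ((Y.H n₀).obj (mk₁ (homOfLE h₄)))) :
    (Y.isoMapFourδ₄Toδ₃' i₀ i₁ i₂ i₃' b h₁ h₂ (h₃.trans h₃') h₄ n₀ n₁ n₂ hz' hn₁ hn₂).inv =
      (Y.isoMapFourδ₄Toδ₃' i₀ i₁ i₂ i₃ b h₁ h₂ h₃ (h₃'.trans h₄) n₀ n₁ n₂ hz hn₁ hn₂).inv ≫
      Y.mapFourδ₄Toδ₃' i₀ i₁ i₂ i₃ i₃' h₁ h₂ h₃ h₃' n₀ n₁ n₂ hn₁ hn₂ := by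
  refine (Iso.eq_inv_comp _).2 ((Iso.comp_inv_eq _).2 ?_)
  exact (Y.mapFourδ₄Toδ₃'_comp i₀ i₁ i₂ i₃ i₃' b h₁ h₂ h₃ h₃' h₄ n₀ n₁ n₂ hn₁ hn₂).symm

end

lemma infPageIso_succ (pq : ℤ × ℤ) (r r' : ℤ) (hrr' : r + 1 = r') (hr : 2 ≤ r)
    (i₁ i₂ : EInt) (h₁ : i₁ = (pq.2 : EInt))
    (h₂ : i₂ = ((pq.2 + 1 : ℤ) : EInt)) (n : ℤ) (hn : n = pq.1 + pq.2)
    (hz₀ : IsZero ((Y.H (n + 1)).obj (mk₁ (homOfLE (bot_le : ⊥ ≤ ((pq.2 - r + 2 : ℤ) : EInt))))))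
    (hz₃ : IsZero ((Y.H (n - 1)).obj (mk₁ (homOfLE (le_top : ((pq.2 + r - 1 : ℤ) : EInt) ≤ ⊤)))))
    (hz₀' : IsZero ((Y.H (n + 1)).obj (mk₁ (homOfLE (bot_le : ⊥ ≤ ((pq.2 - r' + 2 : ℤ) : EInt))))))
    (hz₃' : IsZero ((Y.H (n - 1)).obj (mk₁ (homOfLE (le_top : ((pq.2 + r' - 1 : ℤ) : EInt) ≤ ⊤)))))
    {Z : C} (x : Z ⟶ Y.E (homOfLE (bot_le : ⊥ ≤ i₁)) (homOfLE (le₁₂ pq i₁ i₂ h₁ h₂))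
      (homOfLE (le_top : i₂ ≤ ⊤)) (n - 1) n (n + 1))
    (w : (x ≫ (infPageIso Y pq r hr i₁ i₂ h₁ h₂ n hn hz₀ hz₃).hom) ≫
      (Y.E₂SpectralSequence.page r hr).d pq _ = 0) :
    (Y.E₂SpectralSequence.page r hr).liftCycles
      (x ≫ (infPageIso Y pq r hr i₁ i₂ h₁ h₂ n hn hz₀ hz₃).hom) _ rfl w ≫
      (Y.E₂SpectralSequence.page r hr).homologyπ pq ≫
      (Y.E₂SpectralSequence.iso r r' pq hrr' hr).hom =
    x ≫ (infPageIso Y pq r' (by lia) i₁ i₂ h₁ h₂ n hn hz₀' hz₃').hom := by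
  subst h₁ h₂ hn
  let y := Y.mapFourδ₁Toδ₀' _ _ _ _ _ bot_le (i₀_le pq r' (by lia)) (i₁_le pq) le_top
      (pq.1 + pq.2 - 1) (pq.1 + pq.2) (pq.1 + pq.2 + 1) (by lia) (by lia) ≫
     (Y.isoMapFourδ₄Toδ₃' _ _ _ _ _ (i₀_le pq r' (by lia)) (i₁_le pq) (i₂_le pq r hr) le_top
       (pq.1 + pq.2 - 1) (pq.1 + pq.2) (pq.1 + pq.2 + 1) hz₃ (by lia) (by lia)).inv
  have e : (infPageIso Y pq r hr _ _ rfl rfl _ rfl hz₀ hz₃).hom =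
    y ≫ (pageι Y coreE₂Cohomological r r' hrr' hr pq ≫
      (pageIso Y coreE₂Cohomological r hr pq).inv) := by
    have h := infPageIso_aux₁ (Y := Y) bot_le (coreE₂Cohomological.i₀_le r r' pq) (i₀_le pq r hr)
      (i₁_le pq) (i₂_le pq r hr) le_rfl le_top
      (pq.1 + pq.2 - 1) (pq.1 + pq.2) (pq.1 + pq.2 + 1) (by lia) (by lia) hz₃
    exact (assoc _ _ _).symm.trans ((h =≫ _).trans (assoc _ _ _))
  have e' : (infPageIso Y pq r' (by lia) _ _ rfl rfl _ rfl hz₀' hz₃').hom =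
    y ≫ (pageπ Y coreE₂Cohomological r r' hrr' hr pq ≫
      (pageIso Y coreE₂Cohomological r' (by lia) pq).inv) := by
    have h := infPageIso_aux₂ (Y := Y) (i₀_le pq r' (by lia))
      (i₁_le pq) (i₂_le pq r hr) (coreE₂Cohomological.i₃_le r r' pq) le_top
      (pq.1 + pq.2 - 1) (pq.1 + pq.2) (pq.1 + pq.2 + 1) (by lia) (by lia) hz₃ hz₃'
    exact (whisker_eq _ ((h =≫ _).trans (assoc _ _ _))).trans (assoc _ _ _).symm
  have h := pageCycles_homologyπ_iso Y coreE₂Cohomological r r' hrr' hr pq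
  have h' : (Y.E₂SpectralSequence.page r hr).liftCycles
      (x ≫ (infPageIso Y pq r hr _ _ rfl rfl _ rfl hz₀ hz₃).hom) _ rfl w =
      (x ≫ y) ≫ pageCycles Y coreE₂Cohomological r r' hrr' hr pq := by
    rw [← cancel_mono (HomologicalComplex.iCycles _ _), HomologicalComplex.liftCycles_i]
    refine Eq.trans ?_ (assoc _ _ _).symm
    refine Eq.trans ?_ (whisker_eq _ (HomologicalComplex.liftCycles_i _ _ _ rfl
      (pageι_d Y coreE₂Cohomological r r' hrr' hr pq))).symm
    exact (whisker_eq x e).trans (assoc _ _ _).symm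
  rw [h', e']
  refine (assoc _ _ _).trans ((whisker_eq _ h).trans (assoc _ _ _))

lemma opcyclesMap_three_fromOpcycles {i₀ i₁ i₂ i₃ : EInt} (f₁ : i₀ ⟶ i₁) (f₂ : i₁ ⟶ i₂)
    (f₃ : i₂ ⟶ i₃) (f₁₂ : i₀ ⟶ i₂) (f₂₃ : i₁ ⟶ i₃) (h₁₂ : f₁ ≫ f₂ = f₁₂) (h₂₃ : f₂ ≫ f₃ = f₂₃)
    (f : i₀ ⟶ i₃) (h : f₁₂ ≫ f₃ = f) (h' : f₁ ≫ f₂₃ = f) (n : ℤ) :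
    Y.opcyclesMap _ _ _ _ (threeδ₂Toδ₁ f₁ f₂ f₃ f₁₂ f₂₃ h₁₂ h₂₃) n ≫
      Y.fromOpcycles f₁₂ f₃ f h n = Y.fromOpcycles f₁ f₂₃ f h' n := by
  rw [Y.opcyclesMap_fromOpcycles f₁ f₂₃ f₁₂ f₃ f h' f h _ (𝟙 _) n (by rfl) (by rfl),
    CategoryTheory.Functor.map_id, comp_id]

variable [Y.IsFirstQuadrant]

lemma isZero_page (r : ℤ) (hr : 2 ≤ r) (p q : ℤ) (h : q < 0 ∨ p < 0) :
    IsZero ((Y.E₂SpectralSequence.page r hr).X (p, q)) := by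
  apply Y.isZero_spectralSequence_page_X_of_isZero_H' coreE₂Cohomological r hr (p, q)
  obtain h | h := h
  · apply Y.isZero₁_of_isFirstQuadrant
    simp; lia
  · apply Y.isZero₂_of_isFirstQuadrant
    simp; lia

/-- `F^p Hⁿ` is the image of the cohomology of the part `< n - p + 1`. -/
abbrev filIdx (n p : ℤ) : EInt := ((n - p + 1 : ℤ) : EInt)

lemma filIdx_le (n p : ℤ) : filIdx n (p + 1) ≤ filIdx n p := by simp; lia

lemma ssConvergence_hz₀ (p q r n : ℤ) (hr : max 2 (max (p + 1) (q + 2)) ≤ r) :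
    IsZero ((Y.H (n + 1)).obj (mk₁ (homOfLE (bot_le : ⊥ ≤ ((q - r + 2 : ℤ) : EInt))))) := by
  apply Y.isZero₁_of_isFirstQuadrant
  simp; lia

lemma ssConvergence_hz₃ (p q r n : ℤ) (h : p + q = n) (hr : max 2 (max (p + 1) (q + 2)) ≤ r) :
    IsZero ((Y.H (n - 1)).obj (mk₁ (homOfLE (le_top : ((q + r - 1 : ℤ) : EInt) ≤ ⊤)))) := by
  apply Y.isZero₂_of_isFirstQuadrant
  simp; lia

/-- The isomorphism between the graded pieces and the pages. -/
noncomputable def ssGrIso (n p q r : ℤ) (h : p + q = n) (hr : max 2 (max (p + 1) (q + 2)) ≤ r) :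
    Y.E (homOfLE bot_le) (homOfLE (filIdx_le n p)) (homOfLE le_top) (n - 1) n (n + 1) ≅
      (Y.E₂SpectralSequence.page r (by lia)).X (p, q) :=
  infPageIso Y (p, q) r (by lia) (filIdx n (p + 1)) (filIdx n p)
      (by subst h; lia) (by subst h; lia) n h.symm (ssConvergence_hz₀ Y p q r n hr)
      (ssConvergence_hz₃ Y p q r n h hr)

lemma shortExact_of_iso₃ (S : ShortComplex C) (hS : S.ShortExact) {Z : C} (e : S.X₃ ≅ Z)
    (w : S.f ≫ S.g ≫ e.hom = 0) : (ShortComplex.mk S.f (S.g ≫ e.hom) w).ShortExact :=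
  ShortComplex.shortExact_of_iso (ShortComplex.isoMk (Iso.refl _) (Iso.refl _) e :
    S ≅ ShortComplex.mk S.f (S.g ≫ e.hom) w) hS

/-- The short exact sequence relating two successive steps of the filtration. -/
noncomputable abbrev filShortComplex (n p : ℤ) : ShortComplex C :=
  Y.shortComplexOpcyclesThreeδ₂Toδ₁ (homOfLE (bot_le : ⊥ ≤ filIdx n (p + 1)))
    (homOfLE (filIdx_le n p)) (homOfLE (le_top : filIdx n p ≤ ⊤)) (homOfLE bot_le)
    (homOfLE le_top) rfl rfl (n - 1) n (n + 1)

lemma filShortComplex_f (n p : ℤ) :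
    (filShortComplex Y n p).f ≫ Y.fromOpcycles (homOfLE (bot_le : ⊥ ≤ filIdx n p))
      (homOfLE (le_top : filIdx n p ≤ ⊤)) (homOfLE bot_le) rfl n =
    Y.fromOpcycles (homOfLE (bot_le : ⊥ ≤ filIdx n (p + 1)))
      (homOfLE (le_top : filIdx n (p + 1) ≤ ⊤)) (homOfLE bot_le) rfl n := by
  exact opcyclesMap_three_fromOpcycles Y _ _ _ _ _ _ _ _ _ _ n

/-- The convergence of the spectral sequence of a first quadrant spectral object. -/
noncomputable def ssConvergence :
    Convergence Y.E₂SpectralSequence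
      (fun n => (Y.H n).obj (mk₁ (homOfLE (bot_le : (⊥ : EInt) ≤ ⊤)))) where
  fil n p := Y.opcycles (homOfLE (bot_le : ⊥ ≤ filIdx n p)) (homOfLE (le_top : filIdx n p ≤ ⊤)) n
  ι n p := Y.fromOpcycles _ _ (homOfLE bot_le) rfl n
  mono_ι n p := inferInstance
  sub n p := (filShortComplex Y n p).f
  sub_ι n p := filShortComplex_f Y n p
  exhaustive n := by
    refine ⟨0, Y.isIso_fromOpcycles _ _ _ rfl n (Y.isZero₂_of_isFirstQuadrant _ _ _ _ ?_)⟩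
    simp
  separated n := by
    refine ⟨n + 1, ?_⟩
    have := Y.isZero₁_of_isFirstQuadrant ⊥ (filIdx n (n + 1)) bot_le (by simp) n
    exact IsZero.of_epi (Y.pOpcycles _ _ n) this
  bound p q := max 2 (max (p + 1) (q + 2))
  two_le_bound p q := by lia
  d_from p q r hr := by
    rintro ⟨p', q'⟩
    by_cases h : ((ComplexShape.up' (⟨r, 1 - r⟩ : ℤ × ℤ))).Rel (p, q) (p', q')
    · simp at h
      exact (isZero_page Y r _ p' q' (by lia)).eq_of_tgt _ _
    · exact HomologicalComplex.shape _ _ _ h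
  d_to p q r hr := by
    rintro ⟨p', q'⟩
    by_cases h : ((ComplexShape.up' (⟨r, 1 - r⟩ : ℤ × ℤ))).Rel (p', q') (p, q)
    · simp at h
      exact (isZero_page Y r _ p' q' (by lia)).eq_of_src _ _
    · exact HomologicalComplex.shape _ _ _ h
  π n p q r h hr := (filShortComplex Y n p).g ≫ (ssGrIso Y n p q r h hr).hom
  sub_π n p q r h hr := (assoc _ _ _).symm.trans
    (((filShortComplex Y n p).zero =≫ _).trans zero_comp)
  shortExact n p q r h hr := shortExact_of_iso₃ (filShortComplex Y n p)
    (Y.shortComplexOpcyclesThreeδ₂Toδ₁_shortExact _ _ _ _ _ _ _ _ _ _) (ssGrIso Y n p q r h hr) _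
  π_succ n p q r r' h hr hrr' :=
    infPageIso_succ Y (p, q) r r' hrr' (by lia) _ _ _ _ n h.symm _ _ _ _ _ _

end SSConvergence

section GrothendieckConvergence

open DerivedCategory ComposableArrows

variable {A B C : Type*} [Category* A] [Category* B] [Category* C] [Abelian A] [Abelian B] [Abelian C]
  [HasDerivedCategory A] [HasDerivedCategory B] [HasDerivedCategory C]
  [EnoughInjectives A] (F : A ⥤ B) [F.Additive]

lemma isGE_rightDerived (X : DerivedCategory.Plus A) (n : ℤ) [X.IsGE n] :
    (F.rightDerivedFunctorPlus.obj X).IsGE n := by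
  obtain ⟨L, _, ⟨e⟩⟩ := Plus.exists_injective_nonempty_iso X n
  have e' : Plus.Qh.obj (F.mapHomotopyCategoryPlus.obj
      ((InjectiveObject.ι A).mapHomotopyCategoryPlus.obj
        ((HomotopyCategory.Plus.quotient _).obj L))) ≅ F.rightDerivedFunctorPlus.obj X :=
    (asIso (F.rightDerivedFunctorPlusUnit.app
      ((InjectiveObject.ι A).mapHomotopyCategoryPlus.obj
        ((HomotopyCategory.Plus.quotient _).obj L))) :) ≪≫ F.rightDerivedFunctorPlus.mapIso e
  refine @TStructure.isGE_of_iso _ _ _ _ _ _ _ Plus.TStructure.t _ _ e' n ?_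
  refine (Plus.isGE_ι_obj_iff _ _).1 ?_
  change (DerivedCategory.Q.obj ((F.mapHomologicalComplex (.up ℤ)).obj
    (((InjectiveObject.ι A).mapHomologicalComplex (.up ℤ)).obj L.obj))).IsGE n
  infer_instance

variable [EnoughInjectives B] (G : B ⥤ C) [G.Additive]

instance (X : A) : ((grothendieckSpectralObject F G).obj X).IsFirstQuadrant where
  isZero₁ i j hij hj n := by
    have : (F.rightDerivedFunctorPlus.obj ((Plus.singleFunctor A 0).obj X)).IsGE 0 :=
      isGE_rightDerived F _ _
    have h₁ := Plus.TStructure.t.isZero_eTruncLT_obj_obj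
      (F.rightDerivedFunctorPlus.obj ((Plus.singleFunctor A 0).obj X)) 0 j hj
    exact (Plus.homologyFunctor C n).map_isZero (G.rightDerivedFunctorPlus.map_isZero
      ((Plus.TStructure.t.eTruncGE.obj i).map_isZero h₁))
  isZero₂ i j hij n hi := by
    have hi' : ((n + 1 : ℤ) : EInt) ≤ i := by
      induction i using WithBotTop.rec with
      | bot => simp at hi
      | coe i => simp at hi ⊢; lia
      | top => simp
    let Z : DerivedCategory.Plus B := (Plus.TStructure.t.eTruncGE.obj i).obj
      ((Plus.TStructure.t.eTruncLT.obj j).obj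
        (F.rightDerivedFunctorPlus.obj ((Plus.singleFunctor A 0).obj X)))
    have h₁ : Z.IsGE (n + 1) := Plus.TStructure.t.isGE_eTruncGE_obj_obj (n + 1) i hi' _
    have h₂ := isGE_rightDerived G Z (n + 1)
    exact (G.rightDerivedFunctorPlus.obj Z).isZero_homology_of_isGE (n + 1) n (by lia)

variable [F.PreservesInjectiveObjects]

/-- The convergence `E_2^{p,q}(X) = R^pG(R^qF(X)) ⇒ R^{p+q}(GF)(X)` of the Grothendieck spectral
sequence: `F^p` is the image of `Hⁿ(RG(τ^{< n-p+1} RF(X)))` in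
`Hⁿ(RG(RF(X))) ≅ Rⁿ(GF)(X)`. -/
noncomputable def grothendieckConvergence (X : A) :
    Convergence ((grothendieckSS F G).obj X) (fun n => (rightDer (F ⋙ G) n).obj X) :=
  (ssConvergence ((grothendieckSpectralObject F G).obj X)).ofIso
    (fun n => ((rightDerCompIso F G n).symm.app X))

end GrothendieckConvergence

section

variable {A B C A' B' C' : Type*} [Category* A] [Category* B] [Category* C]
  [Category* A'] [Category* B'] [Category* C']

/-- The composite natural transformation `K_C G F ⟶ G' K_B F ⟶ G' F' K_A`. -/
def compNatTrans {F : A ⥤ B} {G : B ⥤ C} {F' : A' ⥤ B'} {G' : B' ⥤ C'} {KA : A ⥤ A'}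
    {KB : B ⥤ B'} {KC : C ⥤ C'} (NF : F ⋙ KB ⟶ KA ⋙ F') (NG : G ⋙ KC ⟶ KB ⋙ G') :
    (F ⋙ G) ⋙ KC ⟶ KA ⋙ F' ⋙ G' where
  app X := NG.app (F.obj X) ≫ G'.map (NF.app X)
  naturality X Y f := by
    have h₁ := NG.naturality (F.map f)
    have h₂ := G'.congr_map (NF.naturality f)
    dsimp at h₁ h₂ ⊢
    rw [reassoc_of% h₁, assoc, ← G'.map_comp, ← G'.map_comp, h₂]

end

end GrothendieckSS

/-! The spectral sequence of `GF` at `X` comes from a spectral object: apply `RG`, then cohomology,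
to the pieces τ^{≥ i} τ^{< j} RF(X), with i ≤ j in ℤ ∪ {±∞}. So it is enough to compare spectral
objects: to give maps KC Hⁿ(RG τ^{≥ i} τ^{< j} RF(X)) ⟶ Hⁿ(RG' τ^{≥ i} τ^{< j} RF'(KA X)) that are
natural in (i, j) and commute with the connecting morphisms (`HomAlong`). As `KC` is exact, it
commutes with the homology that defines the terms `E`. Such a family therefore acts on every page,
commutes with the differentials and with the passage to the next page, and respects the filtration
of the abutment (`HomAlong.spectralSequenceMap`, `HomAlong.compatible`).

The family is a composite of three maps. The first is the derived transformation KC RG ⟶ RG' KB of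
`NG`. The second compares KB τ^{≥ i} τ^{< j} with τ^{≥ i} τ^{< j} KB: it exists because `KB` is
t-exact, and the orthogonality of a t-structure makes it unique, which gives all of its
compatibilities (`spectralObjectComparison`). The third is the truncation of KB RF(X) ⟶ RF'(KA X). A
connecting morphism has a shift as its target, so the derived transformations, and the isomorphism
between cohomology after `KC` and `KC` after cohomology, must commute with shifts. On complexes this
is a degreewise check; it is carried to the derived categories along quotient functors, fully
faithful inclusions and injective resolutions.

The two assertions are values of this family. At (-∞, +∞) the truncations do nothing, and the map is
KC RG RF ⟶ RG' RF' KA; the universal property of R(GF) identifies it with the derived transformation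
of N_{GF} (`rightDerivedComp_derivedNatTrans`). At (q, q+1) the truncation is H^q placed in degree
q. A map from an object concentrated in degree q to a single complex in degree q is determined by
its effect on H^q, so the comparison of truncations is there R^qF(X) ⟶ R^qF'(KA X)
(`truncMap_truncToSingle`). Compatibility with the shift by -q then turns the derived transformation
of `NG` into the map on R^pG (`rightDerSingleIso_comp`). -/

namespace GrothendieckSS

/-! ### Morphisms of spectral objects along an exact functor -/

section SemilinearMaps

open ComposableArrows Abelian Abelian.SpectralObject

variable {C D : Type*} [Category* C] [Category* D] [Abelian C] [Abelian D]

section ShortComplex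

variable (K : C ⥤ D) [K.Additive] [PreservesFiniteLimits K] [PreservesFiniteColimits K]

/-- The map in homology induced by a morphism from the image under an exact functor
of a short complex. -/
noncomputable def homologyMapAlong {S : ShortComplex C} {S' : ShortComplex D} (φ : S.map K ⟶ S') :
    K.obj S.homology ⟶ S'.homology :=
  (S.mapHomologyIso K).inv ≫ ShortComplex.homologyMap φ

lemma mapHomologyIso_hom_homologyMapAlong {S : ShortComplex C} {S' : ShortComplex D}
    (φ : S.map K ⟶ S') :
    (S.mapHomologyIso K).hom ≫ homologyMapAlong K φ = ShortComplex.homologyMap φ :=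
  Iso.hom_inv_id_assoc _ _

lemma map_homologyMap_homologyMapAlong {S T : ShortComplex C} {S' : ShortComplex D} (f : S ⟶ T)
    (φ : T.map K ⟶ S') :
    K.map (ShortComplex.homologyMap f) ≫ homologyMapAlong K φ =
      homologyMapAlong K (K.mapShortComplex.map f ≫ φ) := by
  rw [← cancel_epi (S.mapHomologyIso K).hom, mapHomologyIso_hom_homologyMapAlong]
  have h := ShortComplex.mapHomologyIso_hom_naturality f K
  refine (assoc _ _ _).symm.trans ((h.symm =≫ _).trans ((assoc _ _ _).trans ?_))
  rw [mapHomologyIso_hom_homologyMapAlong]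
  exact (ShortComplex.homologyMap_comp (K.mapShortComplex.map f) φ).symm

lemma homologyMapAlong_homologyMap {S : ShortComplex C} {S' T' : ShortComplex D}
    (φ : S.map K ⟶ S') (f : S' ⟶ T') :
    homologyMapAlong K φ ≫ ShortComplex.homologyMap f = homologyMapAlong K (φ ≫ f) := by
  dsimp only [homologyMapAlong]
  rw [assoc, ShortComplex.homologyMap_comp]

/-- Homology classes can be followed on representing cycles: as `K` is exact, `K` of the class of
`f` is the class of `K.map f` in the image complex, and `φ` acts on it through its middle component.
-/
lemma map_liftCycles_homologyπ_homologyMapAlong {S : ShortComplex C} {S' : ShortComplex D}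
    (φ : S.map K ⟶ S') {X : C} (f : X ⟶ S.X₂) (w : f ≫ S.g = 0)
    (w' : (K.map f ≫ φ.τ₂) ≫ S'.g = 0) :
    K.map (S.liftCycles f w ≫ S.homologyπ) ≫ homologyMapAlong K φ =
      S'.liftCycles (K.map f ≫ φ.τ₂) w' ≫ S'.homologyπ := by
  have w'' : K.map f ≫ (S.map K).g = 0 :=
    (K.map_comp _ _).symm.trans ((K.congr_map w).trans (K.map_zero _ _))
  have h := Convergence.sc_liftCycles_mapHomologyIso K S f w w''
  refine (h.symm =≫ _).trans ?_
  simp only [assoc]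
  rw [mapHomologyIso_hom_homologyMapAlong, ShortComplex.homologyπ_naturality]
  refine (assoc _ _ _).symm.trans (Eq.trans ?_ rfl)
  congr 1
  rw [← cancel_mono S'.iCycles, assoc, ShortComplex.cyclesMap_i, ShortComplex.liftCycles_i]
  exact ShortComplex.liftCycles_i_assoc _ _ _ _

end ShortComplex

variable {ι : Type*} [Category* ι]

/-- Puts the map from `H` to `E` in the form "class of a cycle", to which
`map_liftCycles_homologyπ_homologyMapAlong` applies. The existential only carries the vanishing that
`liftCycles` asks for. -/
lemma toCycles_πE_eq_liftCycles (X : Abelian.SpectralObject C ι) {i j k l : ι}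
    (f₁ : i ⟶ j) (f₂ : j ⟶ k) (f₃ : k ⟶ l) (n₀ n₁ n₂ : ℤ) (hn₁ : n₀ + 1 = n₁) (hn₂ : n₁ + 1 = n₂)
    (f₁₂ : i ⟶ k) (h₁₂ : f₁ ≫ f₂ = f₁₂) :
    ∃ (w : (X.H n₁).map (twoδ₁Toδ₀ f₁ f₂ f₁₂ h₁₂) ≫
        (X.shortComplex f₁ f₂ f₃ n₀ n₁ n₂ hn₁ hn₂).g = 0),
      X.toCycles f₁ f₂ f₁₂ h₁₂ n₁ ≫ X.πE f₁ f₂ f₃ n₀ n₁ n₂ hn₁ hn₂ =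
        (X.shortComplex f₁ f₂ f₃ n₀ n₁ n₂ hn₁ hn₂).liftCycles _ w ≫
          (X.shortComplex f₁ f₂ f₃ n₀ n₁ n₂ hn₁ hn₂).homologyπ := by
  refine ⟨X.zero₃ f₁ f₂ f₁₂ h₁₂ n₁ n₂ hn₂, ?_⟩
  refine (assoc _ _ _).symm.trans (congrArg (· ≫ ShortComplex.homologyπ _) ?_)
  refine (cancel_mono (ShortComplex.iCycles _)).1 ?_
  refine Eq.trans ?_ (ShortComplex.liftCycles_i _ _ _).symm
  refine (assoc _ _ _).trans ((whisker_eq _ (X.cyclesIso_inv_i f₁ f₂ f₃ n₀ n₁ n₂ hn₁ hn₂)).trans ?_)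
  exact X.toCycles_i f₁ f₂ f₁₂ h₁₂ n₁

/-- A morphism of spectral objects along a functor `K` between the abelian categories. -/
structure HomAlong (K : C ⥤ D) (X : Abelian.SpectralObject C ι)
    (Y : Abelian.SpectralObject D ι) where
  /-- the morphisms on all objects of the spectral object -/
  hom (n : ℤ) : X.H n ⋙ K ⟶ Y.H n
  comm (n₀ n₁ : ℤ) (hn₁ : n₀ + 1 = n₁) {i j k : ι} (f : i ⟶ j) (g : j ⟶ k) :
    K.map (X.δ f g n₀ n₁ hn₁) ≫ (hom n₁).app (mk₁ f) =
      (hom n₀).app (mk₁ g) ≫ Y.δ f g n₀ n₁ hn₁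

namespace HomAlong

variable {K : C ⥤ D} [K.Additive] [PreservesFiniteLimits K] [PreservesFiniteColimits K]

section

variable {X X₁ : Abelian.SpectralObject C ι} {Y Y₁ : Abelian.SpectralObject D ι}
  (φ : HomAlong K X Y) (φ₁ : HomAlong K X₁ Y₁) (a : X ⟶ X₁) (b : Y ⟶ Y₁)
  {i j k l : ι} (f₁ : i ⟶ j) (f₂ : j ⟶ k) (f₃ : k ⟶ l)
  (n₀ n₁ n₂ : ℤ) (hn₁ : n₀ + 1 = n₁) (hn₂ : n₁ + 1 = n₂)

/-- The morphism induced on the short complexes computing `E`. -/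
noncomputable def scMap :
    (X.shortComplex f₁ f₂ f₃ n₀ n₁ n₂ hn₁ hn₂).map K ⟶ Y.shortComplex f₁ f₂ f₃ n₀ n₁ n₂ hn₁ hn₂ where
  τ₁ := (φ.hom n₀).app (mk₁ f₃)
  τ₂ := (φ.hom n₁).app (mk₁ f₂)
  τ₃ := (φ.hom n₂).app (mk₁ f₁)
  comm₁₂ := (φ.comm n₀ n₁ hn₁ f₂ f₃).symm
  comm₂₃ := (φ.comm n₁ n₂ hn₂ f₁ f₂).symm

/-- The morphism induced on `E`. -/
noncomputable def EMap : K.obj (X.E f₁ f₂ f₃ n₀ n₁ n₂ hn₁ hn₂) ⟶ Y.E f₁ f₂ f₃ n₀ n₁ n₂ hn₁ hn₂ :=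
  homologyMapAlong K (φ.scMap f₁ f₂ f₃ n₀ n₁ n₂ hn₁ hn₂)

/-- The source of the naturality of the final morphism in the object of `A`: a square that commutes
on the objects `H` commutes on `E`. -/
lemma map_EMap_comp (h : ∀ n, Functor.whiskerRight (Abelian.SpectralObject.Hom.hom a n) K ≫ φ₁.hom n =
      φ.hom n ≫ Abelian.SpectralObject.Hom.hom b n) :
    K.map (GrothendieckSS.EMap a f₁ f₂ f₃ n₀ n₁ n₂ hn₁ hn₂) ≫ φ₁.EMap f₁ f₂ f₃ n₀ n₁ n₂ hn₁ hn₂ =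
      φ.EMap f₁ f₂ f₃ n₀ n₁ n₂ hn₁ hn₂ ≫ GrothendieckSS.EMap b f₁ f₂ f₃ n₀ n₁ n₂ hn₁ hn₂ := by
  refine (map_homologyMap_homologyMapAlong K _ _).trans
    (Eq.trans ?_ (homologyMapAlong_homologyMap K _ _).symm)
  congr 1
  ext
  · exact NatTrans.congr_app (h n₀) (mk₁ f₃)
  · exact NatTrans.congr_app (h n₁) (mk₁ f₂)
  · exact NatTrans.congr_app (h n₂) (mk₁ f₁)

variable {i' j' k' l' : ι} (f₁' : i' ⟶ j') (f₂' : j' ⟶ k') (f₃' : k' ⟶ l')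
  (α : mk₃ f₁ f₂ f₃ ⟶ mk₃ f₁' f₂' f₃')

/-- The inclusion of the cycles of a page, the projection onto the next page and the identification
of the infinite page are all built from maps `X.map`, so this single square takes care of each of
them. -/
lemma map_EMap : K.map (X.map f₁ f₂ f₃ f₁' f₂' f₃' α n₀ n₁ n₂ hn₁ hn₂) ≫
      φ.EMap f₁' f₂' f₃' n₀ n₁ n₂ hn₁ hn₂ =
    φ.EMap f₁ f₂ f₃ n₀ n₁ n₂ hn₁ hn₂ ≫ Y.map f₁ f₂ f₃ f₁' f₂' f₃' α n₀ n₁ n₂ hn₁ hn₂ := by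
  refine (map_homologyMap_homologyMapAlong K _ _).trans
    (Eq.trans ?_ (homologyMapAlong_homologyMap K _ _).symm)
  congr 1
  ext
  · exact (φ.hom n₀).naturality _
  · exact (φ.hom n₁).naturality _
  · exact (φ.hom n₂).naturality _

/-- `toCycles` followed by `πE` is an epimorphism, and `K` preserves epimorphisms, so this square
determines `EMap`; identities about `EMap` can be checked on the objects `H`. -/
lemma map_toCycles_πE_EMap (f₁₂ : i ⟶ k) (h₁₂ : f₁ ≫ f₂ = f₁₂) :
    K.map (X.toCycles f₁ f₂ f₁₂ h₁₂ n₁ ≫ X.πE f₁ f₂ f₃ n₀ n₁ n₂ hn₁ hn₂) ≫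
      φ.EMap f₁ f₂ f₃ n₀ n₁ n₂ hn₁ hn₂ =
    (φ.hom n₁).app (mk₁ f₁₂) ≫
      Y.toCycles f₁ f₂ f₁₂ h₁₂ n₁ ≫ Y.πE f₁ f₂ f₃ n₀ n₁ n₂ hn₁ hn₂ := by
  obtain ⟨w, e⟩ := toCycles_πE_eq_liftCycles X f₁ f₂ f₃ n₀ n₁ n₂ hn₁ hn₂ f₁₂ h₁₂
  obtain ⟨w', e'⟩ := toCycles_πE_eq_liftCycles Y f₁ f₂ f₃ n₀ n₁ n₂ hn₁ hn₂ f₁₂ h₁₂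
  rw [e, e']
  have hn := (φ.hom n₁).naturality (twoδ₁Toδ₀ f₁ f₂ f₁₂ h₁₂)
  have w'' : (K.map ((X.H n₁).map (twoδ₁Toδ₀ f₁ f₂ f₁₂ h₁₂)) ≫
      (φ.scMap f₁ f₂ f₃ n₀ n₁ n₂ hn₁ hn₂).τ₂) ≫
      (Y.shortComplex f₁ f₂ f₃ n₀ n₁ n₂ hn₁ hn₂).g = 0 := by
    refine (hn =≫ _).trans ((assoc _ _ _).trans ?_)
    rw [w', comp_zero]
  refine (map_liftCycles_homologyπ_homologyMapAlong K _ _ w w'').trans ?_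
  refine Eq.trans ?_ (assoc _ _ _)
  congr 1
  refine (cancel_mono (ShortComplex.iCycles _)).1 ?_
  refine (ShortComplex.liftCycles_i _ _ _).trans (hn.trans ?_)
  refine Eq.trans ?_ (assoc _ _ _).symm
  exact whisker_eq _ ((Y.shortComplex f₁ f₂ f₃ n₀ n₁ n₂ hn₁ hn₂).liftCycles_i _ w').symm

end

section

variable {X : Abelian.SpectralObject C ι} {Y : Abelian.SpectralObject D ι} (φ : HomAlong K X Y)

/-- When the outer arrows are identities, `EIsoH` undoes `toCycles` followed by `πE`, so
`map_toCycles_πE_EMap` becomes this square. -/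
lemma EMap_EIsoH {i j : ι} (f : i ⟶ j) (n₀ n₁ n₂ : ℤ) (hn₁ : n₀ + 1 = n₁) (hn₂ : n₁ + 1 = n₂) :
    φ.EMap (𝟙 i) f (𝟙 j) n₀ n₁ n₂ hn₁ hn₂ ≫ (Y.EIsoH f n₀ n₁ n₂ hn₁ hn₂).hom =
      K.map (X.EIsoH f n₀ n₁ n₂ hn₁ hn₂).hom ≫ (φ.hom n₁).app (mk₁ f) := by
  have hX : X.toCycles (𝟙 i) f f (id_comp f) n₁ ≫ X.πE (𝟙 i) f (𝟙 j) n₀ n₁ n₂ hn₁ hn₂ ≫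
      (X.EIsoH f n₀ n₁ n₂ hn₁ hn₂).hom = 𝟙 _ := by
    rw [X.πE_EIsoH_hom f n₀ n₁ n₂ hn₁ hn₂, X.cyclesIsoH_inv_hom_id f n₁ n₂ hn₂]
  have hY : Y.toCycles (𝟙 i) f f (id_comp f) n₁ ≫ Y.πE (𝟙 i) f (𝟙 j) n₀ n₁ n₂ hn₁ hn₂ ≫
      (Y.EIsoH f n₀ n₁ n₂ hn₁ hn₂).hom = 𝟙 _ := by
    rw [Y.πE_EIsoH_hom f n₀ n₁ n₂ hn₁ hn₂, Y.cyclesIsoH_inv_hom_id f n₁ n₂ hn₂]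
  rw [← cancel_epi (K.map (X.toCycles (𝟙 i) f f (id_comp f) n₁ ≫
    X.πE (𝟙 i) f (𝟙 j) n₀ n₁ n₂ hn₁ hn₂))]
  refine (assoc _ _ _).symm.trans ((map_toCycles_πE_EMap φ (𝟙 i) f (𝟙 j) n₀ n₁ n₂ hn₁ hn₂ f
    (id_comp f) =≫ _).trans ?_)
  simp only [assoc]
  rw [hY, ← K.map_comp_assoc, assoc, hX, K.map_id, comp_id]
  exact (id_comp _).symm

/-- On representatives in `H` the differential is the connecting morphism `δ`, with which `φ`
commutes by definition. -/
lemma map_d_EMap {i₀ i₁ i₂ i₃ i₄ i₅ : ι} (f₁ : i₀ ⟶ i₁) (f₂ : i₁ ⟶ i₂) (f₃ : i₂ ⟶ i₃)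
    (f₄ : i₃ ⟶ i₄) (f₅ : i₄ ⟶ i₅) (n₀ n₁ n₂ n₃ : ℤ)
    (hn₁ : n₀ + 1 = n₁) (hn₂ : n₁ + 1 = n₂) (hn₃ : n₂ + 1 = n₃) :
    K.map (X.d f₁ f₂ f₃ f₄ f₅ n₀ n₁ n₂ n₃ hn₁ hn₂ hn₃) ≫ φ.EMap f₁ f₂ f₃ n₁ n₂ n₃ hn₂ hn₃ =
      φ.EMap f₃ f₄ f₅ n₀ n₁ n₂ hn₁ hn₂ ≫ Y.d f₁ f₂ f₃ f₄ f₅ n₀ n₁ n₂ n₃ hn₁ hn₂ hn₃ := by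
  rw [← cancel_epi (K.map (X.toCycles f₃ f₄ _ rfl n₁ ≫ X.πE f₃ f₄ f₅ n₀ n₁ n₂ hn₁ hn₂)),
    ← K.map_comp_assoc, assoc,
    X.toCycles_πE_d f₁ f₂ f₃ f₄ f₅ _ rfl _ rfl n₀ n₁ n₂ n₃ hn₁ hn₂ hn₃, K.map_comp, assoc,
    φ.map_toCycles_πE_EMap f₁ f₂ f₃ n₁ n₂ n₃ hn₂ hn₃]
  have h := φ.map_toCycles_πE_EMap f₃ f₄ f₅ n₀ n₁ n₂ hn₁ hn₂ _ rfl =≫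
    Y.d f₁ f₂ f₃ f₄ f₅ n₀ n₁ n₂ n₃ hn₁ hn₂ hn₃
  simp only [assoc] at h
  rw [h, Y.toCycles_πE_d f₁ f₂ f₃ f₄ f₅ _ rfl _ rfl n₀ n₁ n₂ n₃ hn₁ hn₂ hn₃, ← assoc, ← assoc,
    φ.comm n₁ n₂ hn₂]
  simp only [assoc]

variable {i j k l : ι} (f : i ⟶ j) (g : j ⟶ k) (n : ℤ)

/-- The morphism induced on the objects of opcycles. -/
noncomputable def opcyclesMap : K.obj (X.opcycles f g n) ⟶ Y.opcycles f g n :=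
  haveI : Epi ((X.cokernelSequenceOpcycles f g (n - 1) n (sub_add_cancel n 1)).map K).g := by
    have : Epi (X.cokernelSequenceOpcycles f g (n - 1) n (sub_add_cancel n 1)).g := inferInstance
    exact inferInstanceAs (Epi (K.map (X.cokernelSequenceOpcycles f g (n - 1) n (sub_add_cancel n 1)).g))
  -- `K` keeps the sequence presenting the opcycles exact, and `φ.comm` shows that the map to be
  -- descended kills the image of `δ`, which starts in degree `n - 1`.
  ((X.cokernelSequenceOpcycles_exact f g (n - 1) n (sub_add_cancel n 1)).map K).desc
    ((φ.hom n).app (mk₁ f) ≫ Y.pOpcycles f g n) (by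
      refine (assoc _ _ _).symm.trans ((φ.comm (n - 1) n (sub_add_cancel n 1) f g =≫ _).trans ?_)
      rw [assoc, Y.δ_pOpcycles f g (n - 1) n, comp_zero]
      rfl)

lemma map_pOpcycles_opcyclesMap : K.map (X.pOpcycles f g n) ≫ φ.opcyclesMap f g n =
    (φ.hom n).app (mk₁ f) ≫ Y.pOpcycles f g n := by
  have : Epi ((X.cokernelSequenceOpcycles f g (n - 1) n (sub_add_cancel n 1)).map K).g := by
    have : Epi (X.cokernelSequenceOpcycles f g (n - 1) n (sub_add_cancel n 1)).g := inferInstance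
    exact inferInstanceAs (Epi (K.map (X.cokernelSequenceOpcycles f g (n - 1) n (sub_add_cancel n 1)).g))
  exact ((X.cokernelSequenceOpcycles_exact f g (n - 1) n (sub_add_cancel n 1)).map K).g_desc _ _

/-- The steps of the filtration of the abutment are opcycles, included by `fromOpcycles`: this
square says that the filtration is respected, and the next one handles the projections onto the
graded pieces. -/
lemma opcyclesMap_fromOpcycles (fg : i ⟶ k) (h : f ≫ g = fg) :
    φ.opcyclesMap f g n ≫ Y.fromOpcycles f g fg h n =
      K.map (X.fromOpcycles f g fg h n) ≫ (φ.hom n).app (mk₁ fg) := by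
  rw [← cancel_epi (K.map (X.pOpcycles f g n))]
  refine (assoc _ _ _).symm.trans ((φ.map_pOpcycles_opcyclesMap f g n =≫ _).trans ?_)
  rw [assoc, Y.p_fromOpcycles, ← K.map_comp_assoc, X.p_fromOpcycles]
  exact ((φ.hom n).naturality _).symm

lemma opcyclesMap_opcyclesToE (f₃ : k ⟶ l) (fg : i ⟶ k) (h : f ≫ g = fg) (n₀ n₁ n₂ : ℤ)
    (hn₁ : n₀ + 1 = n₁) (hn₂ : n₁ + 1 = n₂) :
    φ.opcyclesMap fg f₃ n₁ ≫ Y.opcyclesToE f g f₃ fg h n₀ n₁ n₂ hn₁ hn₂ =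
      K.map (X.opcyclesToE f g f₃ fg h n₀ n₁ n₂ hn₁ hn₂) ≫ φ.EMap f g f₃ n₀ n₁ n₂ hn₁ hn₂ := by
  rw [← cancel_epi (K.map (X.pOpcycles fg f₃ n₁))]
  refine (assoc _ _ _).symm.trans ((φ.map_pOpcycles_opcyclesMap fg f₃ n₁ =≫ _).trans ?_)
  rw [assoc, Y.p_opcyclesToE f g f₃ fg h n₀ n₁ n₂ hn₁ hn₂, ← K.map_comp_assoc,
    X.p_opcyclesToE f g f₃ fg h n₀ n₁ n₂ hn₁ hn₂, φ.map_toCycles_πE_EMap f g f₃ n₀ n₁ n₂ hn₁ hn₂ fg h]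

end

end HomAlong

end SemilinearMaps

end GrothendieckSS

namespace GrothendieckSS

/-! ### The induced morphism of converging spectral sequences -/

section SemilinearSpectralSequence

/-- The shape `a ≪≫ b.symm ≪≫ c.symm` is that of `infPageIso`; three squares, the last two traversed
backwards, are pasted. -/
lemma comp_trans_symm_trans_symm_hom {C D : Type*} [Category* C] [Category* D] {K : C ⥤ D}
    {X₀ X₁ X₂ X₃ : C} {Y₀ Y₁ Y₂ Y₃ : D} (a : X₀ ≅ X₁)
    (b : X₂ ≅ X₁) (c : X₃ ≅ X₂) (a' : Y₀ ≅ Y₁) (b' : Y₂ ≅ Y₁) (c' : Y₃ ≅ Y₂)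
    (f₀ : K.obj X₀ ⟶ Y₀) (f₁ : K.obj X₁ ⟶ Y₁) (f₂ : K.obj X₂ ⟶ Y₂) (f₃ : K.obj X₃ ⟶ Y₃)
    (h₁ : K.map a.hom ≫ f₁ = f₀ ≫ a'.hom) (h₂ : K.map b.hom ≫ f₁ = f₂ ≫ b'.hom)
    (h₃ : f₃ ≫ c'.hom = K.map c.hom ≫ f₂) :
    f₀ ≫ (a' ≪≫ b'.symm ≪≫ c'.symm).hom = K.map (a ≪≫ b.symm ≪≫ c.symm).hom ≫ f₃ := by
  have h₂' : K.map b.inv ≫ f₂ = f₁ ≫ b'.inv := by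
    rw [Iso.eq_comp_inv, assoc, ← h₂, ← K.map_comp_assoc, Iso.inv_hom_id, K.map_id, id_comp]
  have h₃' : K.map c.inv ≫ f₃ = f₂ ≫ c'.inv := by
    rw [Iso.eq_comp_inv, assoc, h₃, ← K.map_comp_assoc, Iso.inv_hom_id, K.map_id, id_comp]
  simp [h₃', reassoc_of% h₂', reassoc_of% h₁]

open ComposableArrows Abelian Abelian.SpectralObject

namespace HomAlong

section

variable {C D ι κ : Type*} [Category* C] [Category* D] [Abelian C] [Abelian D] [Preorder ι]
  {K : C ⥤ D} [K.Additive] [PreservesFiniteLimits K] [PreservesFiniteColimits K]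
  {X : Abelian.SpectralObject C ι} {Y : Abelian.SpectralObject D ι} (φ : HomAlong K X Y)
  {c : ℤ → ComplexShape κ} {r₀ : ℤ} (data : SpectralSequenceDataCore ι c r₀)
  [X.HasSpectralSequence data] [Y.HasSpectralSequence data]

/-- The morphism induced in each bidegree of the `r`th page. -/
noncomputable def pageMapX (r : ℤ) (hr : r₀ ≤ r) (pq : κ) :
    K.obj (((X.spectralSequence data).page r hr).X pq) ⟶
      ((Y.spectralSequence data).page r hr).X pq :=
  K.map (pageIso X data r hr pq).hom ≫ φ.EMap _ _ _ _ _ _ _ _ ≫ (pageIso Y data r hr pq).inv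

/-- `pageMapX` is built on one choice of indices and degrees. The differentials and the first page
use other expressions equal to these; substituting the equalities gives the square for all of them.
-/
lemma pageMapX_comp_spectralSequencePageXIso_hom (r : ℤ) (hr : r₀ ≤ r) (pq : κ)
    (i₀ i₁ i₂ i₃ : ι) (h₀ : i₀ = data.i₀ r pq)
    (h₁ : i₁ = data.i₁ pq) (h₂ : i₂ = data.i₂ pq)
    (h₃ : i₃ = data.i₃ r pq)
    (n₀ n₁ n₂ : ℤ) (h : n₁ = data.deg pq)
    (hn₁ : n₀ + 1 = n₁) (hn₂ : n₁ + 1 = n₂) :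
    φ.pageMapX data r hr pq ≫
      (Y.spectralSequencePageXIso data r hr pq i₀ i₁ i₂ i₃ h₀ h₁ h₂ h₃ n₀ n₁ n₂ h hn₁ hn₂).hom =
      K.map (X.spectralSequencePageXIso data r hr pq i₀ i₁ i₂ i₃ h₀ h₁ h₂ h₃ n₀ n₁ n₂ h hn₁ hn₂).hom ≫
      φ.EMap _ _ _ n₀ n₁ n₂ hn₁ hn₂ := by
  obtain rfl : n₀ = n₁ - 1 := by lia
  subst h hn₂ h₀ h₁ h₂ h₃
  exact (assoc _ _ _).trans (whisker_eq _ ((assoc _ _ _).trans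
    ((whisker_eq _ (Iso.inv_hom_id _)).trans (comp_id _))))

lemma pageMapX_d (r : ℤ) (hr : r₀ ≤ r) (pq pq' : κ) (hpq : (c r).Rel pq pq') :
    φ.pageMapX data r hr pq ≫ ((Y.spectralSequence data).page r hr).d pq pq' =
      K.map (((X.spectralSequence data).page r hr).d pq pq') ≫ φ.pageMapX data r hr pq' := by
  have hX := X.spectralSequence_page_d_eq data r hr pq pq' hpq (homOfLE (data.le₀₁ r pq'))
      (homOfLE (data.le₁₂' pq' rfl (data.hc₀₂ r pq pq' hpq)))
      (homOfLE (data.le₀₁ r pq)) (homOfLE (data.le₁₂ pq)) (homOfLE (data.le₂₃ r pq))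
      rfl rfl rfl rfl rfl rfl
      (data.deg pq - 1) (data.deg pq) (data.deg pq + 1) (data.deg pq + 2) rfl
  have hY := Y.spectralSequence_page_d_eq data r hr pq pq' hpq (homOfLE (data.le₀₁ r pq'))
      (homOfLE (data.le₁₂' pq' rfl (data.hc₀₂ r pq pq' hpq)))
      (homOfLE (data.le₀₁ r pq)) (homOfLE (data.le₁₂ pq)) (homOfLE (data.le₂₃ r pq))
      rfl rfl rfl rfl rfl rfl
      (data.deg pq - 1) (data.deg pq) (data.deg pq + 1) (data.deg pq + 2) rfl
  -- The target `pq'` is described by the indices coming from the source `pq`, through `hc₀₂`,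
  -- `hc₁₃` and `hc`, since the formula for the differential is written with these.
  rw [hX, hY, ← cancel_mono (Y.spectralSequencePageXIso data r hr pq' _ _ _ _ rfl rfl
    (data.hc₀₂ r pq pq' hpq) (data.hc₁₃ r pq pq' hpq) _ _ (data.deg pq + 2)
    (data.hc r pq pq' hpq) rfl (by lia)).hom]
  simp only [assoc, Iso.inv_hom_id, comp_id, K.map_comp]
  rw [φ.pageMapX_comp_spectralSequencePageXIso_hom data, ← K.map_comp_assoc (Iso.inv _),
    Iso.inv_hom_id, K.map_id, id_comp, φ.map_d_EMap _ _ _ _ _ (data.deg pq - 1) (data.deg pq)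
    (data.deg pq + 1) (data.deg pq + 2)]
  rw [← assoc, φ.pageMapX_comp_spectralSequencePageXIso_hom data, assoc]

/-- The morphism induced on the `r`th page. -/
noncomputable def pageMap (r : ℤ) (hr : r₀ ≤ r) :
    (K.mapHomologicalComplex (c r)).obj ((X.spectralSequence data).page r hr) ⟶
      (Y.spectralSequence data).page r hr where
  f pq := φ.pageMapX data r hr pq
  comm' pq pq' hpq := φ.pageMapX_d data r hr pq pq' hpq

/-- The morphism of spectral sequences induced by a morphism of spectral objects along an exact
functor. -/
noncomputable def spectralSequenceMap :
    (mapSpectralSequence K).obj (X.spectralSequence data) ⟶ Y.spectralSequence data where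
  hom r hr := φ.pageMap data r hr
  comm r r' pq hrr' hr := by
    have hw := pageι_d X data r r' hrr' hr pq
    have w' : K.map (pageι X data r r' hrr' hr pq ≫ (pageIso X data r hr pq).inv) ≫
        ((K.mapHomologicalComplex (c r)).obj ((X.spectralSequence data).page r hr)).d pq ((c r).next pq) = 0 :=
      (K.map_comp _ _).symm.trans ((K.congr_map hw).trans (K.map_zero _ _))
    have h₀ := Convergence.liftCycles_mapHomologyIso K ((X.spectralSequence data).page r hr) pq _ _ rfl hw w'
    -- The compatibility with the next page is tested on this map, which starts from `K` of the
    -- cycles of page `r`. Up to isomorphisms it is `K` of `pageπ`, hence an epimorphism.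
    have hepi : Epi (((K.mapHomologicalComplex (c r)).obj ((X.spectralSequence data).page r hr)).liftCycles _ _ rfl w' ≫
        ((K.mapHomologicalComplex (c r)).obj ((X.spectralSequence data).page r hr)).homologyπ pq) := by
      have h := pageCycles_homologyπ_iso X data r r' hrr' hr pq
      have h' : Epi (pageCycles X data r r' hrr' hr pq ≫ ((X.spectralSequence data).page r hr).homologyπ pq) := by
        have h' : Epi ((pageCycles X data r r' hrr' hr pq ≫ ((X.spectralSequence data).page r hr).homologyπ pq) ≫
          ((X.spectralSequence data).iso r r' pq hrr' hr).hom) := by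
          rw [assoc, h]; infer_instance
        have := epi_comp ((pageCycles X data r r' hrr' hr pq ≫ ((X.spectralSequence data).page r hr).homologyπ pq) ≫
          ((X.spectralSequence data).iso r r' pq hrr' hr).hom)
          ((X.spectralSequence data).iso r r' pq hrr' hr).inv
        simpa using this
      have h₁ : Epi ((((K.mapHomologicalComplex (c r)).obj ((X.spectralSequence data).page r hr)).liftCycles _ _ rfl w' ≫
        ((K.mapHomologicalComplex (c r)).obj ((X.spectralSequence data).page r hr)).homologyπ pq) ≫ (mapHomologyIso K ((X.spectralSequence data).page r hr) pq).hom) := by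
        rw [assoc, h₀]
        exact inferInstanceAs (Epi (K.map (pageCycles X data r r' hrr' hr pq ≫ ((X.spectralSequence data).page r hr).homologyπ pq)))
      have := epi_comp ((((K.mapHomologicalComplex (c r)).obj ((X.spectralSequence data).page r hr)).liftCycles _ _ rfl w' ≫
        ((K.mapHomologicalComplex (c r)).obj ((X.spectralSequence data).page r hr)).homologyπ pq) ≫ (mapHomologyIso K ((X.spectralSequence data).page r hr) pq).hom)
        (mapHomologyIso K ((X.spectralSequence data).page r hr) pq).inv
      simpa using this
    refine (cancel_epi (((K.mapHomologicalComplex (c r)).obj ((X.spectralSequence data).page r hr)).liftCycles _ _ rfl w' ≫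
        ((K.mapHomologicalComplex (c r)).obj ((X.spectralSequence data).page r hr)).homologyπ pq)).1 ?_
    -- The cycles of page `r` are again an `E`, whose first index is that of page `r'`, and `pageι`
    -- is one of the maps `X.map`; so `map_EMap` computes the map induced on cycles.
    have h₁ : ((K.mapHomologicalComplex (c r)).obj ((X.spectralSequence data).page r hr)).liftCycles _ _ rfl w' ≫
        HomologicalComplex.cyclesMap (φ.pageMap data r hr) pq =
        φ.EMap _ _ _ _ _ _ (by lia) (by lia) ≫ pageCycles Y data r r' hrr' hr pq := by
      rw [← cancel_mono (HomologicalComplex.iCycles _ _)]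
      rw [assoc, assoc, HomologicalComplex.cyclesMap_i]
      refine (HomologicalComplex.liftCycles_i_assoc _ _ _ rfl w' _).trans ?_
      refine Eq.trans ?_ (whisker_eq _ (HomologicalComplex.liftCycles_i _ _ _ rfl
        (pageι_d Y data r r' hrr' hr pq))).symm
      change K.map _ ≫ K.map (pageIso X data r hr pq).hom ≫ φ.EMap _ _ _ _ _ _ _ _ ≫
        (pageIso Y data r hr pq).inv = _
      rw [← K.map_comp_assoc, assoc, Iso.inv_hom_id, comp_id]
      exact (assoc _ _ _).symm.trans ((φ.map_EMap _ _ _ _ _ _ _ _ _ _ _ _ =≫ _).trans (assoc _ _ _))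
    have hY := pageCycles_homologyπ_iso Y data r r' hrr' hr pq
    have hX := K.congr_map (pageCycles_homologyπ_iso X data r r' hrr' hr pq)
    have hl : (((K.mapHomologicalComplex (c r)).obj ((X.spectralSequence data).page r hr)).liftCycles _ _ rfl w' ≫
        ((K.mapHomologicalComplex (c r)).obj ((X.spectralSequence data).page r hr)).homologyπ pq) ≫
        HomologicalComplex.homologyMap (φ.pageMap data r hr) pq ≫
        ((Y.spectralSequence data).iso r r' pq hrr' hr).hom =
        φ.EMap _ _ _ _ _ _ (by lia) (by lia) ≫ pageπ Y data r r' hrr' hr pq ≫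
          (pageIso Y data r' (by lia) pq).inv := by
      rw [assoc, HomologicalComplex.homologyπ_naturality_assoc, reassoc_of% h₁, hY]
    refine hl.trans ?_
    have hr : (((K.mapHomologicalComplex (c r)).obj ((X.spectralSequence data).page r hr)).liftCycles _ _ rfl w' ≫
        ((K.mapHomologicalComplex (c r)).obj ((X.spectralSequence data).page r hr)).homologyπ pq) ≫ (mapHomologyIso K ((X.spectralSequence data).page r hr) pq).hom ≫
        K.map ((X.spectralSequence data).iso r r' pq hrr' hr).hom =
        K.map (pageπ X data r r' hrr' hr pq ≫ (pageIso X data r' (by lia) pq).inv) := by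
      rw [← hX, assoc, reassoc_of% h₀, ← K.map_comp, assoc]
      rfl
    refine Eq.trans ?_ (((assoc _ _ _).symm.trans (hr =≫ φ.pageMapX data r' (by lia) pq))).symm
    change _ = _ ≫ K.map (pageIso X data r' (by lia) pq).hom ≫ φ.EMap _ _ _ _ _ _ _ _ ≫
      (pageIso Y data r' (by lia) pq).inv
    rw [← K.map_comp_assoc, assoc, Iso.inv_hom_id, comp_id]
    -- The same square `map_EMap`, now for `pageπ`, whose target is page `r'`.
    exact (assoc _ _ _).symm.trans (((φ.map_EMap _ _ _ _ _ _ _ _ _ _ _ _).symm =≫ _).trans (assoc _ _ _))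

/-- On the first page the outer arrows of `E` are identities, so `EMap_EIsoH` applies. This makes
the second page of the Grothendieck spectral sequence computable. -/
lemma pageMapX_spectralSequenceFirstPageXIso_hom [data.HasFirstPageComputation] (pq : κ)
    (i₁ i₂ : ι) (hi₁ : i₁ = data.i₁ pq) (hi₂ : i₂ = data.i₂ pq) (n : ℤ) (hn : n = data.deg pq) :
    φ.pageMapX data r₀ le_rfl pq ≫
      (Y.spectralSequenceFirstPageXIso data pq i₁ i₂ hi₁ hi₂ n hn).hom =
    K.map (X.spectralSequenceFirstPageXIso data pq i₁ i₂ hi₁ hi₂ n hn).hom ≫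
      (φ.hom n).app (mk₁ (homOfLE (data.le₁₂' pq hi₁ hi₂))) := by
  rw [Y.spectralSequenceFirstPageXIso_hom data pq i₁ i₂ hi₁ hi₂ (n - 1) n (n + 1) hn,
    X.spectralSequenceFirstPageXIso_hom data pq i₁ i₂ hi₁ hi₂ (n - 1) n (n + 1) hn,
    K.map_comp, assoc, ← φ.EMap_EIsoH]
  refine (assoc _ _ _).symm.trans ((φ.pageMapX_comp_spectralSequencePageXIso_hom data _ _ _ _ _ _ _
    _ _ _ _ _ _ _ _ _ _ =≫ _).trans (assoc _ _ _))

lemma spectralSequenceMap_naturality {X₁ : Abelian.SpectralObject C ι}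
    {Y₁ : Abelian.SpectralObject D ι} (φ₁ : HomAlong K X₁ Y₁) (a : X ⟶ X₁) (b : Y ⟶ Y₁)
    [X₁.HasSpectralSequence data] [Y₁.HasSpectralSequence data]
    (h : ∀ n, Functor.whiskerRight (Abelian.SpectralObject.Hom.hom a n) K ≫ φ₁.hom n =
      φ.hom n ≫ Abelian.SpectralObject.Hom.hom b n) :
    (mapSpectralSequence K).map (GrothendieckSS.spectralSequenceMap a data) ≫
      φ₁.spectralSequenceMap data =
    φ.spectralSequenceMap data ≫ GrothendieckSS.spectralSequenceMap b data := by
  ext r hr pq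
  change K.map ((pageIso X data r hr pq).hom ≫ GrothendieckSS.EMap a _ _ _ _ _ _ ≫
    (pageIso X₁ data r hr pq).inv) ≫ K.map (pageIso X₁ data r hr pq).hom ≫
      φ₁.EMap _ _ _ _ _ _ _ _ ≫ (pageIso Y₁ data r hr pq).inv =
    (K.map (pageIso X data r hr pq).hom ≫ φ.EMap _ _ _ _ _ _ _ _ ≫ (pageIso Y data r hr pq).inv) ≫
     (pageIso Y data r hr pq).hom ≫ GrothendieckSS.EMap b _ _ _ _ _ _ ≫
    (pageIso Y₁ data r hr pq).inv
  have h' := map_EMap_comp φ φ₁ a b (homOfLE (data.le₀₁ r pq)) (homOfLE (data.le₁₂ pq))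
    (homOfLE (data.le₂₃ r pq)) (data.deg pq - 1) (data.deg pq) (data.deg pq + 1)
    (by lia) (by lia) h
  simp only [K.map_comp, assoc, Iso.inv_hom_id_assoc]
  rw [← K.map_comp_assoc (Iso.inv _), Iso.inv_hom_id, K.map_id, id_comp, reassoc_of% h']

end

section

variable {C D : Type*} [Category* C] [Category* D] [Abelian C] [Abelian D]
  {K : C ⥤ D} [K.Additive] [PreservesFiniteLimits K] [PreservesFiniteColimits K]
  {X : Abelian.SpectralObject C EInt} {Y : Abelian.SpectralObject D EInt} (φ : HomAlong K X Y)

/-- `infPageIso` moves the outer indices from `⊥` and `⊤` to those of page `r`, then identifies the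
result with the page. Each of the three isomorphisms commutes with the maps induced by `φ`. -/
lemma EMap_infPageIso_hom (pq : ℤ × ℤ) (r : ℤ) (hr : 2 ≤ r) (i₁ i₂ : EInt) (h₁ : i₁ = (pq.2 : EInt))
    (h₂ : i₂ = ((pq.2 + 1 : ℤ) : EInt)) (n : ℤ) (hn : n = pq.1 + pq.2)
    (hX₀ : IsZero ((X.H (n + 1)).obj (mk₁ (homOfLE (bot_le : ⊥ ≤ ((pq.2 - r + 2 : ℤ) : EInt))))))
    (hX₃ : IsZero ((X.H (n - 1)).obj (mk₁ (homOfLE (le_top : ((pq.2 + r - 1 : ℤ) : EInt) ≤ ⊤)))))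
    (hY₀ : IsZero ((Y.H (n + 1)).obj (mk₁ (homOfLE (bot_le : ⊥ ≤ ((pq.2 - r + 2 : ℤ) : EInt))))))
    (hY₃ : IsZero ((Y.H (n - 1)).obj (mk₁ (homOfLE (le_top : ((pq.2 + r - 1 : ℤ) : EInt) ≤ ⊤))))) :
    φ.EMap _ _ _ _ _ _ (by lia) (by lia) ≫
      (infPageIso Y pq r hr i₁ i₂ h₁ h₂ n hn hY₀ hY₃).hom =
    K.map (infPageIso X pq r hr i₁ i₂ h₁ h₂ n hn hX₀ hX₃).hom ≫
      φ.pageMapX coreE₂Cohomological r hr pq := by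
  have e₁ := φ.map_EMap _ _ _ (n - 1) n (n + 1) (by lia) (by lia) _ _ _
    (fourδ₁Toδ₀' ⊥ ((pq.2 - r + 2 : ℤ) : EInt) i₁ i₂ ⊤ bot_le (le₀₁ pq r hr i₁ h₁)
    (le₁₂ pq i₁ i₂ h₁ h₂) le_top)
  have e₂ := φ.map_EMap _ _ _ (n - 1) n (n + 1) (by lia) (by lia) _ _ _
    (fourδ₄Toδ₃' ((pq.2 - r + 2 : ℤ) : EInt) i₁ i₂ ((pq.2 + r - 1 : ℤ) : EInt) ⊤
    (le₀₁ pq r hr i₁ h₁) (le₁₂ pq i₁ i₂ h₁ h₂) (le₂₃ pq r hr i₂ h₂) le_top)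
  have e₃ := φ.pageMapX_comp_spectralSequencePageXIso_hom coreE₂Cohomological r hr pq _ i₁ i₂ _ rfl
    h₁ h₂ rfl (n - 1) n (n + 1) hn (by lia) (by lia)
  exact comp_trans_symm_trans_symm_hom _ _ _ _ _ _ _ _ _ _ e₁ e₂ e₃

variable [X.IsFirstQuadrant] [Y.IsFirstQuadrant]

/-- A morphism of first quadrant spectral objects along an exact functor induces a morphism of
converging spectral sequences. -/
lemma compatible : Convergence.Compatible ((ssConvergence X).map K) (ssConvergence Y)
    (φ.spectralSequenceMap coreE₂Cohomological)
    (fun n => (φ.hom n).app (mk₁ (homOfLE (bot_le : (⊥ : EInt) ≤ ⊤)))) := by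
  -- What remains is the graded part: the projection onto it is `opcyclesToE` followed by
  -- `infPageIso`, which `h₁` and `h₂` treat in turn.
  refine ⟨fun n p => φ.opcyclesMap _ _ n, fun n p => φ.opcyclesMap_fromOpcycles _ _ n _ _, ?_⟩
  intro n p q r h hr hr'
  have h₁ := φ.opcyclesMap_opcyclesToE (homOfLE (bot_le : ⊥ ≤ filIdx n (p + 1)))
    (homOfLE (filIdx_le n p)) (homOfLE (le_top : filIdx n p ≤ ⊤)) (homOfLE bot_le) rfl
    (n - 1) n (n + 1) (by lia) (by lia)
  have h₂ := φ.EMap_infPageIso_hom (p, q) r (le_trans (le_max_left _ _) hr) (filIdx n (p + 1))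
    (filIdx n p)
    (by subst h; lia) (by subst h; lia) n h.symm (ssConvergence_hz₀ X p q r n hr)
      (ssConvergence_hz₃ X p q r n h hr) (ssConvergence_hz₀ Y p q r n hr)
      (ssConvergence_hz₃ Y p q r n h hr)
  refine Eq.trans ?_ (((assoc _ _ _).symm.trans (h₁ =≫ _)).trans
    ((assoc _ _ _).trans (whisker_eq _ h₂))).symm
  exact (K.map_comp _ _ =≫ _).trans (assoc _ _ _)

end

end HomAlong

end SemilinearSpectralSequence

end GrothendieckSS

namespace GrothendieckSS

/-! ### Truncations at extended integers and their universal properties -/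

section ETruncation

open Pretriangulated ComposableArrows

variable {C : Type*} [Category* C] [Preadditive C] [HasZeroObject C] [HasShift C ℤ]
  [∀ (n : ℤ), (shiftFunctor C n).Additive] [Pretriangulated C] (t : TStructure C)

/-- The objects concentrated in degrees `< i`, for `i` in `ℤ ∪ {-∞, +∞}`. -/
def IsELT (i : EInt) (X : C) : Prop :=
  WithBotTop.rec (motive := fun _ => Prop) (IsZero X) (fun n => t.IsLE X (n - 1)) True i

/-- The objects concentrated in degrees `≥ i`, for `i` in `ℤ ∪ {-∞, +∞}`. -/
def IsEGE (i : EInt) (X : C) : Prop :=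
  WithBotTop.rec (motive := fun _ => Prop) True (fun n => t.IsGE X n) (IsZero X) i

variable {t}

/-- The orthogonality axiom of a t-structure. At the infinite indices one of the two objects is
zero. -/
lemma IsELT.hom_eq_zero {i : EInt} {X Y : C} (hX : IsELT t i X) (hY : IsEGE t i Y) (f : X ⟶ Y) :
    f = 0 := by
  induction i using WithBotTop.rec with
  | bot => exact IsZero.eq_of_src hX _ _
  | coe n => exact t.zero_of_isLE_of_isGE f (n - 1) n (by lia) hX hY
  | top => exact IsZero.eq_of_tgt hY _ _

/-- Needed for uniqueness in `desc_ext_of_isELT`, where two solutions differ by a map out of the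
shifted first vertex. -/
lemma IsELT.shift {i : EInt} {X : C} (hX : IsELT t i X) : IsELT t i (X⟦(1 : ℤ)⟧) := by
  induction i using WithBotTop.rec with
  | bot => exact (shiftFunctor C (1 : ℤ)).map_isZero hX
  | coe n =>
    have : t.IsLE X (n - 1) := hX
    have := t.isLE_shift X (n - 1) 1 (n - 2)
    exact t.isLE_of_le _ (n - 2) (n - 1)
  | top => trivial

lemma IsELT.mono {i j : EInt} (h : i ≤ j) {X : C} (hX : IsELT t i X) : IsELT t j X := by
  induction i using WithBotTop.rec with
  | bot =>
    induction j using WithBotTop.rec with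
    | bot => exact hX
    | coe m => exact t.isLE_of_isZero hX _
    | top => trivial
  | coe n =>
    induction j using WithBotTop.rec with
    | bot => simp at h
    | coe m =>
      have : t.IsLE X (n - 1) := hX
      simp only [WithBotTop.coe_le_coe] at h
      exact t.isLE_of_le X (n - 1) (m - 1) (by lia)
    | top => trivial
  | top =>
    obtain rfl : j = ⊤ := by simpa using h
    trivial

lemma IsEGE.mono {i j : EInt} (h : i ≤ j) {X : C} (hX : IsEGE t j X) : IsEGE t i X := by
  induction j using WithBotTop.rec with
  | top =>
    induction i using WithBotTop.rec with
    | bot => trivial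
    | coe m => exact t.isGE_of_isZero hX _
    | top => exact hX
  | coe n =>
    induction i using WithBotTop.rec with
    | bot => trivial
    | coe m =>
      have : t.IsGE X n := hX
      exact t.isGE_of_ge X m n (by simpa using h)
    | top => simp at h
  | bot =>
    obtain rfl : i = ⊥ := by simpa using h
    trivial

variable (t)

lemma isELT_eTruncLT (i : EInt) (X : C) : IsELT t i ((t.eTruncLT.obj i).obj X) := by
  induction i using WithBotTop.rec with
  | bot => exact Functor.zero_obj X
  | coe n => exact inferInstanceAs (t.IsLE ((t.truncLT n).obj X) (n - 1))
  | top => trivial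

lemma isEGE_eTruncGE (i : EInt) (X : C) : IsEGE t i ((t.eTruncGE.obj i).obj X) := by
  induction i using WithBotTop.rec with
  | bot => trivial
  | coe n => exact inferInstanceAs (t.IsGE ((t.truncGE n).obj X) n)
  | top => exact Functor.zero_obj X

lemma isELT_eTruncGE_eTruncLT [IsTriangulated C] (i j : EInt) (X : C) :
    IsELT t j ((t.eTruncGE.obj i).obj ((t.eTruncLT.obj j).obj X)) := by
  induction j using WithBotTop.rec with
  | bot => exact (t.eTruncGE.obj i).map_isZero (Functor.zero_obj X)
  | coe n => exact inferInstanceAs (t.IsLE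
      ((t.eTruncGE.obj i).obj ((t.truncLT n).obj X)) (n - 1))
  | top => trivial

variable {t}

/-- By the truncation triangle of `Y`, the obstruction to lifting is a map from an object in degrees
`< i` to one in degrees `≥ i`. -/
lemma exists_lift_eTruncLT {i : EInt} {X Y : C} (hX : IsELT t i X) (f : X ⟶ Y) :
    ∃ g : X ⟶ (t.eTruncLT.obj i).obj Y, g ≫ (t.eTruncLTι i).app Y = f := by
  obtain ⟨g, hg⟩ := Triangle.coyoneda_exact₂ _ (t.eTriangleLTGE_distinguished i Y) f
    (hX.hom_eq_zero (isEGE_eTruncGE t i Y) _)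
  exact ⟨g, hg.symm⟩

lemma to_eTruncLT_ext {i : EInt} {X Y : C} (hX : IsELT t i X)
    {f g : X ⟶ (t.eTruncLT.obj i).obj Y}
    (h : f ≫ (t.eTruncLTι i).app Y = g ≫ (t.eTruncLTι i).app Y) : f = g := by
  induction i using WithBotTop.rec with
  | bot => exact IsZero.eq_of_src hX _ _
  | coe n =>
    have : t.IsLE X (n - 1) := hX
    exact t.to_truncLT_obj_ext h
  -- At `⊤` nothing is truncated, so no orthogonality is needed.
  | top => exact (cancel_mono ((t.eTruncLTι ⊤).app Y)).1 h

section

variable {a : EInt} {T : Triangle C} (hT : T ∈ distTriang C) {Y : C} (h₁ : IsELT t a T.obj₁)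
  (hY : IsEGE t a Y)
include hT h₁ hY

/-- The obstruction is a map `T.obj₁ ⟶ Y`, zero by orthogonality. An arbitrary distinguished
triangle is allowed, because the lemma is applied to the images of truncation triangles under a
functor. -/
lemma exists_desc_of_isELT (f : T.obj₂ ⟶ Y) : ∃ g : T.obj₃ ⟶ Y, T.mor₂ ≫ g = f := by
  obtain ⟨g, hg⟩ := Triangle.yoneda_exact₂ _ hT f (h₁.hom_eq_zero hY _)
  exact ⟨g, hg.symm⟩

/-- The difference factors through `T.obj₁⟦1⟧`, which is still in degrees `< a`. -/
lemma desc_ext_of_isELT {f g : T.obj₃ ⟶ Y} (h : T.mor₂ ≫ f = T.mor₂ ≫ g) : f = g := by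
  obtain ⟨r, hr⟩ := Triangle.yoneda_exact₃ _ hT (f - g)
    (by rw [Preadditive.comp_sub, h, sub_self])
  rw [← sub_eq_zero, hr, h₁.shift.hom_eq_zero hY r, comp_zero]

end

end ETruncation

/-! ### Comparing a t-exact functor with truncations -/

section TExact

open Pretriangulated ComposableArrows

variable {C D : Type*} [Category* C] [Preadditive C] [HasZeroObject C] [HasShift C ℤ]
  [∀ (n : ℤ), (shiftFunctor C n).Additive] [Pretriangulated C]
  [Category* D] [Preadditive D] [HasZeroObject D] [HasShift D ℤ]
  [∀ (n : ℤ), (shiftFunctor D n).Additive] [Pretriangulated D]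
  (k : C ⥤ D) [k.CommShift ℤ] [k.IsTriangulated] (t : TStructure C) (t' : TStructure D)

/-- A functor between triangulated categories equipped with t-structures is t-exact if it
preserves the objects concentrated in degrees `≤ n` and `≥ n`. -/
class IsTExact : Prop where
  isLE_obj (X : C) (n : ℤ) : t.IsLE X n → t'.IsLE (k.obj X) n
  isGE_obj (X : C) (n : ℤ) : t.IsGE X n → t'.IsGE (k.obj X) n

variable [hk : IsTExact k t t']

variable {t} in
lemma IsELT.map {i : EInt} {X : C} (hX : IsELT t i X) : IsELT t' i (k.obj X) := by
  induction i using WithBotTop.rec with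
  | bot => exact k.map_isZero hX
  | coe n => exact hk.isLE_obj _ _ hX
  | top => trivial

section

variable (i : EInt) (X : C)

/-- The comparison morphism `k (τ_{< i} X) ⟶ τ_{< i} (k X)`. -/
noncomputable def eTruncLTComparison :
    k.obj ((t.eTruncLT.obj i).obj X) ⟶ (t'.eTruncLT.obj i).obj (k.obj X) :=
  (exists_lift_eTruncLT ((isELT_eTruncLT t i X).map k t') (k.map ((t.eTruncLTι i).app X))).choose

lemma eTruncLTComparison_ι : eTruncLTComparison k t t' i X ≫ (t'.eTruncLTι i).app (k.obj X) =
    k.map ((t.eTruncLTι i).app X) :=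
  (exists_lift_eTruncLT ((isELT_eTruncLT t i X).map k t') (k.map ((t.eTruncLTι i).app X))).choose_spec

/-- As for the other identities about the comparison morphisms, uniqueness in the universal property
leaves only an equality of maps to the untruncated object. -/
lemma eTruncLTComparison_naturality {X Y : C} (f : X ⟶ Y) :
    k.map ((t.eTruncLT.obj i).map f) ≫ eTruncLTComparison k t t' i Y =
      eTruncLTComparison k t t' i X ≫ (t'.eTruncLT.obj i).map (k.map f) := by
  refine to_eTruncLT_ext ((isELT_eTruncLT t i X).map k t') ?_
  rw [assoc, eTruncLTComparison_ι, assoc, t'.eTruncLTι_naturality, reassoc_of% eTruncLTComparison_ι k t t' i X,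
    ← k.map_comp, ← k.map_comp, t.eTruncLTι_naturality]

lemma map_eTruncLT_map_comparison {i j : EInt} (f : i ⟶ j) :
    k.map ((t.eTruncLT.map f).app X) ≫ eTruncLTComparison k t t' j X =
      eTruncLTComparison k t t' i X ≫ (t'.eTruncLT.map f).app (k.obj X) := by
  refine to_eTruncLT_ext (((isELT_eTruncLT t i X).map k t').mono (leOfHom f)) ?_
  rw [assoc, eTruncLTComparison_ι, assoc, t'.eTruncLT_map_app_eTruncLTι_app,
    eTruncLTComparison_ι, ← k.map_comp, t.eTruncLT_map_app_eTruncLTι_app]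

end

section

variable (i j : EInt) (X : C)

/-- The image under `k` of the truncation triangles of `X`. -/
noncomputable abbrev mapETriangle : Triangle D := k.mapTriangle.obj ((t.eTriangleLTGE.obj i).obj X)

lemma mapETriangle_distinguished : mapETriangle k t i X ∈ distTriang D :=
  k.map_distinguished _ (t.eTriangleLTGE_distinguished i X)

-- The universal property of τ^{≥ i} survives the application of `k`: the image of the truncation
-- triangle is distinguished and its first vertex remains in degrees `< i`.
variable {X} in
lemma from_eTruncGE_ext {Y : D} (hY : IsEGE t' i Y)
    {f g : k.obj ((t.eTruncGE.obj i).obj X) ⟶ Y}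
    (h : k.map ((t.eTruncGEπ i).app X) ≫ f = k.map ((t.eTruncGEπ i).app X) ≫ g) : f = g :=
  desc_ext_of_isELT (mapETriangle_distinguished k t i X) ((isELT_eTruncLT t i X).map k t') hY h

variable {X} in
lemma exists_desc_eTruncGE {Y : D} (hY : IsEGE t' i Y) (f : k.obj X ⟶ Y) :
    ∃ g : k.obj ((t.eTruncGE.obj i).obj X) ⟶ Y, k.map ((t.eTruncGEπ i).app X) ≫ g = f :=
  exists_desc_of_isELT (mapETriangle_distinguished k t i X) ((isELT_eTruncLT t i X).map k t') hY f

/-- The comparison morphism `k (τ_{≥ i} τ_{< j} X) ⟶ τ_{≥ i} τ_{< j} (k X)`. -/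
noncomputable def eTruncComparison :
    k.obj ((t.eTruncGE.obj i).obj ((t.eTruncLT.obj j).obj X)) ⟶
      (t'.eTruncGE.obj i).obj ((t'.eTruncLT.obj j).obj (k.obj X)) :=
  (exists_desc_eTruncGE k t t' i (isEGE_eTruncGE t' i _)
    (eTruncLTComparison k t t' j X ≫ (t'.eTruncGEπ i).app _)).choose

lemma π_eTruncComparison :
    k.map ((t.eTruncGEπ i).app _) ≫ eTruncComparison k t t' i j X =
      eTruncLTComparison k t t' j X ≫ (t'.eTruncGEπ i).app _ :=
  (exists_desc_eTruncGE k t t' i (isEGE_eTruncGE t' i _)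
    (eTruncLTComparison k t t' j X ≫ (t'.eTruncGEπ i).app _)).choose_spec

lemma eTruncComparison_naturality {X Y : C} (f : X ⟶ Y) :
    k.map ((t.eTruncGE.obj i).map ((t.eTruncLT.obj j).map f)) ≫ eTruncComparison k t t' i j Y =
      eTruncComparison k t t' i j X ≫ (t'.eTruncGE.obj i).map ((t'.eTruncLT.obj j).map (k.map f)) := by
  refine from_eTruncGE_ext k t t' i (isEGE_eTruncGE t' i _) ?_
  rw [← k.map_comp_assoc, t.eTruncGEπ_naturality, k.map_comp_assoc, π_eTruncComparison,
    reassoc_of% eTruncLTComparison_naturality k t t' j f, reassoc_of% π_eTruncComparison k t t' i j X, t'.eTruncGEπ_naturality]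

lemma map_ω₁_map_comparison {x y : ComposableArrows EInt 1} (f : x ⟶ y) :
    k.map ((t.ω₁.map f).app X) ≫ eTruncComparison k t t' (y.obj 0) (y.obj 1) X =
      eTruncComparison k t t' (x.obj 0) (x.obj 1) X ≫ (t'.ω₁.map f).app (k.obj X) := by
  -- The target is in degrees `≥ y.obj 0`, hence `≥ x.obj 0`, which is the truncation occurring in
  -- the source.
  refine from_eTruncGE_ext k t t' _ ((isEGE_eTruncGE t' _ _).mono (leOfHom (f.app 0))) ?_
  have h : (t.eTruncGEπ (x.obj 0)).app ((t.eTruncLT.obj (x.obj 1)).obj X) ≫ (t.ω₁.map f).app X =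
      (t.eTruncLT.map (f.app 1)).app X ≫ (t.eTruncGEπ (y.obj 0)).app _ :=
    (t.eTruncGEπ_app_eTruncGE_map_app_assoc (f.app 0) _ _).trans
      (t.eTruncGEπ_naturality _ _)
  have h' : (t'.eTruncGEπ (x.obj 0)).app ((t'.eTruncLT.obj (x.obj 1)).obj (k.obj X)) ≫
      (t'.ω₁.map f).app (k.obj X) =
      (t'.eTruncLT.map (f.app 1)).app (k.obj X) ≫ (t'.eTruncGEπ (y.obj 0)).app _ :=
    (t'.eTruncGEπ_app_eTruncGE_map_app_assoc (f.app 0) _ _).trans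
      (t'.eTruncGEπ_naturality _ _)
  refine (k.map_comp_assoc _ _ _).symm.trans ?_
  refine ((k.congr_map h =≫ _).trans (k.map_comp_assoc _ _ _)).trans ?_
  refine (whisker_eq _ (π_eTruncComparison k t t' _ _ X)).trans ?_
  refine (assoc _ _ _).symm.trans
    ((map_eTruncLT_map_comparison k t t' X (f.app 1) =≫ _).trans ((assoc _ _ _).trans ?_))
  exact (whisker_eq _ h'.symm).trans ((assoc _ _ _).symm.trans
    ((π_eTruncComparison k t t' (x.obj 0) (x.obj 1) X =≫ _).symm.trans (assoc _ _ _)))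

end

section

variable [IsTriangulated C] [IsTriangulated D] (X : C)

/-- The comparison morphisms between truncations are part of a morphism of spectral objects. -/
noncomputable def spectralObjectComparison :
    (t.spectralObject X).mapTriangulatedFunctor k ⟶ t'.spectralObject (k.obj X) where
  hom :=
    { app x := eTruncComparison k t t' (x.obj 0) (x.obj 1) X
      naturality x y f := map_ω₁_map_comparison k t t' X f }
  comm {a b c} f g := by
    have hT := (((t.spectralObject X).mapTriangulatedFunctor k).triangle_distinguished f g)
    have hT' := ((t'.spectralObject (k.obj X)).triangle_distinguished f g)
    -- A third map completing a morphism of triangles is compatible with `δ` but in general not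
    -- unique. Here the first vertex is in degrees `< b` and the target in degrees `≥ b`, so `ψ` is
    -- determined by its restriction along the second map and must be the comparison morphism.
    obtain ⟨ψ, h₁, h₂⟩ := complete_distinguished_triangle_morphism _ _ hT hT'
      (eTruncComparison k t t' a b X) (eTruncComparison k t t' a c X)
      (map_ω₁_map_comparison k t t' X (twoδ₂Toδ₁ f g _ rfl))
    obtain rfl : ψ = eTruncComparison k t t' b c X :=
      desc_ext_of_isELT hT ((isELT_eTruncGE_eTruncLT t a b X).map k t')
        (isEGE_eTruncGE t' b _)
        (h₁.trans (map_ω₁_map_comparison k t t' X (twoδ₁Toδ₀ f g _ rfl)).symm)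
    exact h₂

end

end TExact

end GrothendieckSS

namespace GrothendieckSS

/-! ### Detecting compatibility with shifts -/

section CommShiftReflection

variable {C D E M : Type*} [Category* C] [Category* D] [Category* E] [AddMonoid M]
  [HasShift C M] [HasShift D M] [HasShift E M]

/-- The shift isomorphisms of `ι` can be cancelled, so the square for `τ` commutes after applying
`ι`, and `ι` is faithful. -/
lemma commShift_of_whiskerRight {F G : C ⥤ D} [F.CommShift M] [G.CommShift M] (τ : F ⟶ G)
    (ι : D ⥤ E) [ι.CommShift M] [ι.Faithful]
    [NatTrans.CommShift (Functor.whiskerRight τ ι) M] : NatTrans.CommShift τ M := by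
  refine ⟨fun a => ?_⟩
  ext X
  apply ι.map_injective
  have h := NatTrans.shift_app_comm (Functor.whiskerRight τ ι) a X
  rw [Functor.commShiftIso_comp_hom_app, Functor.commShiftIso_comp_hom_app] at h
  have h' := (ι.commShiftIso a).hom.naturality (τ.app X)
  rw [← cancel_mono ((ι.commShiftIso a).hom.app (G.obj X))]
  dsimp at h h' ⊢
  rw [ι.map_comp, ι.map_comp, assoc, assoc, h']
  exact (assoc _ _ _).symm.trans h

/-- The square holds at the objects in the image of `L`; by naturality it is transported to every
object isomorphic to one of these. -/
lemma commShift_of_whiskerLeft {F G : D ⥤ E} [F.CommShift M] [G.CommShift M] (τ : F ⟶ G)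
    (L : C ⥤ D) [L.CommShift M] [L.EssSurj]
    [NatTrans.CommShift (Functor.whiskerLeft L τ) M] : NatTrans.CommShift τ M := by
  refine ⟨fun a => ?_⟩
  ext Y
  have h := NatTrans.shift_app_comm (Functor.whiskerLeft L τ) a (L.objPreimage Y)
  rw [Functor.commShiftIso_comp_hom_app, Functor.commShiftIso_comp_hom_app] at h
  dsimp at h
  rw [← τ.naturality_assoc, assoc, cancel_epi] at h
  have e := L.objObjPreimageIso Y
  rw [← cancel_epi (F.map (e.hom⟦a⟧'))]
  have h₁ := (F.commShiftIso a).hom.naturality e.hom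
  have h₂ := (G.commShiftIso a).hom.naturality e.hom
  dsimp at h₁ h₂ ⊢
  rw [τ.naturality_assoc, h₂, reassoc_of% h₁, ← Functor.map_comp, τ.naturality,
    Functor.map_comp, reassoc_of% h]

end CommShiftReflection

/-! ### Functors on bounded below categories: shifts and t-exactness -/

section MapPlus

open DerivedCategory Pretriangulated

variable {A B : Type*} [Category* A] [Category* B] [Abelian A] [Abelian B]
  [HasDerivedCategory A] [HasDerivedCategory B]

section

variable (F : A ⥤ B) [F.Additive]

/-- The bounded below homotopy category functor is induced by the unbounded one. -/
noncomputable def mapHPlusCompι :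
    F.mapHomotopyCategoryPlus ⋙ HomotopyCategory.Plus.ι B ≅
      HomotopyCategory.Plus.ι A ⋙ F.mapHomotopyCategory (.up ℤ) := Iso.refl _

instance : NatTrans.CommShift (mapHPlusCompι F).hom ℤ :=
  inferInstanceAs (NatTrans.CommShift (ObjectProperty.liftCompιIso _ _ _).hom ℤ)

end

section

variable (K : A ⥤ B) [K.Additive] [PreservesFiniteLimits K] [PreservesFiniteColimits K]

noncomputable instance : (mapPlus K).CommShift ℤ := by
  dsimp only [mapPlus]; infer_instance

instance : (mapPlus K).IsTriangulated := by
  dsimp only [mapPlus]; infer_instance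

/-- `mapPlus K` is induced by the functor between unbounded derived categories. -/
noncomputable def mapPlusCompι : mapPlus K ⋙ Plus.ι ≅ Plus.ι ⋙ K.mapDerivedCategory := Iso.refl _

instance : NatTrans.CommShift (mapPlusCompι K).hom ℤ :=
  inferInstanceAs (NatTrans.CommShift (ObjectProperty.liftCompιIso _ _ _).hom ℤ)

instance : NatTrans.CommShift (Plus.QhCompιIsoιCompQh A).hom ℤ :=
  inferInstanceAs (NatTrans.CommShift (ObjectProperty.liftCompιIso _ _ _).hom ℤ)

instance : NatTrans.CommShift (mapPlusFactors K).hom ℤ := by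
  have : NatTrans.CommShift (Functor.whiskerRight (mapPlusFactors K).hom Plus.ι) ℤ := by
    -- `mapPlusFactors` is defined by cancelling the fully faithful `Plus.ι`, so its shift
    -- compatibility is visible after `Plus.ι`. There it is a composite of known isomorphisms, all
    -- with identity components except `K.mapDerivedCategoryFactorsh`.
    have e : Functor.whiskerRight (mapPlusFactors K).hom Plus.ι =
        (Functor.associator _ _ _).hom ≫ Functor.whiskerLeft Plus.Qh (mapPlusCompι K).hom ≫
        (Functor.associator _ _ _).inv ≫
        Functor.whiskerRight (Plus.QhCompιIsoιCompQh A).hom K.mapDerivedCategory ≫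
        (Functor.associator _ _ _).hom ≫
        Functor.whiskerLeft (HomotopyCategory.Plus.ι A) K.mapDerivedCategoryFactorsh.hom ≫
        (Functor.associator _ _ _).inv ≫
        Functor.whiskerRight (mapHPlusCompι K).inv DerivedCategory.Qh ≫
        (Functor.associator _ _ _).hom ≫
        Functor.whiskerLeft K.mapHomotopyCategoryPlus (Plus.QhCompιIsoιCompQh B).inv ≫
        (Functor.associator _ _ _).inv := by
      ext X
      refine (Plus.ι.map_preimage _).trans ?_
      simp only [NatTrans.comp_app, Functor.associator_hom_app, Functor.associator_inv_app,
        id_comp, comp_id]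
      change K.mapDerivedCategoryFactorsh.hom.app X.obj = 𝟙 _ ≫
        K.mapDerivedCategory.map (𝟙 (DerivedCategory.Qh.obj X.obj)) ≫
        K.mapDerivedCategoryFactorsh.hom.app X.obj ≫
        DerivedCategory.Qh.map (𝟙 ((K.mapHomotopyCategory (.up ℤ)).obj X.obj)) ≫ 𝟙 _
      simp
    rw [e]
    infer_instance
  exact commShift_of_whiskerRight _ Plus.ι

/-- Membership in the t-structure is detected by vanishing of cohomology, and cohomology commutes
with the exact functor `K`. -/
instance : IsTExact (mapPlus K) Plus.TStructure.t Plus.TStructure.t where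
  isLE_obj X n h := by
    refine (Plus.isLE_ι_obj_iff _ _).1 ((DerivedCategory.isLE_iff _ _).2 ?_)
    intro i hi
    exact (K.map_isZero (X.isZero_homology_of_isLE n i hi)).of_iso ((mapPlusHomology K i).app X)
  isGE_obj X n h := by
    refine (Plus.isGE_ι_obj_iff _ _).1 ((DerivedCategory.isGE_iff _ _).2 ?_)
    intro i hi
    exact (K.map_isZero (X.isZero_homology_of_isGE n i hi)).of_iso ((mapPlusHomology K i).app X)

end

section

variable {F F' : A ⥤ B} [F.Additive] [F'.Additive] (α : F ⟶ F')

instance : NatTrans.CommShift (NatTrans.mapHomologicalComplex α (.up ℤ)) ℤ := by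
  refine ⟨fun a => ?_⟩
  ext K n
  simp only [NatTrans.comp_app, Functor.whiskerRight_app, Functor.whiskerLeft_app,
    HomologicalComplex.comp_f, Functor.mapHomologicalComplex_commShiftIso_hom_app_f]
  exact (id_comp _).trans (comp_id _).symm

/-- From complexes to the homotopy category the compatibility descends along the essentially
surjective quotient functor; the restriction to bounded below objects then uses the faithful
inclusion. The composition isomorphisms below follow the same route. -/
instance : NatTrans.CommShift (NatTrans.mapHomotopyCategory α (.up ℤ)) ℤ := by
  have : NatTrans.CommShift (Functor.whiskerLeft (HomotopyCategory.quotient A (.up ℤ))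
      (NatTrans.mapHomotopyCategory α (.up ℤ))) ℤ := by
    have e : Functor.whiskerLeft (HomotopyCategory.quotient A (.up ℤ))
      (NatTrans.mapHomotopyCategory α (.up ℤ)) =
        (F.mapHomotopyCategoryFactors (.up ℤ)).hom ≫
        Functor.whiskerRight (NatTrans.mapHomologicalComplex α (.up ℤ)) _ ≫
        (F'.mapHomotopyCategoryFactors (.up ℤ)).inv := by
      ext X
      exact ((id_comp _).trans (comp_id _)).symm
    rw [e]
    infer_instance
  exact commShift_of_whiskerLeft _ (HomotopyCategory.quotient A (.up ℤ))

instance : NatTrans.CommShift (mapHPlus α) ℤ := by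
  have : NatTrans.CommShift (Functor.whiskerRight (mapHPlus α) (HomotopyCategory.Plus.ι B)) ℤ := by
    have e : Functor.whiskerRight (mapHPlus α) (HomotopyCategory.Plus.ι B) =
        (mapHPlusCompι F).hom ≫ Functor.whiskerLeft (HomotopyCategory.Plus.ι A)
          (NatTrans.mapHomotopyCategory α (.up ℤ)) ≫ (mapHPlusCompι F').inv := by
      ext X
      exact ((id_comp _).trans (comp_id _)).symm
    rw [e]
    infer_instance
  exact commShift_of_whiskerRight _ (HomotopyCategory.Plus.ι B)

end

section

variable {C : Type*} [Category* C] [Abelian C] (F : A ⥤ B) (G : B ⥤ C) (H : A ⥤ C)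
  [F.Additive] [G.Additive] [H.Additive] (e : F ⋙ G ≅ H)

instance : NatTrans.CommShift (Functor.mapHomologicalComplexCompIso e (.up ℤ)).hom ℤ := by
  refine ⟨fun a => ?_⟩
  ext K n
  simp only [NatTrans.comp_app, Functor.whiskerRight_app, Functor.whiskerLeft_app,
    HomologicalComplex.comp_f, Functor.mapHomologicalComplex_commShiftIso_hom_app_f,
    Functor.commShiftIso_comp_hom_app]
  refine Eq.trans ?_ (comp_id _).symm
  refine Eq.trans ((?_ : _ = 𝟙 _) =≫ _) (id_comp _)
  exact (comp_id _).trans (G.map_id _)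

instance : NatTrans.CommShift (Functor.mapHomotopyCategoryCompIso e (.up ℤ)).hom ℤ := by
  have : NatTrans.CommShift (Functor.whiskerLeft (HomotopyCategory.quotient A (.up ℤ))
      (Functor.mapHomotopyCategoryCompIso e (.up ℤ)).hom) ℤ := by
    have e : Functor.whiskerLeft (HomotopyCategory.quotient A (.up ℤ))
      (Functor.mapHomotopyCategoryCompIso e (.up ℤ)).hom =
        (Functor.associator _ _ _).inv ≫
        Functor.whiskerRight (F.mapHomotopyCategoryFactors (.up ℤ)).hom _ ≫
        (Functor.associator _ _ _).hom ≫
        Functor.whiskerLeft (F.mapHomologicalComplex (.up ℤ))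
          (G.mapHomotopyCategoryFactors (.up ℤ)).hom ≫
        (Functor.associator _ _ _).inv ≫
        Functor.whiskerRight (Functor.mapHomologicalComplexCompIso e (.up ℤ)).hom _ ≫
        (H.mapHomotopyCategoryFactors (.up ℤ)).inv := by
      ext X
      simp only [NatTrans.comp_app, Functor.associator_hom_app, Functor.associator_inv_app,
        id_comp]
      refine Eq.trans ?_ ((CategoryTheory.Functor.map_id (G.mapHomotopyCategory (.up ℤ)) _ =≫ _).trans
        (id_comp _)).symm
      refine Eq.trans ?_ (id_comp _).symm
      exact (comp_id _).symm
    rw [e]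
    infer_instance
  exact commShift_of_whiskerLeft _ (HomotopyCategory.quotient A (.up ℤ))

instance : NatTrans.CommShift (Functor.mapHomotopyCategoryPlusCompIso e).hom ℤ := by
  have : NatTrans.CommShift (Functor.whiskerRight (Functor.mapHomotopyCategoryPlusCompIso e).hom
      (HomotopyCategory.Plus.ι C)) ℤ := by
    have e : Functor.whiskerRight (Functor.mapHomotopyCategoryPlusCompIso e).hom
      (HomotopyCategory.Plus.ι C) =
        (Functor.associator _ _ _).hom ≫
        Functor.whiskerLeft F.mapHomotopyCategoryPlus (mapHPlusCompι G).hom ≫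
        (Functor.associator _ _ _).inv ≫
        Functor.whiskerRight (mapHPlusCompι F).hom (G.mapHomotopyCategory (.up ℤ)) ≫
        (Functor.associator _ _ _).hom ≫
        Functor.whiskerLeft (HomotopyCategory.Plus.ι A)
          (Functor.mapHomotopyCategoryCompIso e (.up ℤ)).hom ≫ (mapHPlusCompι H).inv := by
      ext X
      simp only [NatTrans.comp_app, Functor.associator_hom_app, Functor.associator_inv_app,
        id_comp]
      refine Eq.trans ?_ (id_comp _).symm
      refine Eq.trans ?_ ((CategoryTheory.Functor.map_id (G.mapHomotopyCategory (.up ℤ)) _ =≫ _).trans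
        (id_comp _)).symm
      exact (comp_id _).symm
    rw [e]
    infer_instance
  exact commShift_of_whiskerRight _ (HomotopyCategory.Plus.ι C)

end

end MapPlus

end GrothendieckSS

namespace GrothendieckSS

/-! ### Cohomology, exact functors and shifts -/

section MapHomologyShift

lemma natTrans_ext_of_essSurj {C D E : Type*} [Category* C] [Category* D] [Category* E]
    {F G : D ⥤ E} {α β : F ⟶ G} (L : C ⥤ D) [L.EssSurj]
    (h : ∀ X, α.app (L.obj X) = β.app (L.obj X)) : α = β := by
  ext Y
  rw [← cancel_epi (F.map (L.objObjPreimageIso Y).hom), α.naturality, β.naturality, h]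

lemma map_XIsoOfEq_hom {A B : Type*} [Category* A] [Category* B] [Preadditive A] [Preadditive B]
    (K : A ⥤ B) [K.Additive] {κ : Type*} {c : ComplexShape κ} (L : HomologicalComplex A c)
    {i j : κ} (h : i = j) : K.map (L.XIsoOfEq h).hom =
      (HomologicalComplex.XIsoOfEq ((K.mapHomologicalComplex c).obj L) h).hom := by
  subst h
  exact K.map_id _

open DerivedCategory Pretriangulated

variable {A B : Type*} [Category* A] [Category* B] [Abelian A] [Abelian B]
  (K : A ⥤ B) [K.Additive] [PreservesFiniteLimits K] [PreservesFiniteColimits K]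

/-- Both shift isomorphisms come from isomorphisms of short complexes with the sign (-1)ⁿ on the
outer terms. An additive functor commutes with signs, so the two short complex maps agree (`h₂`),
and naturality of `mapHomologyIso` concludes. -/
lemma homologyMap_commShiftIso_mapHomologyIso (L : CochainComplex A ℤ) (n a a' : ℤ)
    (h : n + a = a') :
    HomologicalComplex.homologyMap
        (((K.mapHomologicalComplex (.up ℤ)).commShiftIso n).hom.app L) a ≫
      ((HomologicalComplex.homologyFunctor B (.up ℤ) 0).shiftIso n a a' h).hom.app
        ((K.mapHomologicalComplex (.up ℤ)).obj L) ≫ (mapHomologyIso K L a').hom =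
    (mapHomologyIso K (L⟦n⟧) a).hom ≫
      K.map (((HomologicalComplex.homologyFunctor A (.up ℤ) 0).shiftIso n a a' h).hom.app L) := by
  have hA := CochainComplex.ShiftSequence.shiftIso_hom_app n a a' h L
  have hB := CochainComplex.ShiftSequence.shiftIso_hom_app n a a' h
    ((K.mapHomologicalComplex (.up ℤ)).obj L)
  have h₁ := ShortComplex.mapHomologyIso_hom_naturality
    ((CochainComplex.shiftShortComplexFunctorIso A n a a' h).hom.app L) K
  have h₂ : (HomologicalComplex.shortComplexFunctor B (.up ℤ) a).map
      (((K.mapHomologicalComplex (.up ℤ)).commShiftIso n).hom.app L) ≫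
        (CochainComplex.shiftShortComplexFunctorIso B n a a' h).hom.app
          ((K.mapHomologicalComplex (.up ℤ)).obj L) =
      K.mapShortComplex.map ((CochainComplex.shiftShortComplexFunctorIso A n a a' h).hom.app L) := by
    ext
    · refine (id_comp _).trans ?_
      refine (CochainComplex.shiftShortComplexFunctorIso_hom_app_τ₁ ..).trans (Eq.trans ?_
        (K.congr_map (CochainComplex.shiftShortComplexFunctorIso_hom_app_τ₁ ..).symm))
      refine Eq.trans ?_ (Functor.map_units_smul (R := ℤ) K _ _).symm
      exact congrArg (n.negOnePow • ·) (map_XIsoOfEq_hom K L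
        (by simp only [CochainComplex.prev]; lia)).symm
    · refine (id_comp _).trans ?_
      refine (CochainComplex.shiftShortComplexFunctorIso_hom_app_τ₂ ..).trans (Eq.trans ?_
        (K.congr_map (CochainComplex.shiftShortComplexFunctorIso_hom_app_τ₂ ..).symm))
      exact (map_XIsoOfEq_hom K L (by lia)).symm
    · refine (id_comp _).trans ?_
      refine (CochainComplex.shiftShortComplexFunctorIso_hom_app_τ₃ ..).trans (Eq.trans ?_
        (K.congr_map (CochainComplex.shiftShortComplexFunctorIso_hom_app_τ₃ ..).symm))
      refine Eq.trans ?_ (Functor.map_units_smul (R := ℤ) K _ _).symm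
      exact congrArg (n.negOnePow • ·) (map_XIsoOfEq_hom K L
        (by simp only [CochainComplex.next]; lia)).symm
  refine Eq.trans ?_ (h₁.trans (whisker_eq _ (K.congr_map hA.symm)))
  refine (assoc _ _ _).symm.trans (Eq.trans ?_ (congrArg (fun f => ShortComplex.homologyMap f) h₂) =≫ _)
  refine Eq.trans (whisker_eq _ hB) ?_
  exact (ShortComplex.homologyMap_comp _ _).symm

variable [HasDerivedCategory A] [HasDerivedCategory B]

lemma mapDerivedCategoryHomology_hom_app_Q_obj (L : CochainComplex A ℤ) (n : ℤ) :
    (mapDerivedCategoryHomology K n).hom.app (Q.obj L) =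
      (homologyFunctor B n).map (K.mapDerivedCategoryFactors.hom.app L) ≫
      (homologyFunctorFactors B n).hom.app _ ≫ (mapHomologyIso K L n).hom ≫
        K.map ((homologyFunctorFactors A n).inv.app L) := by
  -- The liftings chosen in the definition of `mapDerivedCategoryHomology` are restored, so that
  -- `liftNatTrans_app` speaks of the same transformation.
  let : Localization.Lifting DerivedCategory.Q (HomologicalComplex.quasiIso A (.up ℤ))
    (DerivedCategory.Q ⋙ K.mapDerivedCategory ⋙ homologyFunctor B n)
    (K.mapDerivedCategory ⋙ homologyFunctor B n) := ⟨Iso.refl _⟩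
  let : Localization.Lifting DerivedCategory.Q (HomologicalComplex.quasiIso A (.up ℤ))
    (DerivedCategory.Q ⋙ homologyFunctor A n ⋙ K)
    (homologyFunctor A n ⋙ K) := ⟨Iso.refl _⟩
  have h := Localization.liftNatTrans_app DerivedCategory.Q
    (HomologicalComplex.quasiIso A (.up ℤ)) _ _ (K.mapDerivedCategory ⋙ homologyFunctor B n)
    (homologyFunctor A n ⋙ K) (QmapDerivedCategoryHomology K n).hom L
  refine h.trans ?_
  refine (id_comp _).trans ((comp_id _).trans ?_)
  simp only [QmapDerivedCategoryHomology, Iso.trans_hom, NatTrans.comp_app, Iso.symm_hom,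
    Functor.associator_hom_app, Functor.associator_inv_app, Functor.isoWhiskerRight_hom,
    Functor.isoWhiskerLeft_hom, Functor.whiskerRight_app, Functor.whiskerLeft_app,
    id_comp, comp_id]
  rfl

lemma homologyFunctor_map_Q_commShiftIso (L : CochainComplex A ℤ) (n a a' : ℤ)
    (h : n + a = a') :
    (homologyFunctor A a).map ((Q.commShiftIso n).hom.app L) ≫
      ((homologyFunctor A 0).shiftIso n a a' h).hom.app (Q.obj L) =
    (homologyFunctorFactors A a).hom.app (L⟦n⟧) ≫
      ((HomologicalComplex.homologyFunctor A (.up ℤ) 0).shiftIso n a a' h).hom.app L ≫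
      (homologyFunctorFactors A a').inv.app L := by
  -- The shift isomorphism is the shift map of the identity of `L⟦n⟧`.
  have h₁ := shiftMap_homologyFunctor_map_Q (𝟙 (L⟦n⟧)) a a' h
  refine Eq.trans ?_ (h₁.trans (whisker_eq _ (Eq.trans ((?_ : _ = 𝟙 _) =≫ _) (id_comp _) =≫ _)))
  · refine Functor.congr_map _ ?_ =≫ _
    exact ((CategoryTheory.Functor.map_id Q _ =≫ _).trans (id_comp _)).symm
  · exact CategoryTheory.Functor.map_id _ _

/-- The chase for `commShiftIso_shiftIso_mapDerivedCategoryHomology_Q` in an arbitrary category.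
After the epimorphism `m₁`, both sides are rewritten until only the square `e₄` of complexes is
left. -/
lemma comparison_of_factorizations {C : Type*} [Category* C]
    {X₀ X₁ X₂ X₃ X₄ Y₀ Y₁ Z₀ Z₁ Z₂ W₁ W₂ W₃ V₁ V₂ V₃ : C}
    (m₁ : X₀ ⟶ X₁) (m₂ : X₁ ⟶ X₂) (s : X₂ ⟶ X₃) (N' : X₃ ⟶ X₄) (N₁ : X₁ ⟶ Y₁) (ks : Y₁ ⟶ X₄)
    (N₀ : X₀ ⟶ Y₀) (kc : Y₀ ⟶ Y₁) (kf : Y₀ ⟶ Z₁) (ks' : Z₁ ⟶ Z₂) (kf' : Z₂ ⟶ X₄)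
    (hf₀ : X₀ ⟶ W₁) (fB₀ : W₁ ⟶ Z₀) (mh₀ : Z₀ ⟶ Z₁) (kfi : Z₁ ⟶ Y₀)
    (hc : Z₀ ⟶ V₁) (sB : V₁ ⟶ V₂) (mh : V₂ ⟶ Z₂) (hf : X₃ ⟶ V₃) (fB : V₃ ⟶ V₂)
    (hfs : X₂ ⟶ W₃) (sQ : W₃ ⟶ V₃) {hQc : W₁ ⟶ W₂} {hcQ : W₂ ⟶ W₃} {fB₁ : W₂ ⟶ V₁}
    {fBi : V₂ ⟶ V₃} [Epi m₁]
    (e₇ : m₁ ≫ N₁ = N₀ ≫ kc) (e₁ : kc ≫ ks = kf ≫ ks' ≫ kf')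
    (eN₀ : N₀ = hf₀ ≫ fB₀ ≫ mh₀ ≫ kfi) (hK : kfi ≫ kf = 𝟙 _) (e₄ : hc ≫ sB ≫ mh = mh₀ ≫ ks')
    (eN' : N' = hf ≫ fB ≫ mh ≫ kf') (e₅ : hfs ≫ sQ = s ≫ hf)
    (e₃ : (m₁ ≫ m₂) ≫ hfs = hf₀ ≫ hQc ≫ hcQ) (e₂ : hcQ ≫ sQ = fB₁ ≫ sB ≫ fBi)
    (hB : fBi ≫ fB = 𝟙 _) (e₆ : hQc ≫ fB₁ = fB₀ ≫ hc) :
    m₂ ≫ s ≫ N' = N₁ ≫ ks := by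
  rw [← cancel_epi m₁, reassoc_of% e₇, e₁, eN₀, eN', ← reassoc_of% e₅]
  simp only [assoc] at e₃ ⊢
  rw [reassoc_of% e₃, reassoc_of% e₂, reassoc_of% hB, reassoc_of% e₆, reassoc_of% e₄,
    reassoc_of% hK]

lemma commShiftIso_shiftIso_mapDerivedCategoryHomology_Q (L : CochainComplex A ℤ) (n a a' : ℤ)
    (h : n + a = a') :
    (homologyFunctor B a).map ((K.mapDerivedCategory.commShiftIso n).hom.app (Q.obj L)) ≫
      ((homologyFunctor B 0).shiftIso n a a' h).hom.app (K.mapDerivedCategory.obj (Q.obj L)) ≫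
      (mapDerivedCategoryHomology K a').hom.app (Q.obj L) =
    (mapDerivedCategoryHomology K a).hom.app ((Q.obj L)⟦n⟧) ≫
      K.map (((homologyFunctor A 0).shiftIso n a a' h).hom.app (Q.obj L)) := by
  have e₁ := homologyFunctor_map_Q_commShiftIso L n a a' h
  have e₂ := homologyFunctor_map_Q_commShiftIso ((K.mapHomologicalComplex (.up ℤ)).obj L) n a a' h
  have e₃ := NatTrans.shift_app_comm K.mapDerivedCategoryFactors.hom n L
  rw [Functor.commShiftIso_comp_hom_app, Functor.commShiftIso_comp_hom_app] at e₃
  have e₄ := homologyMap_commShiftIso_mapHomologyIso K L n a a' h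
  have e₅ := ((homologyFunctor B 0).shiftIso n a a' h).hom.naturality
    (K.mapDerivedCategoryFactors.hom.app L)
  have e₆ := homologyFunctorFactors_hom_naturality
    (((K.mapHomologicalComplex (.up ℤ)).commShiftIso n).hom.app L) a
  have e₇ := (mapDerivedCategoryHomology K a).hom.naturality ((Q.commShiftIso n).hom.app L)
  have e₃' := (homologyFunctor B a).congr_map e₃
  simp only [Functor.map_comp] at e₃'
  have e₁' := (K.map_comp _ _).symm.trans ((K.congr_map e₁).trans
    ((K.map_comp _ _).trans (whisker_eq _ (K.map_comp _ _))))
  have : Epi ((K.mapDerivedCategory ⋙ homologyFunctor B a).map ((Q.commShiftIso n).hom.app L)) :=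
    inferInstance
  exact comparison_of_factorizations _ _ _ _ _ _ _ _ _ _ _ _ _ _ _ _ _ _ _ _ _ _ e₇ e₁'
    (mapDerivedCategoryHomology_hom_app_Q_obj K (L⟦n⟧) a)
    ((K.map_comp _ _).symm.trans ((K.congr_map
      ((homologyFunctorFactors A a).inv_hom_id_app (L⟦n⟧))).trans (K.map_id _))) e₄
    (mapDerivedCategoryHomology_hom_app_Q_obj K L a') e₅ e₃' e₂
    ((homologyFunctorFactors B a').inv_hom_id_app _) e₆

/-- Both sides are natural in `X`, and every object is isomorphic to the image of a complex under
`Q`. -/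
lemma commShiftIso_shiftIso_mapDerivedCategoryHomology (X : DerivedCategory A) (n a a' : ℤ)
    (h : n + a = a') :
    (homologyFunctor B a).map ((K.mapDerivedCategory.commShiftIso n).hom.app X) ≫
      ((homologyFunctor B 0).shiftIso n a a' h).hom.app (K.mapDerivedCategory.obj X) ≫
      (mapDerivedCategoryHomology K a').hom.app X =
    (mapDerivedCategoryHomology K a).hom.app (X⟦n⟧) ≫
      K.map (((homologyFunctor A 0).shiftIso n a a' h).hom.app X) := by
  let α : (shiftFunctor _ n ⋙ K.mapDerivedCategory) ⋙ homologyFunctor B a ⟶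
      homologyFunctor A a' ⋙ K :=
    Functor.whiskerRight (K.mapDerivedCategory.commShiftIso n).hom _ ≫
      (Functor.associator _ _ _).hom ≫
      Functor.whiskerLeft K.mapDerivedCategory ((homologyFunctor B 0).shiftIso n a a' h).hom ≫
      (mapDerivedCategoryHomology K a').hom
  let β : (shiftFunctor _ n ⋙ K.mapDerivedCategory) ⋙ homologyFunctor B a ⟶
      homologyFunctor A a' ⋙ K :=
    (Functor.associator _ _ _).hom ≫
      Functor.whiskerLeft _ (mapDerivedCategoryHomology K a).hom ≫
      (Functor.associator _ _ _).inv ≫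
      Functor.whiskerRight ((homologyFunctor A 0).shiftIso n a a' h).hom K
  have hα (X) : α.app X = (homologyFunctor B a).map ((K.mapDerivedCategory.commShiftIso n).hom.app X) ≫
      ((homologyFunctor B 0).shiftIso n a a' h).hom.app (K.mapDerivedCategory.obj X) ≫
      (mapDerivedCategoryHomology K a').hom.app X := whisker_eq _ (id_comp _)
  have hβ (X) : β.app X = (mapDerivedCategoryHomology K a).hom.app (X⟦n⟧) ≫
      K.map (((homologyFunctor A 0).shiftIso n a a' h).hom.app X) :=
    (id_comp _).trans (whisker_eq _ (id_comp _))
  have e : α = β := natTrans_ext_of_essSurj Q (fun L => (hα _).trans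
    ((commShiftIso_shiftIso_mapDerivedCategoryHomology_Q K L n a a' h).trans (hβ _).symm))
  exact (hα X).symm.trans ((congr_app e X).trans (hβ X))

lemma plus_homologyFunctor_shiftIso_hom_app (X : Plus A) (n a a' : ℤ) (h : n + a = a') :
    ((Plus.homologyFunctor A 0).shiftIso n a a' h).hom.app X =
      (homologyFunctor A a).map ((Plus.ι.commShiftIso n).hom.app X) ≫
      ((homologyFunctor A 0).shiftIso n a a' h).hom.app (Plus.ι.obj X) :=
  (id_comp _).trans (whisker_eq _ (id_comp _))

lemma ι_map_commShiftIso_mapPlus (X : Plus A) (n : ℤ) :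
    Plus.ι.map (((mapPlus K).commShiftIso n).hom.app X) ≫
      (Plus.ι.commShiftIso n).hom.app ((mapPlus K).obj X) =
    K.mapDerivedCategory.map ((Plus.ι.commShiftIso n).hom.app X) ≫
      (K.mapDerivedCategory.commShiftIso n).hom.app (Plus.ι.obj X) := by
  have e := NatTrans.shift_app_comm (mapPlusCompι K).hom n X
  rw [Functor.commShiftIso_comp_hom_app, Functor.commShiftIso_comp_hom_app] at e
  refine Eq.trans ?_ (e.trans (id_comp _))
  exact ((whisker_eq _ ((shiftFunctor (DerivedCategory B) n).map_id _)).trans (comp_id _)).symm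

lemma comparison_of_square {C : Type*} [Category* C] {X₀ X₁ X₂ X₃ X₄ Y₁ Z₀ Z₁ Z₂ : C}
    {p : X₀ ⟶ X₁} {q : X₁ ⟶ X₂} {s : X₂ ⟶ X₃} {N' : X₃ ⟶ X₄} {d : X₀ ⟶ Y₁} {c : Y₁ ⟶ X₂}
    {N₁ : Y₁ ⟶ Z₁} {ks : Z₁ ⟶ X₄} {N₀ : X₀ ⟶ Z₀} {kc : Z₀ ⟶ Z₁} {qs : X₁ ⟶ X₃} {f : Z₂ ⟶ X₄}
    {g : Z₀ ⟶ Z₂} (e₁ : p ≫ q = d ≫ c) (e₂ : c ≫ s ≫ N' = N₁ ≫ ks) (e₃ : d ≫ N₁ = N₀ ≫ kc)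
    (e₄ : qs = q ≫ s) (e₅ : kc ≫ ks = g ≫ f) : p ≫ qs ≫ N' = N₀ ≫ g ≫ f := by
  rw [e₄, assoc, reassoc_of% e₁, e₂, reassoc_of% e₃, e₅]

/-- The form used later: with `n = 1` for the connecting morphisms of the spectral objects, and with
`n = -q` for the second page. -/
lemma commShiftIso_shiftIso_mapPlusHomology (X : Plus A) (n a a' : ℤ) (h : n + a = a') :
    (Plus.homologyFunctor B a).map (((mapPlus K).commShiftIso n).hom.app X) ≫
      ((Plus.homologyFunctor B 0).shiftIso n a a' h).hom.app ((mapPlus K).obj X) ≫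
      (mapPlusHomology K a').hom.app X =
    (mapPlusHomology K a).hom.app (X⟦n⟧) ≫
      K.map (((Plus.homologyFunctor A 0).shiftIso n a a' h).hom.app X) := by
  have e' := commShiftIso_shiftIso_mapDerivedCategoryHomology K (Plus.ι.obj X) n a a' h
  have e₁ := plus_homologyFunctor_shiftIso_hom_app ((mapPlus K).obj X) n a a' h
  have e₂ := ι_map_commShiftIso_mapPlus K X n
  have e₃ := (mapDerivedCategoryHomology K a).hom.naturality ((Plus.ι.commShiftIso n).hom.app X)
  have e₄ := plus_homologyFunctor_shiftIso_hom_app X n a a' h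
  refine Eq.trans ?_ (whisker_eq _ (comp_id _))
  exact comparison_of_square (((homologyFunctor B a).map_comp _ _).symm.trans
    (((homologyFunctor B a).congr_map e₂).trans ((homologyFunctor B a).map_comp _ _))) e' e₃ e₁
    ((K.map_comp _ _).symm.trans ((K.congr_map e₄.symm).trans (comp_id _).symm))

end MapHomologyShift

end GrothendieckSS

namespace GrothendieckSS

/-! ### Single complexes under an exact functor -/

section MapSingle

/-- A map into a single complex is determined in its one nonzero degree, and there each map involved
reduces to an `eqToHom`. -/
lemma map_cochainComplex_singleFunctors_shiftIso {A B : Type*} [Category* A] [Category* B] [Abelian A]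
    [Abelian B] (K : A ⥤ B) [K.Additive] (Y : A) (n a a' : ℤ) (h : n + a = a') :
    (K.mapHomologicalComplex (.up ℤ)).map
        (((CochainComplex.singleFunctors A).shiftIso n a a' h).hom.app Y) ≫
      (HomologicalComplex.singleMapHomologicalComplex K (.up ℤ) a).hom.app Y =
    ((K.mapHomologicalComplex (.up ℤ)).commShiftIso n).hom.app
        ((CochainComplex.singleFunctor A a').obj Y) ≫
      ((HomologicalComplex.singleMapHomologicalComplex K (.up ℤ) a').hom.app Y)⟦n⟧' ≫
      ((CochainComplex.singleFunctors B).shiftIso n a a' h).hom.app (K.obj Y) := by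
  obtain rfl : a' = a + n := by lia
  apply HomologicalComplex.to_single_hom_ext
  have h₁ : (((CochainComplex.singleFunctors A).shiftIso n a (a + n) h).hom.app Y).f a =
    eqToHom (by simp [CochainComplex.singleFunctors, HomologicalComplex.single]) := rfl
  have h₂ : (((CochainComplex.singleFunctors B).shiftIso n a (a + n) h).hom.app (K.obj Y)).f a =
    eqToHom (by simp [CochainComplex.singleFunctors, HomologicalComplex.single]) := rfl
  have h₃ := HomologicalComplex.singleMapHomologicalComplex_hom_app_self K (.up ℤ) a Y
  have h₄ := HomologicalComplex.singleMapHomologicalComplex_hom_app_self K (.up ℤ) (a + n) Y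
  have h₅ := (K.congr_map h₁).trans (eqToHom_map _ _)
  refine (congrArg₂ (· ≫ ·) h₅ h₃).trans (Eq.trans ?_
    ((id_comp _).trans (congrArg₂ (· ≫ ·) h₄ h₂)).symm)
  simp [HomologicalComplex.singleObjXSelf, HomologicalComplex.singleObjXIsoOfEq, eqToHom_map]
  exact (eqToHom_trans _ _).trans (eqToHom_trans _ _).symm

open DerivedCategory Pretriangulated

variable {A B : Type*} [Category* A] [Category* B] [Abelian A] [Abelian B]
  (K : A ⥤ B) [K.Additive] [PreservesFiniteLimits K] [PreservesFiniteColimits K]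

lemma homologyMap_singleMapHomologicalComplex (Y : A) (q : ℤ) :
    HomologicalComplex.homologyMap
      ((HomologicalComplex.singleMapHomologicalComplex K (.up ℤ) q).hom.app Y) q ≫
      (HomologicalComplex.singleObjHomologySelfIso (.up ℤ) q (K.obj Y)).hom =
    (mapHomologyIso K ((HomologicalComplex.single A (.up ℤ) q).obj Y) q).hom ≫
      K.map (HomologicalComplex.singleObjHomologySelfIso (.up ℤ) q Y).hom := by
  let φ : (K.mapHomologicalComplex (.up ℤ)).obj
      ((HomologicalComplex.single A (.up ℤ) q).obj Y) ⟶
        (HomologicalComplex.single B (.up ℤ) q).obj (K.obj Y) := (HomologicalComplex.singleMapHomologicalComplex K (.up ℤ) q).hom.app Y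
  let x := (HomologicalComplex.singleObjXSelf (.up ℤ) q Y).inv
  have hx : x ≫ ((HomologicalComplex.single A (.up ℤ) q).obj Y).d q
      ((ComplexShape.up ℤ).next q) = 0 := comp_zero
  let x' : K.obj Y ⟶ ((K.mapHomologicalComplex (.up ℤ)).obj
    ((HomologicalComplex.single A (.up ℤ) q).obj Y)).X q := K.map x
  have hx' : x' ≫ ((K.mapHomologicalComplex (.up ℤ)).obj
    ((HomologicalComplex.single A (.up ℤ) q).obj Y)).d q ((ComplexShape.up ℤ).next q) = 0 :=
      (whisker_eq _ (K.map_zero _ _)).trans comp_zero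
  -- `u` sends `K.obj Y` to the homology of the image complex by the tautological cycle; the two
  -- composites to be compared both become the identity after `u`.
  let u := HomologicalComplex.liftCycles ((K.mapHomologicalComplex (.up ℤ)).obj
    ((HomologicalComplex.single A (.up ℤ) q).obj Y)) x' _ rfl
      hx' ≫ HomologicalComplex.homologyπ _ q
  have h₁ : u ≫ HomologicalComplex.homologyMap φ q ≫
      (HomologicalComplex.singleObjHomologySelfIso (.up ℤ) q (K.obj Y)).hom = 𝟙 _ := by
    dsimp only [u]
    rw [assoc, HomologicalComplex.homologyπ_naturality_assoc,
      HomologicalComplex.homologyπ_singleObjHomologySelfIso_hom,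
      HomologicalComplex.singleObjCyclesSelfIso_hom, HomologicalComplex.cyclesMap_i_assoc,
      HomologicalComplex.liftCycles_i_assoc]
    refine (whisker_eq _ (congrArg (· ≫ _)
      (HomologicalComplex.singleMapHomologicalComplex_hom_app_self K (.up ℤ) q Y))).trans ?_
    refine (whisker_eq _ ((assoc _ _ _).trans ((whisker_eq _ (Iso.inv_hom_id _)).trans
      (comp_id _)))).trans ?_
    exact (K.mapIso (HomologicalComplex.singleObjXSelf (.up ℤ) q Y)).inv_hom_id
  have h₂ : u ≫ (mapHomologyIso K ((HomologicalComplex.single A (.up ℤ) q).obj Y) q).hom ≫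
      K.map (HomologicalComplex.singleObjHomologySelfIso (.up ℤ) q Y).hom = 𝟙 _ := by
    have h := Convergence.liftCycles_mapHomologyIso K ((HomologicalComplex.single A (.up ℤ) q).obj Y)
      q _ x rfl hx hx'
    refine (assoc _ _ _).symm.trans (((assoc _ _ _).trans h =≫ _).trans
      ((K.map_comp _ _).symm.trans (Eq.trans (K.congr_map ?_) (K.map_id _))))
    rw [assoc, HomologicalComplex.homologyπ_singleObjHomologySelfIso_hom,
      HomologicalComplex.singleObjCyclesSelfIso_hom, HomologicalComplex.liftCycles_i_assoc]
    exact Iso.inv_hom_id _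
  have : IsIso (HomologicalComplex.homologyMap φ q ≫
      (HomologicalComplex.singleObjHomologySelfIso (.up ℤ) q (K.obj Y)).hom) := inferInstance
  -- By `h₁`, `u` is the inverse of an isomorphism, so it can be cancelled.
  have hu : IsIso u := by
    rw [(IsIso.eq_comp_inv _).2 h₁]
    infer_instance
  exact (cancel_epi u).1 (h₁.trans h₂.symm)

variable [HasDerivedCategory A] [HasDerivedCategory B]

lemma mapDerivedCategorySingleFunctor_hom_app (Y : A) (n : ℤ) :
    (K.mapDerivedCategorySingleFunctor n).hom.app Y =
      K.mapDerivedCategoryFactors.hom.app ((HomologicalComplex.single A (.up ℤ) n).obj Y) ≫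
      Q.map ((HomologicalComplex.singleMapHomologicalComplex K (.up ℤ) n).hom.app Y) := by
  have h₁ : K.mapDerivedCategory.map ((singleFunctorIsoCompQ A n).hom.app Y) = 𝟙 _ :=
    K.mapDerivedCategory.map_id _
  refine (h₁ =≫ _).trans ((id_comp _).trans ?_)
  refine (id_comp _).trans (whisker_eq _ ?_)
  refine (id_comp _).trans (Eq.trans (whisker_eq _ ?_) (comp_id _))
  exact id_comp _

lemma singleFunctorCompHomologyFunctorIso_hom_app (Y : A) (n : ℤ) :
    (singleFunctorCompHomologyFunctorIso A n).hom.app Y =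
      (homologyFunctorFactors A n).hom.app ((HomologicalComplex.single A (.up ℤ) n).obj Y) ≫
      (HomologicalComplex.singleObjHomologySelfIso (.up ℤ) n Y).hom := by
  have h₁ : (homologyFunctor A n).map (((singleFunctorsPostcompQIso A).hom.hom n).app Y) =
      𝟙 _ := by
    rw [singleFunctorsPostcompQIso_hom_hom]
    exact CategoryTheory.Functor.map_id _ _
  exact (h₁ =≫ _).trans ((id_comp _).trans (id_comp _))

lemma homologyFunctor_map_mapDerivedCategorySingleFunctor (Y : A) (q : ℤ) :
    (homologyFunctor B q).map ((K.mapDerivedCategorySingleFunctor q).hom.app Y) ≫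
      (singleFunctorCompHomologyFunctorIso B q).hom.app (K.obj Y) =
    (mapDerivedCategoryHomology K q).hom.app ((singleFunctor A q).obj Y) ≫
      K.map ((singleFunctorCompHomologyFunctorIso A q).hom.app Y) := by
  have e₁ := homologyMap_singleMapHomologicalComplex K Y q
  have e₂ := mapDerivedCategoryHomology_hom_app_Q_obj K
    ((HomologicalComplex.single A (.up ℤ) q).obj Y) q
  have e₃ := homologyFunctorFactors_hom_naturality
    ((HomologicalComplex.singleMapHomologicalComplex K (.up ℤ) q).hom.app Y) q
  have e₄ := K.congr_map ((homologyFunctorFactors A q).inv_hom_id_app_assoc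
    ((HomologicalComplex.single A (.up ℤ) q).obj Y)
      (HomologicalComplex.singleObjHomologySelfIso (.up ℤ) q Y).hom)
  rw [mapDerivedCategorySingleFunctor_hom_app, singleFunctorCompHomologyFunctorIso_hom_app,
    singleFunctorCompHomologyFunctorIso_hom_app]
  refine ((homologyFunctor B q).map_comp _ _ =≫ _).trans ((assoc _ _ _).trans ?_)
  refine (whisker_eq _ ((assoc _ _ _).symm.trans ((e₃ =≫ _).trans (assoc _ _ _)))).trans ?_
  refine (whisker_eq _ (whisker_eq _ e₁)).trans (Eq.trans ?_ (e₂.symm =≫ _))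
  refine Eq.trans ?_ ((assoc _ _ _).trans (whisker_eq _ ((assoc _ _ _).trans
    (whisker_eq _ (assoc _ _ _))))).symm
  exact whisker_eq _ (whisker_eq _ (whisker_eq _ (e₄.symm.trans (K.map_comp _ _))))

lemma Q_commShiftIso_singleFunctors_shiftIso (Y : A) (n a a' : ℤ) (h : n + a = a') :
    (Q.commShiftIso n).hom.app ((CochainComplex.singleFunctor A a').obj Y) ≫
      ((singleFunctors A).shiftIso n a a' h).hom.app Y =
    Q.map (((CochainComplex.singleFunctors A).shiftIso n a a' h).hom.app Y) := by
  have e := congr_app ((singleFunctorsPostcompQIso A).hom.comm n a a' h) Y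
  have h₁ : ((singleFunctorsPostcompQIso A).hom.hom a).app Y = 𝟙 _ := by
    rw [singleFunctorsPostcompQIso_hom_hom]
    rfl
  have h₂ : (((singleFunctorsPostcompQIso A).hom.hom a').app Y)⟦n⟧' = 𝟙 _ := by
    rw [singleFunctorsPostcompQIso_hom_hom]
    exact CategoryTheory.Functor.map_id _ _
  have e' : ((singleFunctors A).shiftIso n a a' h).hom.app Y =
      (((CochainComplex.singleFunctors A).postcomp Q).shiftIso n a a' h).hom.app Y :=
    (comp_id _).symm.trans ((whisker_eq _ h₁.symm).trans (e.trans ((h₂ =≫ _).trans (id_comp _))))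
  rw [e', SingleFunctors.postcomp_shiftIso_hom_app]
  exact (Q.commShiftIso n).hom_inv_id_app_assoc _ _

lemma comparison_of_shift_squares {C : Type*} [Category* C]
    {X₀ X₁ X₂ X₃ X₄ X₅ Y₁ Y₂ Y₃ Z₁ Z₂ : C} {m : X₀ ⟶ X₁} {s : X₁ ⟶ X₂} {f : X₂ ⟶ X₃}
    {g : X₃ ⟶ X₄} {c : X₁ ⟶ Y₁} {f' : Y₁ ⟶ Y₂} {g' : Y₂ ⟶ Y₃} {s' : Y₃ ⟶ X₄} {qs : X₀ ⟶ X₂}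
    {f₀ : X₀ ⟶ X₅} {ks : X₅ ⟶ X₃} {ck : X₅ ⟶ Z₁} {g₀ : Z₁ ⟶ Z₂} {qs' : Z₂ ⟶ X₄}
    {cq : Z₁ ⟶ Y₂} {cq' : Z₂ ⟶ Y₃} [Epi m] (h₁ : m ≫ s = qs) (h₂ : qs ≫ f = f₀ ≫ ks)
    (h₃ : ks ≫ g = ck ≫ g₀ ≫ qs') (h₄ : (m ≫ c) ≫ f' = f₀ ≫ ck ≫ cq)
    (h₅ : cq ≫ g' = g₀ ≫ cq') (h₆ : cq' ≫ s' = qs') {t : Y₁ ⟶ Y₃} (ht : t = f' ≫ g') :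
    s ≫ f ≫ g = c ≫ t ≫ s' := by
  rw [← cancel_epi m, ht, reassoc_of% h₁, reassoc_of% h₂, h₃, ← h₆, assoc, ← reassoc_of% h₅]
  simp only [assoc] at h₄
  rw [reassoc_of% h₄]

lemma mapDerivedCategory_map_singleFunctors_shiftIso (Y : A) (n a a' : ℤ) (h : n + a = a') :
    K.mapDerivedCategory.map (((singleFunctors A).shiftIso n a a' h).hom.app Y) ≫
      (K.mapDerivedCategorySingleFunctor a).hom.app Y =
    (K.mapDerivedCategory.commShiftIso n).hom.app ((singleFunctor A a').obj Y) ≫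
      ((K.mapDerivedCategorySingleFunctor a').hom.app Y)⟦n⟧' ≫
      ((singleFunctors B).shiftIso n a a' h).hom.app (K.obj Y) := by
  have h₁ := (K.mapDerivedCategory.map_comp _ _).symm.trans
    (K.mapDerivedCategory.congr_map (Q_commShiftIso_singleFunctors_shiftIso Y n a a' h))
  have h₂ := K.mapDerivedCategoryFactors.hom.naturality
    (((CochainComplex.singleFunctors A).shiftIso n a a' h).hom.app Y)
  have h₃ := (Q.map_comp _ _).symm.trans ((Q.congr_map
    (map_cochainComplex_singleFunctors_shiftIso K Y n a a' h)).trans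
      ((Q.map_comp _ _).trans (whisker_eq _ (Q.map_comp _ _))))
  have h₄ := NatTrans.shift_app_comm K.mapDerivedCategoryFactors.hom n
    ((CochainComplex.singleFunctor A a').obj Y)
  rw [Functor.commShiftIso_comp_hom_app, Functor.commShiftIso_comp_hom_app] at h₄
  have h₅ := ((Q (C := B)).commShiftIso n).hom.naturality
    ((HomologicalComplex.singleMapHomologicalComplex K (.up ℤ) a').hom.app Y)
  have h₆ := Q_commShiftIso_singleFunctors_shiftIso (K.obj Y) n a a' h
  have h₇ : ((K.mapDerivedCategorySingleFunctor a').hom.app Y)⟦n⟧' = _ :=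
    ((shiftFunctor (DerivedCategory B) n).congr_map
    (mapDerivedCategorySingleFunctor_hom_app K Y a')).trans
      ((shiftFunctor (DerivedCategory B) n).map_comp _ _)
  rw [mapDerivedCategorySingleFunctor_hom_app]
  exact comparison_of_shift_squares h₁ h₂ h₃ h₄ h₅.symm h₆ h₇

lemma homologyFunctor_map_mapPlusSingle (Y : A) (q : ℤ) :
    (Plus.homologyFunctor B q).map ((mapPlusSingle K q).hom.app Y) ≫
      (homologySingleIso B q).hom.app (K.obj Y) =
    (mapPlusHomology K q).hom.app ((Plus.singleFunctor A q).obj Y) ≫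
      K.map ((homologySingleIso A q).hom.app Y) := by
  refine Eq.trans (Functor.congr_map _ (Plus.ι.map_preimage _) =≫ _)
    (homologyFunctor_map_mapDerivedCategorySingleFunctor K Y q)

lemma ι_map_singleFunctors_shiftIso (Y : A) (n a a' : ℤ) (h : n + a = a') :
    Plus.ι.map (((Plus.singleFunctors A).shiftIso n a a' h).hom.app Y) =
      (Plus.ι.commShiftIso n).hom.app ((Plus.singleFunctor A a').obj Y) ≫
        ((singleFunctors A).shiftIso n a a' h).hom.app Y := by
  have e := SingleFunctors.map_lift_shiftIso_hom_app (singleFunctors A) Plus.ι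
    (fun n => DerivedCategory.TStructure.t.plus.lift (singleFunctor A n) (fun _ => ⟨n, inferInstance⟩))
    (fun _ => Iso.refl _) n a a' h Y
  refine Eq.trans e (whisker_eq _ ?_)
  exact ((CategoryTheory.Functor.map_id _ _ =≫ _).trans (id_comp _)).trans (comp_id _)

lemma comparison_of_restrictions {C : Type*} [Category* C] {X₀ X₁ X₂ X₃ Y₁ Y₂ Z₁ Z₂ : C}
    {d : X₀ ⟶ X₁} {s : X₁ ⟶ X₂} {f : X₂ ⟶ X₃} {c : X₁ ⟶ Y₁} {g : Y₁ ⟶ Y₂} {s' : Y₂ ⟶ X₃}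
    {p : X₀ ⟶ Z₁} {q : Z₁ ⟶ Y₁} {t : Z₁ ⟶ Z₂} {q' : Z₂ ⟶ Y₂} {ds : X₀ ⟶ X₂} {qs : Z₂ ⟶ X₃}
    (h₁ : s ≫ f = c ≫ g ≫ s') (h₂ : p ≫ q = d ≫ c) (h₃ : t ≫ q' = q ≫ g) (h₄ : ds = d ≫ s)
    (h₅ : qs = q' ≫ s') : ds ≫ f = p ≫ t ≫ qs := by
  rw [h₄, h₅, assoc, h₁, ← reassoc_of% h₂, reassoc_of% h₃]

/-- Allows a statement about the single complex in degree `q` to be reduced to degree `0` by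
shifting. -/
lemma mapPlus_map_singleFunctors_shiftIso (Y : A) (n a a' : ℤ) (h : n + a = a') :
    (mapPlus K).map (((Plus.singleFunctors A).shiftIso n a a' h).hom.app Y) ≫
      (mapPlusSingle K a).hom.app Y =
    ((mapPlus K).commShiftIso n).hom.app ((Plus.singleFunctor A a').obj Y) ≫
      ((mapPlusSingle K a').hom.app Y)⟦n⟧' ≫
      ((Plus.singleFunctors B).shiftIso n a a' h).hom.app (K.obj Y) := by
  apply Plus.ι.map_injective
  have e (a : ℤ) : Plus.ι.map ((mapPlusSingle K a).hom.app Y) =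
    (K.mapDerivedCategorySingleFunctor a).hom.app Y := Plus.ι.map_preimage _
  have h₁ := (whisker_eq _ (e a)).trans
    ((mapDerivedCategory_map_singleFunctors_shiftIso K Y n a a' h).trans
      (whisker_eq _ ((shiftFunctor (DerivedCategory B) n).congr_map (e a').symm =≫ _)))
  have h₂ := ι_map_commShiftIso_mapPlus K ((Plus.singleFunctor A a').obj Y) n
  have h₃ := (Plus.ι.commShiftIso n).hom.naturality ((mapPlusSingle K a').hom.app Y)
  have h₄ := (K.mapDerivedCategory.congr_map (ι_map_singleFunctors_shiftIso Y n a a' h)).trans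
    (K.mapDerivedCategory.map_comp _ _)
  exact comparison_of_restrictions h₁ h₂ h₃ h₄ (ι_map_singleFunctors_shiftIso (K.obj Y) n a a' h)

end MapSingle

end GrothendieckSS

namespace GrothendieckSS

/-! ### Derived natural transformations: shifts and composition -/

section DerivedShift

open DerivedCategory Pretriangulated

/-- `L` need not be essentially surjective. Naturality along `s : X ⟶ L.obj Z` carries the known
square at `Z` to `X`, and `s` can be cancelled because `G` inverts it. In the application `s` is a
resolution by a complex of injectives. -/
lemma commShift_of_resolutions {C C' D M : Type*} [Category* C] [Category* C'] [Category* D]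
    [AddMonoid M] [HasShift C M] [HasShift C' M] [HasShift D M] {F G : C ⥤ D} [F.CommShift M]
    [G.CommShift M] (τ : F ⟶ G) (L : C' ⥤ C) [L.CommShift M]
    [NatTrans.CommShift (Functor.whiskerLeft L τ) M]
    (h : ∀ X, ∃ (Z : C') (s : X ⟶ L.obj Z), IsIso (G.map s)) : NatTrans.CommShift τ M := by
  refine ⟨fun a => ?_⟩
  ext X
  obtain ⟨Z, s, hs⟩ := h X
  have h := NatTrans.shift_app_comm (Functor.whiskerLeft L τ) a Z
  rw [Functor.commShiftIso_comp_hom_app, Functor.commShiftIso_comp_hom_app] at h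
  dsimp at h
  rw [← τ.naturality_assoc, assoc, cancel_epi] at h
  rw [← cancel_mono ((G.map s)⟦a⟧')]
  have h₁ := (F.commShiftIso a).hom.naturality s
  have h₂ := (G.commShiftIso a).hom.naturality s
  dsimp at h₁ h₂ ⊢
  rw [assoc, assoc, ← h₂, ← Functor.map_comp, ← τ.naturality, Functor.map_comp, ← reassoc_of% h₁,
    h, τ.naturality_assoc]

variable {A B : Type*} [Category* A] [Category* B] [Abelian A] [Abelian B]
  [HasDerivedCategory A] [HasDerivedCategory B] (F : A ⥤ B) [F.Additive] [EnoughInjectives A]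

/-- The shift structure on `RF` was defined by localization precisely so that this isomorphism
respects it; `injLift` is the inverse of the lifting isomorphism. -/
instance : NatTrans.CommShift (injLift F).hom ℤ := by
  let e := Localization.Lifting.iso (injQh A) (MorphismProperty.isomorphisms _)
    ((InjectiveObject.ι A).mapHomotopyCategoryPlus ⋙ F.mapHomotopyCategoryPlus ⋙ Plus.Qh)
    F.rightDerivedFunctorPlus
  have : NatTrans.CommShift e.hom ℤ := NatTrans.commShift_iso_hom_of_localization ..
  exact inferInstanceAs (NatTrans.CommShift e.inv ℤ)

instance : NatTrans.CommShift F.rightDerivedFunctorPlusUnit ℤ := by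
  have : NatTrans.CommShift (Functor.whiskerLeft (InjectiveObject.ι A).mapHomotopyCategoryPlus
      F.rightDerivedFunctorPlusUnit) ℤ := by
    let α : injQh A ⋙ F.rightDerivedFunctorPlus ⟶ (InjectiveObject.ι A).mapHomotopyCategoryPlus ⋙
      Plus.Qh ⋙ F.rightDerivedFunctorPlus := (Functor.associator _ _ _).hom
    have : NatTrans.CommShift α ℤ := NatTrans.CommShift.associator
      (F₁ := (InjectiveObject.ι A).mapHomotopyCategoryPlus) Plus.Qh F.rightDerivedFunctorPlus ℤ
    have e : Functor.whiskerLeft (InjectiveObject.ι A).mapHomotopyCategoryPlus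
      F.rightDerivedFunctorPlusUnit = (injLift F).hom ≫ α := by
      ext X
      exact (comp_id _).symm
    rw [e]
    infer_instance
  refine commShift_of_resolutions _ (InjectiveObject.ι A).mapHomotopyCategoryPlus (fun X => ?_)
  -- `RF` after `Qh` inverts quasi-isomorphisms, in particular the resolution `r.w` by injectives;
  -- over injectives the unit is `injLift`.
  let r : (HomotopyCategory.Plus.localizerMorphism A).RightResolution X := Classical.arbitrary _
  have := Localization.inverts Plus.Qh _ _ r.hw
  exact ⟨r.X₁, r.w, inferInstanceAs (IsIso (F.rightDerivedFunctorPlus.map (Plus.Qh.map r.w)))⟩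

section

variable {A B A' B' : Type*} [Category* A] [Category* B] [Category* A'] [Category* B']
  [Abelian A] [Abelian B] [Abelian A'] [Abelian B']
  [HasDerivedCategory A] [HasDerivedCategory B] [HasDerivedCategory A'] [HasDerivedCategory B']
  [EnoughInjectives A] [EnoughInjectives A']
  {F : A ⥤ B} {F' : A' ⥤ B'} {KA : A ⥤ A'} {KB : B ⥤ B'}
  [F.Additive] [F'.Additive] [KA.Additive] [KB.Additive]
  [PreservesFiniteLimits KA] [PreservesFiniteColimits KA]
  [PreservesFiniteLimits KB] [PreservesFiniteColimits KB]
  (N : F ⋙ KB ⟶ KA ⋙ F')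

instance : NatTrans.CommShift (derivedNatTransAux N) ℤ := by
  have e : derivedNatTransAux N = Functor.whiskerLeft _ (mapPlusFactors KB).hom ≫
      (Functor.associator _ _ _).inv ≫
      Functor.whiskerRight ((Functor.mapHomotopyCategoryPlusCompIso (Iso.refl (F ⋙ KB))).hom ≫
        mapHPlus N ≫ (Functor.mapHomotopyCategoryPlusCompIso (Iso.refl (KA ⋙ F'))).inv) Plus.Qh ≫
      (Functor.associator _ _ _).hom ≫
      Functor.whiskerLeft KA.mapHomotopyCategoryPlus F'.rightDerivedFunctorPlusUnit ≫
      (Functor.associator _ _ _).inv ≫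
      Functor.whiskerRight (mapPlusFactors KA).inv F'.rightDerivedFunctorPlus ≫
      (Functor.associator _ _ _).hom := by
    ext X
    refine whisker_eq _ (Eq.trans ?_ (id_comp _).symm)
    refine whisker_eq _ (Eq.trans ?_ (id_comp _).symm)
    refine whisker_eq _ (Eq.trans ?_ (id_comp _).symm)
    exact (comp_id _).symm
  rw [e]
  infer_instance

/-- The property that characterises `derivedNatTrans`; beyond naturality and shifts, nothing else
about it is needed. -/
lemma unitComp_derivedNatTrans_app (L : HomotopyCategory.Plus A) :
    (mapPlus KB).map (F.rightDerivedFunctorPlusUnit.app L) ≫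
      (derivedNatTrans N).app (Plus.Qh.obj L) = (derivedNatTransAux N).app L :=
  Functor.rightDerived_fac_app _ (unitComp F (mapPlus KB)) _ _ _ L

instance : NatTrans.CommShift (derivedNatTrans N) ℤ := by
  have : NatTrans.CommShift (Functor.whiskerLeft (injQh A) (derivedNatTrans N)) ℤ := by
    let L := (InjectiveObject.ι A).mapHomotopyCategoryPlus
    let β : L ⋙ Plus.Qh ⋙ mapPlus KA ⋙ F'.rightDerivedFunctorPlus ⟶
      injQh A ⋙ mapPlus KA ⋙ F'.rightDerivedFunctorPlus := (Functor.associator _ _ _).inv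
    have : NatTrans.CommShift β ℤ := inferInstanceAs (NatTrans.CommShift
      (Functor.associator (InjectiveObject.ι A).mapHomotopyCategoryPlus Plus.Qh
        (mapPlus KA ⋙ F'.rightDerivedFunctorPlus)).inv ℤ)
    -- Over complexes of injectives the unit of `RF` is invertible, so there the derived
    -- transformation is the inverse of the unit followed by `derivedNatTransAux`, whose factors
    -- respect shifts.
    have e : Functor.whiskerLeft (injQh A) (derivedNatTrans N) =
      (Functor.associator _ _ _).inv ≫
      Functor.whiskerRight (injLift F).inv (mapPlus KB) ≫
      (Functor.associator _ _ _).hom ≫ Functor.whiskerLeft L (Functor.associator _ _ _).hom ≫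
      Functor.whiskerLeft L (derivedNatTransAux N) ≫ β := by
      apply NatTrans.ext
      funext X
      have h := unitComp_derivedNatTrans_app N (L.obj X)
      have h' : (mapPlus KB).map ((injLift F).inv.app X) ≫
        (mapPlus KB).map (F.rightDerivedFunctorPlusUnit.app (L.obj X)) = 𝟙 _ :=
          ((mapPlus KB).mapIso ((injLift F).app X)).inv_hom_id
      refine Eq.trans ?_ (id_comp _).symm
      refine Eq.trans ?_ (whisker_eq _ ((id_comp _).trans ((id_comp _).trans
        ((comp_id _).trans h.symm)))).symm
      exact ((assoc _ _ _).symm.trans ((h' =≫ _).trans (id_comp _))).symm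
    rw [e]
    infer_instance
  exact commShift_of_whiskerLeft _ (injQh A)

end

lemma unit_rightDerivedComp_app {A B C : Type*} [Category* A] [Category* B] [Category* C]
    [Abelian A] [Abelian B] [Abelian C]
    [HasDerivedCategory A] [HasDerivedCategory B] [HasDerivedCategory C]
    [EnoughInjectives A] [EnoughInjectives B] (F : A ⥤ B) (G : B ⥤ C) [F.Additive] [G.Additive]
    (L : HomotopyCategory.Plus A) :
    (F ⋙ G).rightDerivedFunctorPlusUnit.app L ≫ (rightDerivedComp F G).app (Plus.Qh.obj L) =
      (rightDerivedCompAux F G).app L :=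
  Functor.rightDerived_fac_app _ (F ⋙ G).rightDerivedFunctorPlusUnit _ _ _ L

/-- The chase for `rightDerivedComp_derivedNatTrans`: unit formulas and naturality squares reduce
the identity to the one square `h₇` that comes from complexes. -/
lemma comp_derived_chase {D : Type*} [Category* D]
    {X₀ X₁ X₂ X₃ X₄ X₅ X₆ X₇ X₈ X₉ Y₀ Y₁ Y₂ Y₃ Y₄ Y₅ Y₆ Y₇ : D}
    {u : X₀ ⟶ X₁} {r : X₁ ⟶ X₂} {c : X₀ ⟶ X₃} {ug : X₃ ⟶ X₄} {guf : X₄ ⟶ X₂}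
    (h₁ : u ≫ r = c ≫ ug ≫ guf)
    {d₁ : X₂ ⟶ X₅} {d₂ : X₄ ⟶ X₆} {gkuf : X₆ ⟶ X₅} (h₂ : guf ≫ d₁ = d₂ ≫ gkuf)
    {m : X₃ ⟶ X₇} {s : X₇ ⟶ X₈} {ug' : X₈ ⟶ X₉} {b' : X₉ ⟶ X₆} (h₃ : ug ≫ d₂ = m ≫ s ≫ ug' ≫ b')
    {d₃ : X₅ ⟶ Y₀} {b : X₆ ⟶ X₉} {gs : X₉ ⟶ Y₁} {guf' : Y₁ ⟶ Y₂} {a : Y₂ ⟶ Y₀}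
    (h₄ : gkuf ≫ d₃ = b ≫ gs ≫ guf' ≫ a) (hm : b' ≫ b = 𝟙 _)
    {tgs : X₈ ⟶ Y₃} {ug'' : Y₃ ⟶ Y₁} (h₅ : tgs ≫ ug'' = ug' ≫ gs)
    {m' : X₀ ⟶ Y₄} {kc : Y₄ ⟶ X₇} (h₆ : c ≫ m = m' ≫ kc)
    {t : Y₄ ⟶ Y₅} {c' : Y₅ ⟶ Y₃} (h₇ : kc ≫ s ≫ tgs = t ≫ c')
    {dc : X₁ ⟶ Y₆} {u' : Y₅ ⟶ Y₇} {a' : Y₇ ⟶ Y₆} (h₈ : u ≫ dc = m' ≫ t ≫ u' ≫ a')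
    {r' : Y₆ ⟶ Y₀} {r'' : Y₇ ⟶ Y₂} (h₉ : a' ≫ r' = r'' ≫ a) (h₁₀ : u' ≫ r'' = c' ≫ ug'' ≫ guf') :
    u ≫ r ≫ d₁ ≫ d₃ = u ≫ dc ≫ r' := by
  rw [reassoc_of% h₁, reassoc_of% h₂, reassoc_of% h₃, h₄, reassoc_of% hm, ← reassoc_of% h₅,
    reassoc_of% h₆, reassoc_of% h₇, reassoc_of% h₈, h₉, reassoc_of% h₁₀]

section

variable {A B C A' B' C' : Type*}
    [Category* A] [Category* B] [Category* C] [Category* A'] [Category* B'] [Category* C']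
    [Abelian A] [Abelian B] [Abelian C] [Abelian A'] [Abelian B'] [Abelian C']
    {F : A ⥤ B} {G : B ⥤ C} {F' : A' ⥤ B'} {G' : B' ⥤ C'}
    {KA : A ⥤ A'} {KB : B ⥤ B'} {KC : C ⥤ C'}
    [F.Additive] [G.Additive] [F'.Additive] [G'.Additive]
    [KA.Additive] [KB.Additive] [KC.Additive]
    (NF : F ⋙ KB ⟶ KA ⋙ F') (NG : G ⋙ KC ⟶ KB ⋙ G')

/-- The natural transformation on bounded below homotopy categories that is induced by
`N : F ⋙ KB ⟶ KA ⋙ F'`. -/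
noncomputable abbrev mapHPlusSquare :
    F.mapHomotopyCategoryPlus ⋙ KB.mapHomotopyCategoryPlus ⟶
      KA.mapHomotopyCategoryPlus ⋙ F'.mapHomotopyCategoryPlus :=
  (Functor.mapHomotopyCategoryPlusCompIso (Iso.refl (F ⋙ KB))).hom ≫
    mapHPlus NF ≫ (Functor.mapHomotopyCategoryPlusCompIso (Iso.refl (KA ⋙ F'))).inv

/-- The morphism of complexes that is given by `N` in each degree. -/
noncomputable abbrev mapComplexSquare (L : CochainComplex A ℤ) :
    (KB.mapHomologicalComplex (.up ℤ)).obj ((F.mapHomologicalComplex (.up ℤ)).obj L) ⟶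
      (F'.mapHomologicalComplex (.up ℤ)).obj ((KA.mapHomologicalComplex (.up ℤ)).obj L) :=
  (Functor.mapHomologicalComplexCompIso (Iso.refl (F ⋙ KB)) (.up ℤ)).hom.app L ≫
    (NatTrans.mapHomologicalComplex NF (.up ℤ)).app L ≫
    (Functor.mapHomologicalComplexCompIso (Iso.refl (KA ⋙ F')) (.up ℤ)).inv.app L

lemma mapComplexSquare_f (L : CochainComplex A ℤ) (n : ℤ) :
    (mapComplexSquare NF L).f n = NF.app (L.X n) :=
  (id_comp _).trans (comp_id _)

/-- In each degree this is the definition of `compNatTrans`. It is the only place in the comparison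
on the abutment where the form of N_{GF} enters. -/
lemma mapComplexSquare_comp (L : CochainComplex A ℤ) :
    (KC.mapHomologicalComplex (.up ℤ)).map
      ((Functor.mapHomologicalComplexCompIso (Iso.refl (F ⋙ G)) (.up ℤ)).inv.app L) ≫
      mapComplexSquare NG ((F.mapHomologicalComplex (.up ℤ)).obj L) ≫
      (G'.mapHomologicalComplex (.up ℤ)).map (mapComplexSquare NF L) =
    mapComplexSquare (compNatTrans NF NG) L ≫
      (Functor.mapHomologicalComplexCompIso (Iso.refl (F' ⋙ G')) (.up ℤ)).inv.app
        ((KA.mapHomologicalComplex (.up ℤ)).obj L) := by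
  ext n
  refine Eq.trans (?_ : _ = 𝟙 _ ≫ (compNatTrans NF NG).app (L.X n)) ?_
  · refine (congrArg₂ (· ≫ ·) (KC.map_id _) (congrArg₂ (· ≫ ·) (mapComplexSquare_f NG _ n)
      (congrArg G'.map (mapComplexSquare_f NF L n))) : )
  · exact (id_comp _).trans ((mapComplexSquare_f (compNatTrans NF NG) L n).symm.trans
      (comp_id _).symm)

lemma mapHPlusSquare_comp (L : HomotopyCategory.Plus A) :
    KC.mapHomotopyCategoryPlus.map
      ((Functor.mapHomotopyCategoryPlusCompIso (Iso.refl (F ⋙ G))).inv.app L) ≫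
      (mapHPlusSquare NG).app (F.mapHomotopyCategoryPlus.obj L) ≫
      G'.mapHomotopyCategoryPlus.map ((mapHPlusSquare NF).app L) =
    (mapHPlusSquare (compNatTrans NF NG)).app L ≫
      (Functor.mapHomotopyCategoryPlusCompIso (Iso.refl (F' ⋙ G'))).inv.app
        (KA.mapHomotopyCategoryPlus.obj L) := by
  obtain ⟨L, rfl⟩ := HomotopyCategory.Plus.quotient_obj_surjective L
  apply (HomotopyCategory.Plus.ι C').map_injective
  exact (HomotopyCategory.quotient C' (.up ℤ)).congr_map (mapComplexSquare_comp NF NG L.obj)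

end

section

variable {A B C A' B' C' : Type*}
    [Category* A] [Category* B] [Category* C] [Category* A'] [Category* B'] [Category* C']
    [Abelian A] [Abelian B] [Abelian C] [Abelian A'] [Abelian B'] [Abelian C']
    [HasDerivedCategory A] [HasDerivedCategory B] [HasDerivedCategory C]
    [HasDerivedCategory A'] [HasDerivedCategory B'] [HasDerivedCategory C']
    [EnoughInjectives A] [EnoughInjectives B] [EnoughInjectives A'] [EnoughInjectives B']
    {F : A ⥤ B} {G : B ⥤ C} {F' : A' ⥤ B'} {G' : B' ⥤ C'}
    {KA : A ⥤ A'} {KB : B ⥤ B'} {KC : C ⥤ C'}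
    [F.Additive] [G.Additive] [F'.Additive] [G'.Additive]
    [KA.Additive] [KB.Additive] [KC.Additive]
    [PreservesFiniteLimits KA] [PreservesFiniteColimits KA]
    [PreservesFiniteLimits KB] [PreservesFiniteColimits KB]
    [PreservesFiniteLimits KC] [PreservesFiniteColimits KC]
    (NF : F ⋙ KB ⟶ KA ⋙ F') (NG : G ⋙ KC ⟶ KB ⋙ G')

/-- Both sides start from R(GF) followed by `mapPlus KC`, which is a right derived functor, so they
agree once they agree after its unit. There each derived transformation is replaced by its defining
formula, and `mapHPlusSquare_comp` closes the diagram. -/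
lemma rightDerivedComp_derivedNatTrans :
    Functor.whiskerRight (rightDerivedComp F G) (mapPlus KC) ≫
      (Functor.associator _ _ _).hom ≫
      Functor.whiskerLeft F.rightDerivedFunctorPlus (derivedNatTrans NG) ≫
      (Functor.associator _ _ _).inv ≫
      Functor.whiskerRight (derivedNatTrans NF) G'.rightDerivedFunctorPlus ≫
      (Functor.associator _ _ _).hom =
    derivedNatTrans (compNatTrans NF NG) ≫
      Functor.whiskerLeft (mapPlus KA) (rightDerivedComp F' G') := by
  refine Functor.rightDerived_ext _ (unitComp (F ⋙ G) (mapPlus KC))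
    (HomotopyCategory.Plus.quasiIso A) _ _ _ ?_
  apply NatTrans.ext
  funext L
  have hm : G'.rightDerivedFunctorPlus.map
        ((mapPlusFactors KB).inv.app (F.mapHomotopyCategoryPlus.obj L)) ≫
      G'.rightDerivedFunctorPlus.map
        ((mapPlusFactors KB).hom.app (F.mapHomotopyCategoryPlus.obj L)) = 𝟙 _ :=
    (G'.rightDerivedFunctorPlus.mapIso ((mapPlusFactors KB).app
      (F.mapHomotopyCategoryPlus.obj L))).inv_hom_id
  have h₁ := ((mapPlus KC).map_comp _ _).symm.trans
    (((mapPlus KC).congr_map (unit_rightDerivedComp_app F G L)).trans (((mapPlus KC).map_comp _ _).trans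
      (whisker_eq _ ((mapPlus KC).map_comp _ _))))
  have h₄ := (G'.rightDerivedFunctorPlus.map_comp _ _).symm.trans
    ((G'.rightDerivedFunctorPlus.congr_map (unitComp_derivedNatTrans_app NF L)).trans
    ((G'.rightDerivedFunctorPlus.map_comp _ _).trans
    (whisker_eq _ ((G'.rightDerivedFunctorPlus.map_comp _ _).trans
    (whisker_eq _ (G'.rightDerivedFunctorPlus.map_comp _ _))))))
  have h₇ := (whisker_eq _ (Plus.Qh.map_comp _ _).symm).trans ((Plus.Qh.map_comp _ _).symm.trans
    ((Plus.Qh.congr_map (mapHPlusSquare_comp NF NG L)).trans (Plus.Qh.map_comp _ _)))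
  refine Eq.trans (whisker_eq _ (whisker_eq _ ((id_comp _).trans (whisker_eq _
    ((id_comp _).trans (comp_id _)))))) ?_
  exact comp_derived_chase h₁ ((derivedNatTrans NG).naturality (F.rightDerivedFunctorPlusUnit.app L))
    (unitComp_derivedNatTrans_app NG (F.mapHomotopyCategoryPlus.obj L)) h₄ hm
    (G'.rightDerivedFunctorPlusUnit.naturality ((mapHPlusSquare NF).app L))
    ((mapPlusFactors KC).hom.naturality _) h₇
    (unitComp_derivedNatTrans_app (compNatTrans NF NG) L)
    ((rightDerivedComp F' G').naturality ((mapPlusFactors KA).inv.app L))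
    (unit_rightDerivedComp_app F' G' _)

end

end DerivedShift

end GrothendieckSS

namespace GrothendieckSS

/-! ### The morphism between Grothendieck spectral sequences -/

section GrothendieckComparison

open DerivedCategory Pretriangulated ComposableArrows

/-- The chase for `HomAlong.ofTriangulated`. The composite `kd ≫ ks` is a connecting map in
cohomology: the image of a map into a shift, followed by a shift isomorphism; these are moved past
`K` by `h₂` and `h₁`. -/
lemma homology_comm_chase {C : Type*} [Category* C] {X₀ X₁ X₂ X₃ Y₀ Y₁ Y₂ Y₃ Z₀ Z₁ : C}
    {kd : X₀ ⟶ X₁} {ks : X₁ ⟶ X₂} {n : X₂ ⟶ X₃} {n' : X₃ ⟶ X₂} {f₁ : X₃ ⟶ Y₀}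
    {m : X₀ ⟶ Z₀} {m' : Z₀ ⟶ X₀} {hd : Z₀ ⟶ Z₁} {c : Z₁ ⟶ Y₁} {s : Y₁ ⟶ X₃} {m₁ : Z₁ ⟶ X₁}
    {fg : Y₁ ⟶ Y₂} {s' : Y₂ ⟶ Y₀} {f₂ : Z₀ ⟶ Y₃} {d' : Y₃ ⟶ Y₂}
    (hm : m ≫ m' = 𝟙 _) (hn : n' ≫ n = 𝟙 _) (h₁ : c ≫ s ≫ n' = m₁ ≫ ks)
    (h₂ : hd ≫ m₁ = m' ≫ kd) (h₃ : fg ≫ s' = s ≫ f₁) (h₄ : (hd ≫ c) ≫ fg = f₂ ≫ d') :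
    (kd ≫ ks) ≫ n ≫ f₁ = (m ≫ f₂) ≫ d' ≫ s' := by
  have h₅ : kd = m ≫ hd ≫ m₁ := by rw [h₂, reassoc_of% hm]
  have h₆ : m₁ ≫ ks ≫ n = c ≫ s := by rw [← reassoc_of% h₁, hn, comp_id]
  rw [h₅]
  simp only [assoc] at h₄ ⊢
  rw [reassoc_of% h₆, ← h₃, reassoc_of% h₄]

section

variable {C C' ι : Type*} [Category* C] [Category* C'] [Abelian C] [Abelian C'] [Category* ι]
  [HasDerivedCategory C] [HasDerivedCategory C']
  {K : C ⥤ C'} [K.Additive] [PreservesFiniteLimits K] [PreservesFiniteColimits K]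
  {S : Triangulated.SpectralObject (Plus C) ι} {S' : Triangulated.SpectralObject (Plus C') ι}

/-- The morphism between the spectral objects of cohomology objects that is induced by
a morphism `K(S) ⟶ S'` of spectral objects in the derived category. -/
noncomputable def HomAlong.ofTriangulated (f : S.mapTriangulatedFunctor (mapPlus K) ⟶ S') :
    HomAlong K (homologySpectralObjectObj (Plus.homologyFunctor C 0) S)
      (homologySpectralObjectObj (Plus.homologyFunctor C' 0) S') where
  hom n :=
    { app x := (mapPlusHomology K n).inv.app (S.ω₁.obj x) ≫
        (Plus.homologyFunctor C' n).map ((SpectralObject.Hom.hom f).app x)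
      naturality x y g := by
        refine Eq.trans ?_ (assoc _ _ _).symm
        have h₁ := (mapPlusHomology K n).inv.naturality (S.ω₁.map g)
        have h₂ := (Plus.homologyFunctor C' n).congr_map ((SpectralObject.Hom.hom f).naturality g)
        refine (assoc _ _ _).symm.trans ((h₁ =≫ _).trans ((assoc _ _ _).trans (whisker_eq _ ?_)))
        exact ((Plus.homologyFunctor C' n).map_comp _ _).symm.trans
          (h₂.trans ((Plus.homologyFunctor C' n).map_comp _ _)) }
  comm n₀ n₁ hn₁ i j k g h := by
    have hm := (mapPlusHomology K n₀).inv_hom_id_app (S.ω₁.obj (mk₁ h))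
    have hn := (mapPlusHomology K n₁).hom_inv_id_app (S.ω₁.obj (mk₁ g))
    have h₂ := (mapPlusHomology K n₀).hom.naturality (S.δ g h)
    have h₃ := ((Plus.homologyFunctor C' 0).shiftIso 1 n₀ n₁ (by lia)).hom.naturality
      ((SpectralObject.Hom.hom f).app (mk₁ g))
    have h₄ := ((Plus.homologyFunctor C' n₀).map_comp _ _ =≫ _).symm.trans
      (((Plus.homologyFunctor C' n₀).map_comp _ _).symm.trans
        (((Plus.homologyFunctor C' n₀).congr_map (SpectralObject.Hom.comm f g h)).trans
          ((Plus.homologyFunctor C' n₀).map_comp _ _)))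
    exact (K.map_comp _ _ =≫ _).trans (homology_comm_chase hm hn
      (commShiftIso_shiftIso_mapPlusHomology K (S.ω₁.obj (mk₁ g)) 1 n₀ n₁ (by lia)) h₂ h₃ h₄)

end

section

variable {B C B' C' : Type*}
    [Category* B] [Category* C] [Category* B'] [Category* C']
    [Abelian B] [Abelian C] [Abelian B'] [Abelian C']
    [HasDerivedCategory B] [HasDerivedCategory C] [HasDerivedCategory B'] [HasDerivedCategory C']
    [EnoughInjectives B] [EnoughInjectives B']
    {G : B ⥤ C} {G' : B' ⥤ C'} {KB : B ⥤ B'} {KC : C ⥤ C'}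
    [G.Additive] [G'.Additive] [KB.Additive] [KC.Additive]
    [PreservesFiniteLimits KB] [PreservesFiniteColimits KB]
    [PreservesFiniteLimits KC] [PreservesFiniteColimits KC]
    (NG : G ⋙ KC ⟶ KB ⋙ G')

lemma shift_comm_chase {D : Type*} [Category* D] {X₀ X₁ X₂ X₃ Y₀ Y₁ Y₂ Y₃ : D}
    {d : X₀ ⟶ X₁} {c₁ : X₁ ⟶ X₂} {c₂ : X₂ ⟶ X₃} {s₃ : X₃ ⟶ Y₃} {s₀ : X₀ ⟶ Y₀} {d' : Y₀ ⟶ Y₁}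
    {s₁ : X₁ ⟶ Y₁} {c₁' : Y₁ ⟶ Y₂} {c₂' : Y₂ ⟶ Y₃} (h₀ : d ≫ s₁ = s₀ ≫ d')
    (h : (c₁ ≫ c₂) ≫ s₃ = s₁ ≫ c₁' ≫ c₂') : ((d ≫ c₁) ≫ c₂) ≫ s₃ = s₀ ≫ (d' ≫ c₁') ≫ c₂' := by
  simp only [assoc] at h ⊢
  rw [h, reassoc_of% h₀]

/-- The morphism of spectral objects `KC(RG(S)) ⟶ RG'(KB(S))` induced by `NG`. -/
noncomputable def derivedSpectralObjectMap {ι : Type*} [Category* ι]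
    (S : Triangulated.SpectralObject (Plus B) ι) :
    (S.mapTriangulatedFunctor G.rightDerivedFunctorPlus).mapTriangulatedFunctor (mapPlus KC) ⟶
      (S.mapTriangulatedFunctor (mapPlus KB)).mapTriangulatedFunctor G'.rightDerivedFunctorPlus where
  hom := Functor.whiskerLeft S.ω₁ (derivedNatTrans NG)
  comm f g := by
    -- The connecting morphism lands in a shift by `1`; besides naturality, this is where the shift
    -- compatibility of `derivedNatTrans` is used.
    have h := NatTrans.shift_app_comm (derivedNatTrans NG) (1 : ℤ) (S.ω₁.obj (mk₁ f))
    rw [Functor.commShiftIso_comp_hom_app, Functor.commShiftIso_comp_hom_app] at h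
    have h' := (derivedNatTrans NG).naturality (S.δ f g)
    exact (((mapPlus KC).map_comp _ _ =≫ _) =≫ _).trans ((shift_comm_chase h' h).trans
      (whisker_eq _ ((G'.rightDerivedFunctorPlus.map_comp _ _).symm =≫ _)))

/-- The morphism of spectral objects in `D⁺(C')` that is given by the comparison of the truncations
of `Z` and `Z'` for a morphism `φ : KB(Z) ⟶ Z'`. -/
noncomputable def truncationSpectralObjectMap {Z : Plus B} {Z' : Plus B'}
    (φ : (mapPlus KB).obj Z ⟶ Z') :
    ((Plus.TStructure.t.spectralObject Z).mapTriangulatedFunctor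
      G.rightDerivedFunctorPlus).mapTriangulatedFunctor (mapPlus KC) ⟶
    (Plus.TStructure.t.spectralObject Z').mapTriangulatedFunctor G'.rightDerivedFunctorPlus :=
  derivedSpectralObjectMap NG _ ≫
    (G'.rightDerivedFunctorPlus.mapTriangulatedSpectralObject EInt).map
      (spectralObjectComparison (mapPlus KB) Plus.TStructure.t Plus.TStructure.t Z ≫
        Plus.TStructure.t.spectralObjectFunctor.map φ)

lemma truncation_naturality_chase {D : Type*} [Category* D] {X₀ X₁ X₂ X₃ Y₀ Y₁ Y₂ Y₃ : D}
    {a₀ : X₀ ⟶ Y₀} {s : X₀ ⟶ X₁} {s' : Y₀ ⟶ Y₁} {a₁ : X₁ ⟶ Y₁} {c : X₁ ⟶ X₂} {c' : Y₁ ⟶ Y₂}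
    {a₂ : X₂ ⟶ Y₂} {p : X₂ ⟶ X₃} {p' : Y₂ ⟶ Y₃} {a₃ : X₃ ⟶ Y₃}
    (h₀ : a₀ ≫ s' = s ≫ a₁) (h₁ : a₁ ≫ c' = c ≫ a₂) (h₂ : a₂ ≫ p' = p ≫ a₃)
    {r : X₁ ⟶ X₃} (hr : r = c ≫ p) {r' : Y₁ ⟶ Y₃} (hr' : r' = c' ≫ p') :
    a₀ ≫ s' ≫ r' = (s ≫ r) ≫ a₃ := by
  rw [hr, hr', reassoc_of% h₀, reassoc_of% h₁, h₂, assoc, assoc]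

/-- Three squares pasted side by side: naturality of the derived transformation of `NG`, naturality
of the truncation comparison, and the truncation of the given square `h`. -/
lemma truncationSpectralObjectMap_naturality {Z Z₁ : Plus B} {Z' Z₁' : Plus B'}
    (φ : (mapPlus KB).obj Z ⟶ Z') (φ₁ : (mapPlus KB).obj Z₁ ⟶ Z₁') (u : Z ⟶ Z₁) (u' : Z' ⟶ Z₁')
    (h : (mapPlus KB).map u ≫ φ₁ = φ ≫ u') (x : ComposableArrows EInt 1) :
    (mapPlus KC).map (G.rightDerivedFunctorPlus.map
      ((SpectralObject.Hom.hom (Plus.TStructure.t.spectralObjectFunctor.map u)).app x)) ≫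
      (SpectralObject.Hom.hom (truncationSpectralObjectMap NG φ₁)).app x =
    (SpectralObject.Hom.hom (truncationSpectralObjectMap NG φ)).app x ≫
      G'.rightDerivedFunctorPlus.map
        ((SpectralObject.Hom.hom (Plus.TStructure.t.spectralObjectFunctor.map u')).app x) := by
  have h₀ := (derivedNatTrans NG).naturality
    ((SpectralObject.Hom.hom (Plus.TStructure.t.spectralObjectFunctor.map u)).app x)
  have h₁ := G'.rightDerivedFunctorPlus.congr_map (eTruncComparison_naturality (mapPlus KB)
    Plus.TStructure.t Plus.TStructure.t (x.obj 0) (x.obj 1) u)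
  have h₂ := G'.rightDerivedFunctorPlus.congr_map
    (((Plus.TStructure.t.ω₁.obj x).map_comp _ _).symm.trans
    (((Plus.TStructure.t.ω₁.obj x).congr_map h).trans ((Plus.TStructure.t.ω₁.obj x).map_comp _ _)))
  have m {X Y Z : Plus B'} (f : X ⟶ Y) (g : Y ⟶ Z) := G'.rightDerivedFunctorPlus.map_comp f g
  exact truncation_naturality_chase h₀ ((m _ _).symm.trans (h₁.trans (m _ _)))
    ((m _ _).symm.trans (h₂.trans (m _ _))) (m _ _) (m _ _)

end

section

variable {A B C A' B' C' : Type*}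
    [Category* A] [Category* B] [Category* C] [Category* A'] [Category* B'] [Category* C']
    [Abelian A] [Abelian B] [Abelian C] [Abelian A'] [Abelian B'] [Abelian C']
    [HasDerivedCategory A] [HasDerivedCategory B] [HasDerivedCategory C]
    [HasDerivedCategory A'] [HasDerivedCategory B'] [HasDerivedCategory C']
    [EnoughInjectives A] [EnoughInjectives B] [EnoughInjectives A'] [EnoughInjectives B']
    {F : A ⥤ B} {G : B ⥤ C} {F' : A' ⥤ B'} {G' : B' ⥤ C'}
    {KA : A ⥤ A'} {KB : B ⥤ B'} {KC : C ⥤ C'}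
    [F.Additive] [G.Additive] [F'.Additive] [G'.Additive]
    [KA.Additive] [KB.Additive] [KC.Additive]
    [PreservesFiniteLimits KA] [PreservesFiniteColimits KA]
    [PreservesFiniteLimits KB] [PreservesFiniteColimits KB]
    [PreservesFiniteLimits KC] [PreservesFiniteColimits KC]
    (NF : F ⋙ KB ⟶ KA ⋙ F') (NG : G ⋙ KC ⟶ KB ⋙ G')

/-- The morphism `KB(RF(X)) ⟶ RF'(KA(X))` for `X : A`. -/
noncomputable def derivedSingle :
    Plus.singleFunctor A 0 ⋙ F.rightDerivedFunctorPlus ⋙ mapPlus KB ⟶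
      KA ⋙ Plus.singleFunctor A' 0 ⋙ F'.rightDerivedFunctorPlus :=
  Functor.whiskerLeft (Plus.singleFunctor A 0) (derivedNatTrans NF) ≫
    Functor.whiskerRight (mapPlusSingle KA 0).hom F'.rightDerivedFunctorPlus

/-- The morphism between the Grothendieck spectral objects. -/
noncomputable def grothendieckHomAlong (X : A) :
    HomAlong KC ((grothendieckSpectralObject F G).obj X)
      ((grothendieckSpectralObject F' G').obj (KA.obj X)) :=
  HomAlong.ofTriangulated (truncationSpectralObjectMap NG ((derivedSingle NF).app X))

/-- The morphism between the Grothendieck spectral sequences. -/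
noncomputable def grothendieckSSMap :
    grothendieckSS F G ⋙ mapSpectralSequence KC ⟶ KA ⋙ grothendieckSS F' G' where
  app X := (grothendieckHomAlong NF NG X).spectralSequenceMap Abelian.SpectralObject.coreE₂Cohomological
  naturality X Y f := by
    -- Naturality is reduced to the objects of the spectral objects, where it follows from the
    -- naturality of KB(RF(X)) ⟶ RF'(KA(X)) in `X`.
    refine HomAlong.spectralSequenceMap_naturality _ _ _ _ _ (fun n => ?_)
    apply NatTrans.ext
    funext x
    let RF := Plus.singleFunctor A 0 ⋙ F.rightDerivedFunctorPlus
    let RF' := Plus.singleFunctor A' 0 ⋙ F'.rightDerivedFunctorPlus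
    have h := truncationSpectralObjectMap_naturality NG ((derivedSingle NF).app X)
      ((derivedSingle NF).app Y) (RF.map f) (RF'.map (KA.map f))
      ((derivedSingle NF).naturality f) x
    have h₀ := (mapPlusHomology KC n).inv.naturality (G.rightDerivedFunctorPlus.map
      ((SpectralObject.Hom.hom (Plus.TStructure.t.spectralObjectFunctor.map (RF.map f))).app x))
    refine (assoc _ _ _).symm.trans ((h₀ =≫ _).trans ((assoc _ _ _).trans
      (Eq.trans (whisker_eq _ ?_) (assoc _ _ _).symm)))
    exact ((Plus.homologyFunctor C' n).map_comp _ _).symm.trans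
      (((Plus.homologyFunctor C' n).congr_map h).trans ((Plus.homologyFunctor C' n).map_comp _ _))

end

end GrothendieckComparison

end GrothendieckSS

namespace GrothendieckSS

/-! ### Identification on the abutments -/

section AbutmentComparison

open DerivedCategory Pretriangulated ComposableArrows

section

variable {C D : Type*} [Category* C] [Preadditive C] [HasZeroObject C] [HasShift C ℤ]
  [∀ (n : ℤ), (shiftFunctor C n).Additive] [Pretriangulated C]
  [Category* D] [Preadditive D] [HasZeroObject D] [HasShift D ℤ]
  [∀ (n : ℤ), (shiftFunctor D n).Additive] [Pretriangulated D]
  (k : C ⥤ D) [k.CommShift ℤ] [k.IsTriangulated] (t : TStructure C) (t' : TStructure D)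
  [IsTExact k t t'] (X : C)

/-- Between `⊥` and `⊤` nothing is truncated, and the defining equations of the comparison reduce to
this one. -/
lemma eTruncComparison_bot_top : eTruncComparison k t t' ⊥ ⊤ X = 𝟙 (k.obj X) := by
  have h₁ : eTruncLTComparison k t t' ⊤ X = 𝟙 (k.obj X) :=
    (comp_id _).symm.trans ((eTruncLTComparison_ι k t t' ⊤ X).trans (k.map_id _))
  have h := π_eTruncComparison k t t' ⊥ ⊤ X
  refine (id_comp _).symm.trans (((k.map_id _).symm =≫ _).trans (h.trans ?_))
  exact (comp_id _).trans h₁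

end

variable {A B C A' B' C' : Type*}
    [Category* A] [Category* B] [Category* C] [Category* A'] [Category* B'] [Category* C']
    [Abelian A] [Abelian B] [Abelian C] [Abelian A'] [Abelian B'] [Abelian C']
    [HasDerivedCategory A] [HasDerivedCategory B] [HasDerivedCategory C]
    [HasDerivedCategory A'] [HasDerivedCategory B'] [HasDerivedCategory C']
    [EnoughInjectives A] [EnoughInjectives B] [EnoughInjectives A'] [EnoughInjectives B']
    {F : A ⥤ B} {G : B ⥤ C} {F' : A' ⥤ B'} {G' : B' ⥤ C'}
    {KA : A ⥤ A'} {KB : B ⥤ B'} {KC : C ⥤ C'}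
    [F.Additive] [G.Additive] [F'.Additive] [G'.Additive]
    [KA.Additive] [KB.Additive] [KC.Additive]
    [PreservesFiniteLimits KA] [PreservesFiniteColimits KA]
    [PreservesFiniteLimits KB] [PreservesFiniteColimits KB]
    [PreservesFiniteLimits KC] [PreservesFiniteColimits KC]
    (NF : F ⋙ KB ⟶ KA ⋙ F') (NG : G ⋙ KC ⟶ KB ⋙ G')

lemma comp_single_chase {D : Type*} [Category* D] {X₀ X₁ X₂ X₃ Y₀ Y₁ Y₂ : D}
    {r : X₀ ⟶ X₁} {s : X₁ ⟶ X₂} {n : X₂ ⟶ X₃} {d : X₀ ⟶ Y₀} {r₁ : Y₀ ⟶ X₃} {m : X₃ ⟶ Y₁}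
    {n' : X₂ ⟶ Y₁} {e : Y₀ ⟶ Y₂} {r₂ : Y₂ ⟶ Y₁} (h : r ≫ s ≫ n = d ≫ r₁) (hn : n' = n ≫ m)
    (h' : e ≫ r₂ = r₁ ≫ m) : r ≫ s ≫ n' = (d ≫ e) ≫ r₂ := by
  rw [hn, reassoc_of% h, assoc, h']

lemma comp_eq_comp_of_retract {D : Type*} [Category* D] {X₀ X₁ Y₀ Y₁ : D} {a : X₀ ⟶ X₁}
    {a' : X₁ ⟶ X₀} {r : X₀ ⟶ Y₀} {b : Y₀ ⟶ Y₁} {b' : Y₁ ⟶ Y₀} {ψ : X₁ ⟶ Y₁}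
    (h : a ≫ ψ = r ≫ b) (ha : a' ≫ a = 𝟙 _) (hb : b ≫ b' = 𝟙 _) : ψ ≫ b' = a' ≫ r := by
  rw [← id_comp ψ, ← ha, assoc, assoc, reassoc_of% h, hb, comp_id]

/-- The morphism `KC(RG(RF(X))) ⟶ RG'(RF'(KA(X)))` for `X : A`. -/
noncomputable def derivedCompSingle (X : A) :
    (mapPlus KC).obj (G.rightDerivedFunctorPlus.obj (F.rightDerivedFunctorPlus.obj
      ((Plus.singleFunctor A 0).obj X))) ⟶
    G'.rightDerivedFunctorPlus.obj (F'.rightDerivedFunctorPlus.obj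
      ((Plus.singleFunctor A' 0).obj (KA.obj X))) :=
  (derivedNatTrans NG).app _ ≫ G'.rightDerivedFunctorPlus.map ((derivedSingle NF).app X)

lemma grothendieckHomAlong_hom_app_bot_top (X : A) (n : ℤ) :
    ((grothendieckHomAlong NF NG X).hom n).app (mk₁ (homOfLE (bot_le : (⊥ : EInt) ≤ ⊤))) =
      (mapPlusHomology KC n).inv.app _ ≫
        (Plus.homologyFunctor C' n).map (derivedCompSingle NF NG X) := by
  have h := eTruncComparison_bot_top (mapPlus KB) Plus.TStructure.t Plus.TStructure.t
    (F.rightDerivedFunctorPlus.obj ((Plus.singleFunctor A 0).obj X))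
  refine whisker_eq _ ((Plus.homologyFunctor C' n).congr_map
    (whisker_eq _ (G'.rightDerivedFunctorPlus.congr_map ?_)))
  exact (h =≫ _).trans (id_comp _)

/-- The identity of transformations `rightDerivedComp_derivedNatTrans` at `X[0]`, followed by the
identification of KA(X[0]) with KA(X)[0]. -/
lemma rightDerivedComp_derivedCompSingle (X : A) :
    (mapPlus KC).map ((rightDerivedComp F G).app ((Plus.singleFunctor A 0).obj X)) ≫
      derivedCompSingle NF NG X =
    (derivedSingle (compNatTrans NF NG)).app X ≫ (rightDerivedComp F' G').app _ := by
  have h := congr_app (rightDerivedComp_derivedNatTrans NF NG) ((Plus.singleFunctor A 0).obj X)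
  have h' := (rightDerivedComp F' G').naturality ((mapPlusSingle KA 0).hom.app X)
  simp only [NatTrans.comp_app, Functor.associator_hom_app, Functor.associator_inv_app, id_comp,
    comp_id] at h
  exact comp_single_chase h (G'.rightDerivedFunctorPlus.map_comp _ _) h'

/-- Cohomology applied to `rightDerivedComp_derivedCompSingle`: under R(GF) ≅ RG RF on both sides,
the value of the family at (-∞, +∞) is the map induced by N_{GF}. -/
lemma rightDerCompIso_hom_app_comp (X : A) [F.PreservesInjectiveObjects]
    [F'.PreservesInjectiveObjects] (n : ℤ) :
    KC.map ((rightDerCompIso F G n).hom.app X) ≫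
      ((grothendieckHomAlong NF NG X).hom n).app (mk₁ (homOfLE (bot_le : (⊥ : EInt) ≤ ⊤))) =
    (rightDerNatTrans (compNatTrans NF NG) n).app X ≫
      (rightDerCompIso F' G' n).hom.app (KA.obj X) := by
  have h₁ := (mapPlusHomology KC n).inv.naturality
    ((rightDerivedComp F G).app ((Plus.singleFunctor A 0).obj X))
  have h₂ := ((Plus.homologyFunctor C' n).map_comp _ _).symm.trans
    (((Plus.homologyFunctor C' n).congr_map (rightDerivedComp_derivedCompSingle NF NG X)).trans
    ((Plus.homologyFunctor C' n).map_comp _ _))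
  refine (whisker_eq _ (grothendieckHomAlong_hom_app_bot_top NF NG X n)).trans ?_
  refine (assoc _ _ _).symm.trans ((h₁ =≫ _).trans ((assoc _ _ _).trans
    ((whisker_eq _ h₂).trans ?_)))
  refine (assoc _ _ _).symm.trans ?_
  exact (((assoc _ _ _).trans (whisker_eq _
    ((Plus.homologyFunctor C' n).map_comp _ _).symm)) =≫ _).symm

lemma grothendieckSSMap_compatible [F.PreservesInjectiveObjects] [F'.PreservesInjectiveObjects]
    (X : A) :
    Convergence.Compatible ((grothendieckConvergence F G X).map KC)
      (grothendieckConvergence F' G' (KA.obj X)) ((grothendieckSSMap NF NG).app X)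
      (fun n => (rightDerNatTrans (compNatTrans NF NG) n).app X) := by
  obtain ⟨f, h₁, h₂⟩ := (grothendieckHomAlong NF NG X).compatible
  -- Transporting the abutment by `ofIso` changes only the inclusions of the filtration steps, so
  -- the maps `f` and the statement on graded pieces are kept.
  refine ⟨f, fun n p => ?_, h₂⟩
  have h := rightDerCompIso_hom_app_comp NF NG X n
  have h' : ((grothendieckHomAlong NF NG X).hom n).app (mk₁ (homOfLE (bot_le : (⊥ : EInt) ≤ ⊤))) ≫
      (rightDerCompIso F' G' n).inv.app (KA.obj X) =
    KC.map ((rightDerCompIso F G n).inv.app X) ≫ (rightDerNatTrans (compNatTrans NF NG) n).app X :=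
    comp_eq_comp_of_retract h (KC.mapIso ((rightDerCompIso F G n).app X)).inv_hom_id
      ((rightDerCompIso F' G' n).hom_inv_id_app _)
  refine (assoc _ _ _).symm.trans (((h₁ n p) =≫ _).trans ((assoc _ _ _).trans
    ((whisker_eq _ h').trans ?_)))
  exact (assoc _ _ _).symm.trans ((KC.map_comp _ _).symm =≫ _)

end AbutmentComparison

end GrothendieckSS

namespace GrothendieckSS

/-! ### Identification on the second page -/

section SecondPage

open DerivedCategory Pretriangulated ComposableArrows

section

variable {B B' : Type*} [Category* B] [Category* B'] [Abelian B] [Abelian B']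
    [HasDerivedCategory B] [HasDerivedCategory B'] (KB : B ⥤ B') [KB.Additive]
    [PreservesFiniteLimits KB] [PreservesFiniteColimits KB]

lemma inv_comp_chase {D : Type*} [Category* D] {X₀ X₁ X₂ X₃ Y₁ : D}
    {s : X₀ ⟶ X₁} {s' : X₁ ⟶ X₀} {m : X₁ ⟶ X₂} {c : X₀ ⟶ Y₁} {m₀ : Y₁ ⟶ X₃} {t : X₃ ⟶ X₂}
    {t' : X₂ ⟶ X₃} (h : s ≫ m = c ≫ m₀ ≫ t) (hs : s' ≫ s = 𝟙 _) (ht : t ≫ t' = 𝟙 _) :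
    m ≫ t' = s' ≫ c ≫ m₀ := by
  have h' := s' ≫= h =≫ t'
  simp only [assoc, ht, comp_id] at h'
  rw [← h', reassoc_of% hs]

lemma mapPlusSingle_hom_app_shiftIso_inv (Y : B) (n a a' : ℤ) (h : n + a = a') :
    (mapPlusSingle KB a).hom.app Y ≫ ((Plus.singleFunctors B').shiftIso n a a' h).inv.app (KB.obj Y) =
      (mapPlus KB).map (((Plus.singleFunctors B).shiftIso n a a' h).inv.app Y) ≫
        ((mapPlus KB).commShiftIso n).hom.app _ ≫ ((mapPlusSingle KB a').hom.app Y)⟦n⟧' :=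
  inv_comp_chase (mapPlus_map_singleFunctors_shiftIso KB Y n a a' h)
    ((mapPlus KB).mapIso (((Plus.singleFunctors B).shiftIso n a a' h).app Y)).inv_hom_id
    (((Plus.singleFunctors B').shiftIso n a a' h).hom_inv_id_app _)

lemma homologySingleIso_hom_naturality {q : ℤ} {X Y : B} (f : X ⟶ Y) :
    (Plus.homologyFunctor B q).map ((Plus.singleFunctor B q).map f) ≫
      (homologySingleIso B q).hom.app Y = (homologySingleIso B q).hom.app X ≫ f :=
  (homologySingleIso B q).hom.naturality f

instance (q : ℤ) : (Plus.singleFunctor B q).Full where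
  map_surjective f := by
    obtain ⟨a, ha⟩ := (DerivedCategory.singleFunctor B q).map_surjective (Plus.ι.map f)
    exact ⟨a, Plus.ι.map_injective ha⟩

/-- A morphism from an object concentrated in degree `q` to a single complex in degree `q` is
determined by its action on `H^q`. -/
lemma to_singleFunctor_ext {U : Plus B} {Y : B} (q : ℤ) [U.IsGE q] [U.IsLE q]
    {f g : U ⟶ (Plus.singleFunctor B q).obj Y}
    (h : (Plus.homologyFunctor B q).map f ≫ (homologySingleIso B q).hom.app Y =
      (Plus.homologyFunctor B q).map g ≫ (homologySingleIso B q).hom.app Y) : f = g := by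
  let e := isoSingleHomology U q
  obtain ⟨a, ha⟩ := (Plus.singleFunctor B q).map_surjective (e.inv ≫ f)
  obtain ⟨b, hb⟩ := (Plus.singleFunctor B q).map_surjective (e.inv ≫ g)
  rw [← cancel_epi e.inv, ← ha, ← hb]
  refine congrArg _ ?_
  have h₁ := homologySingleIso_hom_naturality (q := q) a
  have h₂ := homologySingleIso_hom_naturality (q := q) b
  rw [ha, Functor.map_comp, assoc, h] at h₁
  rw [hb, Functor.map_comp, assoc] at h₂
  exact (cancel_epi _).1 (h₁.symm.trans h₂)

/-- The canonical morphism `τ^{≥ q} τ^{< q+1} Z ⟶ H^q(Z)[-q]`. -/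
noncomputable def truncToSingle (q : ℤ) (Z : Plus B) :
    (Plus.TStructure.t.truncGE q).obj ((Plus.TStructure.t.truncLT (q + 1)).obj Z) ⟶
      (Plus.singleFunctor B q).obj ((Plus.homologyFunctor B q).obj Z) :=
  (isoSingleHomology ((Plus.TStructure.t.truncGE q).obj
    ((Plus.TStructure.t.truncLT (q + 1)).obj Z)) q ≪≫
      (Plus.singleFunctor B q).mapIso (homologyTruncIso Z q)).hom

/-- The factor `isoSingleHomology` induces the identity on `H^q`, so only `homologyTruncIso`
remains. -/
lemma homologyFunctor_map_truncToSingle (q : ℤ) (Z : Plus B) :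
    (Plus.homologyFunctor B q).map (truncToSingle q Z) ≫ (homologySingleIso B q).hom.app _ =
      (homologyTruncIso Z q).hom := by
  refine ((Plus.homologyFunctor B q).map_comp _ _ =≫ _).trans ((assoc _ _ _).trans ?_)
  refine (whisker_eq _ (homologySingleIso_hom_naturality _)).trans ?_
  refine (assoc _ _ _).symm.trans ((homologyFunctor_map_isoSingleHomology _ q =≫ _).trans ?_)
  exact id_comp _

lemma homology_π_homologyTruncIso_hom (q : ℤ) (Z : Plus B) :
    (Plus.homologyFunctor B q).map ((Plus.TStructure.t.truncGEπ q).app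
      ((Plus.TStructure.t.truncLT (q + 1)).obj Z)) ≫ (homologyTruncIso Z q).hom =
    (Plus.homologyFunctor B q).map ((Plus.TStructure.t.truncLTι (q + 1)).app Z) := by
  have := isIso_homology_truncGEπ ((Plus.TStructure.t.truncLT (q + 1)).obj Z) q
  exact IsIso.hom_inv_id_assoc _ _

/-- The morphism `KB (τ^{≥ q} τ^{< q+1} Z) ⟶ τ^{≥ q} τ^{< q+1} Z'` for `φ : KB(Z) ⟶ Z'`. -/
noncomputable def truncMap {KB : B ⥤ B'} [KB.Additive] [PreservesFiniteLimits KB]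
    [PreservesFiniteColimits KB] {Z : Plus B} {Z' : Plus B'} (φ : (mapPlus KB).obj Z ⟶ Z') (q : ℤ) :
    (mapPlus KB).obj
      ((Plus.TStructure.t.truncGE q).obj ((Plus.TStructure.t.truncLT (q + 1)).obj Z)) ⟶
      (Plus.TStructure.t.truncGE q).obj ((Plus.TStructure.t.truncLT (q + 1)).obj Z') :=
  eTruncComparison (mapPlus KB) Plus.TStructure.t Plus.TStructure.t q (q + 1 : ℤ) Z ≫
    (Plus.TStructure.t.truncGE q).map ((Plus.TStructure.t.truncLT (q + 1)).map φ)

lemma trunc_chase {D : Type*} [Category* D] {X₀ X₁ X₂ X₃ Y₀ Y₁ : D}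
    {p : X₀ ⟶ X₁} {c : X₁ ⟶ X₂} {f : X₂ ⟶ X₃} {l : X₀ ⟶ Y₀} {p' : Y₀ ⟶ X₂} {f' : Y₀ ⟶ Y₁}
    {p'' : Y₁ ⟶ X₃} (h₁ : p ≫ c = l ≫ p') (h₂ : p' ≫ f = f' ≫ p'')
    {cf : X₁ ⟶ X₃} (h : cf = c ≫ f) : p ≫ cf = (l ≫ f') ≫ p'' := by
  rw [h, reassoc_of% h₁, h₂, assoc]

/-- The map `l` is the comparison for τ^{< q+1} followed by the truncation of `φ`; its two
properties are all that the computation of H^q(`truncMap φ q`) needs. -/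
lemma π_truncMap {Z : Plus B} {Z' : Plus B'} (φ : (mapPlus KB).obj Z ⟶ Z') (q : ℤ) :
    ∃ l : (mapPlus KB).obj ((Plus.TStructure.t.truncLT (q + 1)).obj Z) ⟶
        (Plus.TStructure.t.truncLT (q + 1)).obj Z',
      (mapPlus KB).map ((Plus.TStructure.t.truncGEπ q).app _) ≫ truncMap φ q =
        l ≫ (Plus.TStructure.t.truncGEπ q).app _ ∧
      l ≫ (Plus.TStructure.t.truncLTι (q + 1)).app Z' =
        (mapPlus KB).map ((Plus.TStructure.t.truncLTι (q + 1)).app Z) ≫ φ := by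
  have h₁ := π_eTruncComparison (mapPlus KB) Plus.TStructure.t Plus.TStructure.t q (q + 1 : ℤ) Z
  have h₂ := eTruncLTComparison_ι (mapPlus KB) Plus.TStructure.t Plus.TStructure.t (q + 1 : ℤ) Z
  refine ⟨_, trunc_chase h₁ ((Plus.TStructure.t.truncGEπ q).naturality _).symm rfl, ?_⟩
  refine (assoc _ _ _).trans ((whisker_eq _ ((Plus.TStructure.t.truncLTι (q + 1)).naturality
    φ)).trans ?_)
  exact (assoc _ _ _).symm.trans (h₂ =≫ _)

lemma homology_trunc_chase {D : Type*} [Category* D] {X₀ X₁ X₂ X₃ Y₀ Y₁ Y₂ Y₃ : D}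
    {hp : X₀ ⟶ X₁} {ht : X₁ ⟶ X₂} {l : X₀ ⟶ Y₀} {p' : Y₀ ⟶ X₂} {t' : X₂ ⟶ X₃} {i' : Y₀ ⟶ X₃}
    (h₁ : hp ≫ ht = l ≫ p') (h₂ : p' ≫ t' = i') {m : X₁ ⟶ Y₁} {kt : Y₁ ⟶ Y₂} {m₀ : X₀ ⟶ Y₃}
    {kp : Y₃ ⟶ Y₁} {ki : Y₃ ⟶ Y₂} (h₃ : kp ≫ kt = ki) (h₄ : hp ≫ m = m₀ ≫ kp) {Z : D}
    {hi : X₀ ⟶ Z} {mz : Z ⟶ Y₂} {mz' : Y₂ ⟶ Z} {φ : Z ⟶ X₃} (h₅ : hi ≫ mz = m₀ ≫ ki)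
    (hm : mz ≫ mz' = 𝟙 _) (h₆ : l ≫ i' = hi ≫ φ) (_ : Epi hp) :
    ht ≫ t' = m ≫ kt ≫ mz' ≫ φ := by
  rw [← cancel_epi hp, reassoc_of% h₁, h₂, reassoc_of% h₄, reassoc_of% h₃, ← reassoc_of% h₅,
    reassoc_of% hm, h₆]

/-- H^q of τ^{< q+1} ⟶ τ^{≥ q} τ^{< q+1} is invertible, so the identity is checked on τ^{< q+1},
where `π_truncMap` expresses both sides through the inclusion into the whole object. -/
lemma homology_truncMap {Z : Plus B} {Z' : Plus B'} (φ : (mapPlus KB).obj Z ⟶ Z') (q : ℤ) :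
    (Plus.homologyFunctor B' q).map (truncMap φ q) ≫ (homologyTruncIso Z' q).hom =
      (mapPlusHomology KB q).hom.app _ ≫ KB.map (homologyTruncIso Z q).hom ≫
        (mapPlusHomology KB q).inv.app Z ≫ (Plus.homologyFunctor B' q).map φ := by
  obtain ⟨l, hl, hl'⟩ := π_truncMap KB φ q
  have m {X Y Z : Plus B'} (f : X ⟶ Y) (g : Y ⟶ Z) := (Plus.homologyFunctor B' q).map_comp f g
  have h₄ := (mapPlusHomology KB q).hom.naturality ((Plus.TStructure.t.truncGEπ q).app
      ((Plus.TStructure.t.truncLT (q + 1)).obj Z))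
  have h₅ := (mapPlusHomology KB q).hom.naturality ((Plus.TStructure.t.truncLTι (q + 1)).app Z)
  have : Epi ((mapPlus KB ⋙ Plus.homologyFunctor B' q).map ((Plus.TStructure.t.truncGEπ q).app
      ((Plus.TStructure.t.truncLT (q + 1)).obj Z))) := by
    have := isIso_homology_truncGEπ ((Plus.TStructure.t.truncLT (q + 1)).obj Z) q
    have : IsIso ((Plus.homologyFunctor B q ⋙ KB).map ((Plus.TStructure.t.truncGEπ q).app
      ((Plus.TStructure.t.truncLT (q + 1)).obj Z))) := inferInstanceAs (IsIso (KB.map _))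
    have := (NatIso.isIso_map_iff (mapPlusHomology KB q) ((Plus.TStructure.t.truncGEπ q).app
      ((Plus.TStructure.t.truncLT (q + 1)).obj Z))).2 this
    infer_instance
  exact homology_trunc_chase ((m _ _).symm.trans (((Plus.homologyFunctor B' q).congr_map hl).trans
    (m _ _))) (homology_π_homologyTruncIso_hom q Z') ((KB.map_comp _ _).symm.trans
      (KB.congr_map (homology_π_homologyTruncIso_hom q Z))) h₄ h₅
    ((mapPlusHomology KB q).hom_inv_id_app Z) ((m _ _).symm.trans
      (((Plus.homologyFunctor B' q).congr_map hl').trans (m _ _))) this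

lemma single_trunc_chase {D : Type*} [Category* D] {X₀ X₁ X₂ Y₀ Y₁ Y₂ Z₀ Z₁ Z₂ : D}
    {ht : X₀ ⟶ X₁} {hw' : X₁ ⟶ Z₀} {s' : Z₀ ⟶ X₂} {t' : X₁ ⟶ X₂} (h₁ : hw' ≫ s' = t')
    {m : X₀ ⟶ Y₀} {kt : Y₀ ⟶ Y₁} {ν : Y₁ ⟶ X₂} (h₂ : ht ≫ t' = m ≫ kt ≫ ν)
    {hkw : X₀ ⟶ Z₁} {mps : Z₁ ⟶ Z₂} {hν : Z₂ ⟶ Z₀} {s : Z₂ ⟶ Y₁} (h₃ : hν ≫ s' = s ≫ ν)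
    {m₁ : Z₁ ⟶ Y₂} {ks : Y₂ ⟶ Y₁} (h₄ : mps ≫ s = m₁ ≫ ks) {kw : Y₀ ⟶ Y₂}
    (h₅ : hkw ≫ m₁ = m ≫ kw) (h₆ : kw ≫ ks = kt) :
    (ht ≫ hw') ≫ s' = (hkw ≫ mps ≫ hν) ≫ s' := by
  simp only [assoc]
  rw [h₁, h₂, h₃, reassoc_of% h₄, reassoc_of% h₅, reassoc_of% h₆]

/-- On `τ^{≥ q} τ^{< q+1}`, the morphism induced by `φ : KB(Z) ⟶ Z'` is given by `H^q(φ)`. -/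
lemma truncMap_truncToSingle {Z : Plus B} {Z' : Plus B'} (φ : (mapPlus KB).obj Z ⟶ Z') (q : ℤ) :
    truncMap φ q ≫ truncToSingle q Z' =
      (mapPlus KB).map (truncToSingle q Z) ≫ (mapPlusSingle KB q).hom.app _ ≫
        (Plus.singleFunctor B' q).map ((mapPlusHomology KB q).inv.app Z ≫
          (Plus.homologyFunctor B' q).map φ) := by
  let T := (Plus.TStructure.t.truncGE q).obj ((Plus.TStructure.t.truncLT (q + 1)).obj Z)
  have m {X Y Z : Plus B'} (f : X ⟶ Y) (g : Y ⟶ Z) := (Plus.homologyFunctor B' q).map_comp f g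
  -- By t-exactness the source is concentrated in degree `q`, so maps to a single complex in degree
  -- `q` may be compared on `H^q`.
  have : ((mapPlus KB).obj T).IsGE q :=
    IsTExact.isGE_obj (t := Plus.TStructure.t) T q (inferInstanceAs (T.IsGE q))
  have : ((mapPlus KB).obj T).IsLE q :=
    IsTExact.isLE_obj (t := Plus.TStructure.t) T q (inferInstanceAs (T.IsLE q))
  refine to_singleFunctor_ext q ?_
  refine (m _ _ =≫ _).trans (Eq.trans ?_ (((m _ _).trans (whisker_eq _ (m _ _))) =≫ _).symm)
  exact single_trunc_chase (homologyFunctor_map_truncToSingle q Z') (homology_truncMap KB φ q)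
    (homologySingleIso_hom_naturality _) (homologyFunctor_map_mapPlusSingle KB _ q)
    ((mapPlusHomology KB q).hom.naturality _)
    ((KB.map_comp _ _).symm.trans (KB.congr_map (homologyFunctor_map_truncToSingle q Z)))

end

section

variable {B C B' C' : Type*}
    [Category* B] [Category* C] [Category* B'] [Category* C']
    [Abelian B] [Abelian C] [Abelian B'] [Abelian C']
    [HasDerivedCategory B] [HasDerivedCategory C] [HasDerivedCategory B'] [HasDerivedCategory C']
    [EnoughInjectives B] [EnoughInjectives B']
    {G : B ⥤ C} {G' : B' ⥤ C'} {KB : B ⥤ B'} {KC : C ⥤ C'}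
    [G.Additive] [G'.Additive] [KB.Additive] [KC.Additive]
    [PreservesFiniteLimits KB] [PreservesFiniteColimits KB]
    [PreservesFiniteLimits KC] [PreservesFiniteColimits KC]
    (NG : G ⋙ KC ⟶ KB ⋙ G')

lemma single_shift_chase {D : Type*} [Category* D] {X₀ X₁ X₂ X₃ X₄ Y₀ Y₁ Y₂ Y₃ Y₄ Y₅ : D}
    {s : X₀ ⟶ X₁} {m : X₁ ⟶ X₂} {t : X₂ ⟶ X₃} {c : X₃ ⟶ X₄} {k : X₁ ⟶ Y₀} {d : Y₀ ⟶ Y₁}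
    {m₀ : Y₁ ⟶ X₃} {g : X₀ ⟶ Y₂} {s₁ : Y₂ ⟶ Y₀} {c₁ : Y₁ ⟶ Y₃} {m₁ : Y₃ ⟶ X₄} {e : Y₂ ⟶ Y₄}
    {e' : Y₄ ⟶ Y₅} {s₂ : Y₅ ⟶ Y₃}
    (h : m ≫ t = k ≫ d ≫ m₀) (h₁ : g ≫ s₁ = s ≫ k) (h₂ : m₀ ≫ c = c₁ ≫ m₁)
    (h₃ : (e ≫ e') ≫ s₂ = s₁ ≫ d ≫ c₁) {sm : Y₅ ⟶ X₄} (h₄ : sm = s₂ ≫ m₁) :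
    s ≫ m ≫ t ≫ c = g ≫ e ≫ e' ≫ sm := by
  rw [assoc] at h₃
  rw [reassoc_of% h, h₂, ← reassoc_of% h₁, h₄, reassoc_of% h₃]

/-- The derived transformation commutes with shifts, so its value on a single complex in degree `a`
is, up to shift isomorphisms, the shift of its value in degree `a'`. The case `n = -q`, `a = q`, `a'
= 0` is the one used. -/
lemma derivedNatTrans_app_single_shift (Y : B) (n a a' : ℤ) (h : n + a = a') :
    (derivedNatTrans NG).app ((Plus.singleFunctor B a).obj Y) ≫
      G'.rightDerivedFunctorPlus.map ((mapPlusSingle KB a).hom.app Y) ≫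
      G'.rightDerivedFunctorPlus.map
        (((Plus.singleFunctors B').shiftIso n a a' h).inv.app (KB.obj Y)) ≫
      (G'.rightDerivedFunctorPlus.commShiftIso n).hom.app _ =
    (mapPlus KC).map (G.rightDerivedFunctorPlus.map
        (((Plus.singleFunctors B).shiftIso n a a' h).inv.app Y)) ≫
      (mapPlus KC).map ((G.rightDerivedFunctorPlus.commShiftIso n).hom.app _) ≫
      ((mapPlus KC).commShiftIso n).hom.app _ ≫
      ((derivedNatTrans NG).app ((Plus.singleFunctor B a').obj Y) ≫
        G'.rightDerivedFunctorPlus.map ((mapPlusSingle KB a').hom.app Y))⟦n⟧' := by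
  have m {X Y Z : Plus B'} (f : X ⟶ Y) (g : Y ⟶ Z) := G'.rightDerivedFunctorPlus.map_comp f g
  have h₀ := (m _ _).symm.trans ((G'.rightDerivedFunctorPlus.congr_map
    (mapPlusSingle_hom_app_shiftIso_inv KB Y n a a' h)).trans ((m _ _).trans
      (whisker_eq _ (m _ _))))
  have h₃ := NatTrans.shift_app_comm (derivedNatTrans NG) n ((Plus.singleFunctor B a').obj Y)
  rw [Functor.commShiftIso_comp_hom_app, Functor.commShiftIso_comp_hom_app] at h₃
  exact single_shift_chase h₀ ((derivedNatTrans NG).naturality _)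
    ((G'.rightDerivedFunctorPlus.commShiftIso n).hom.naturality _) h₃ (Functor.map_comp _ _ _)

lemma single_homology_chase {D : Type*} [Category* D] {X₀ X₁ X₂ X₃ X₄ X₅ Y₁ Y₂ Y₃ Z₀ Z₁ Z₂ Z₃ : D}
    {i : Z₀ ⟶ X₀} {s : X₀ ⟶ X₁} {m : X₁ ⟶ X₂} {t : X₂ ⟶ X₃} {c : X₃ ⟶ X₄} {r : X₄ ⟶ X₅}
    {g : X₀ ⟶ Y₁} {e : Y₁ ⟶ Y₂} {e' : Y₂ ⟶ Y₃} {sm : Y₃ ⟶ X₄}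
    (h : s ≫ m ≫ t ≫ c = g ≫ e ≫ e' ≫ sm)
    {k : Z₀ ⟶ Z₁} {k' : Z₁ ⟶ Z₂} {k'' : Z₂ ⟶ Z₃} {i₁ : Z₁ ⟶ Y₁} {i₂ : Z₂ ⟶ Y₂} {i₂' : Y₂ ⟶ Z₂}
    {W : D} {i₃ : Z₃ ⟶ W} {i₃' : W ⟶ Z₃} {r₁ : Y₃ ⟶ W} {sm' : W ⟶ X₅}
    (h₁ : k ≫ i₁ = i ≫ g) (h₂ : k' ≫ i₂ = i₁ ≫ e) (h₃ : sm ≫ r = r₁ ≫ sm')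
    (h₄ : e' ≫ r₁ ≫ i₃' = i₂' ≫ k'') (h₂' : i₂ ≫ i₂' = 𝟙 _) (h₃' : i₃' ≫ i₃ = 𝟙 _) :
    i ≫ s ≫ m ≫ t ≫ c ≫ r = (k ≫ k' ≫ k'') ≫ i₃ ≫ sm' := by
  have h₅ : e' ≫ r₁ = i₂' ≫ k'' ≫ i₃ := by rw [← reassoc_of% h₄, h₃', comp_id]
  have h₆ := h =≫ r
  simp only [assoc] at h₆ ⊢
  rw [h₆, ← reassoc_of% h₁, ← reassoc_of% h₂, h₃, reassoc_of% h₅, reassoc_of% h₂']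

lemma rightDerSingleIso_hom_app {B C : Type*} [Category* B] [Category* C]
    [Abelian B] [Abelian C] [HasDerivedCategory B] [HasDerivedCategory C] [EnoughInjectives B]
    (G : B ⥤ C) [G.Additive] (p q n : ℤ) (h : p + q = n) (Y : B) :
    (rightDerSingleIso G p q n h).hom.app Y =
      (Plus.homologyFunctor C n).map (G.rightDerivedFunctorPlus.map
        (((Plus.singleFunctors B).shiftIso (-q) q 0 (by lia)).inv.app Y)) ≫
      (Plus.homologyFunctor C n).map ((G.rightDerivedFunctorPlus.commShiftIso (-q)).hom.app
        ((Plus.singleFunctor B 0).obj Y)) ≫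
      ((Plus.homologyFunctor C 0).shiftIso (-q) n p (by lia)).hom.app
        (G.rightDerivedFunctorPlus.obj ((Plus.singleFunctor B 0).obj Y)) :=
  whisker_eq _ ((id_comp _).trans ((id_comp _).trans (whisker_eq _ (id_comp _))))

/-- `Hⁿ` of `derivedNatTrans_app_single_shift` moves everything from `Y[-q]` to `Y[0]`;
`commShiftIso_shiftIso_mapPlusHomology` then turns `Hⁿ` of the shift by `-q` into `H^p`. -/
lemma rightDerSingleIso_comp (Y : B) (p q n : ℤ) (h : p + q = n) :
    (mapPlusHomology KC n).inv.app _ ≫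
      (Plus.homologyFunctor C' n).map ((derivedNatTrans NG).app ((Plus.singleFunctor B q).obj Y)) ≫
      (Plus.homologyFunctor C' n).map (G'.rightDerivedFunctorPlus.map
        ((mapPlusSingle KB q).hom.app Y)) ≫
      (rightDerSingleIso G' p q n h).hom.app (KB.obj Y) =
    KC.map ((rightDerSingleIso G p q n h).hom.app Y) ≫ (rightDerNatTrans NG p).app Y := by
  have m {X Y Z : Plus C'} (f : X ⟶ Y) (g : Y ⟶ Z) := (Plus.homologyFunctor C' n).map_comp f g
  have e := (Plus.homologyFunctor C' n).congr_map
    (derivedNatTrans_app_single_shift NG Y (-q) q 0 (by lia))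
  have e' := ((m _ _).trans (whisker_eq _ ((m _ _).trans (whisker_eq _ (m _ _))))).symm.trans
    (e.trans ((m _ _).trans (whisker_eq _ ((m _ _).trans (whisker_eq _ (m _ _))))))
  have h₃ := ((Plus.homologyFunctor C' 0).shiftIso (-q) n p (by lia)).hom.naturality
    ((derivedNatTrans NG).app ((Plus.singleFunctor B 0).obj Y) ≫
        G'.rightDerivedFunctorPlus.map ((mapPlusSingle KB 0).hom.app Y))
  have h₁ := (mapPlusHomology KC n).inv.naturality (G.rightDerivedFunctorPlus.map
        (((Plus.singleFunctors B).shiftIso (-q) q 0 (by lia)).inv.app Y))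
  have h₂ := (mapPlusHomology KC n).inv.naturality
    ((G.rightDerivedFunctorPlus.commShiftIso (-q)).hom.app ((Plus.singleFunctor B 0).obj Y))
  have h₄ := commShiftIso_shiftIso_mapPlusHomology KC (G.rightDerivedFunctorPlus.obj
    ((Plus.singleFunctor B 0).obj Y)) (-q) n p (by lia)
  refine Eq.trans (whisker_eq _ (whisker_eq _ (whisker_eq _
    (rightDerSingleIso_hom_app G' p q n h (KB.obj Y))))) ?_
  refine Eq.trans ?_ (((KC.congr_map (rightDerSingleIso_hom_app G p q n h Y)).trans
    ((KC.map_comp _ _).trans (whisker_eq _ (KC.map_comp _ _)))) =≫ _).symm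
  refine Eq.trans ?_ (whisker_eq _ ((whisker_eq _ ((Plus.homologyFunctor C' p).map_comp _ _)).trans
    (assoc _ _ _).symm))
  exact single_homology_chase e' h₁ h₂ h₃ h₄ ((mapPlusHomology KC n).inv_hom_id_app _)
    ((mapPlusHomology KC p).hom_inv_id_app _)

end

section

variable {A B C A' B' C' : Type*}
    [Category* A] [Category* B] [Category* C] [Category* A'] [Category* B'] [Category* C']
    [Abelian A] [Abelian B] [Abelian C] [Abelian A'] [Abelian B'] [Abelian C']
    [HasDerivedCategory A] [HasDerivedCategory B] [HasDerivedCategory C]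
    [HasDerivedCategory A'] [HasDerivedCategory B'] [HasDerivedCategory C']
    [EnoughInjectives A] [EnoughInjectives B] [EnoughInjectives A'] [EnoughInjectives B']
    {F : A ⥤ B} {G : B ⥤ C} {F' : A' ⥤ B'} {G' : B' ⥤ C'}
    {KA : A ⥤ A'} {KB : B ⥤ B'} {KC : C ⥤ C'}
    [F.Additive] [G.Additive] [F'.Additive] [G'.Additive]
    [KA.Additive] [KB.Additive] [KC.Additive]
    [PreservesFiniteLimits KA] [PreservesFiniteColimits KA]
    [PreservesFiniteLimits KB] [PreservesFiniteColimits KB]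
    [PreservesFiniteLimits KC] [PreservesFiniteColimits KC]
    (NF : F ⋙ KB ⟶ KA ⋙ F') (NG : G ⋙ KC ⟶ KB ⋙ G')

lemma page2_chase {D : Type*} [Category* D]
    {X₀ X₁ X₂ X₃ X₄ X₅ Y₀ Y₁ Y₂ Y₃ Y₄ Z₀ Z₁ Z₂ : D}
    {i : X₀ ⟶ X₁} {s : X₁ ⟶ X₂} {θ : X₂ ⟶ X₃} {w' : X₃ ⟶ X₄} {r' : X₄ ⟶ X₅}
    {kw : X₀ ⟶ Y₀} {i₁ : Y₀ ⟶ Y₁} {w₁ : X₁ ⟶ Y₁} {s₁ : Y₁ ⟶ Y₂} {w₂ : X₂ ⟶ Y₂} {m : Y₂ ⟶ Y₃}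
    {ν : Y₃ ⟶ X₄} (h : θ ≫ w' = w₂ ≫ m ≫ ν) (h₁ : w₁ ≫ s₁ = s ≫ w₂) (h₂ : kw ≫ i₁ = i ≫ w₁)
    {r₁ : Y₃ ⟶ Y₄} {ν' : Y₄ ⟶ X₅} (h₃ : ν ≫ r' = r₁ ≫ ν') {kr : Y₀ ⟶ Z₀} {n : Z₀ ⟶ Y₄}
    (h₄ : i₁ ≫ s₁ ≫ m ≫ r₁ = kr ≫ n) {x : Z₁ ⟶ Z₂} {y' : Z₂ ⟶ X₃} {y : Z₁ ⟶ X₀}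
    {sθ : X₁ ⟶ X₃} (hs : sθ = s ≫ θ) (h₅ : x ≫ y' = y ≫ i ≫ sθ) {e' : Z₂ ⟶ X₅}
    (he' : e' = y' ≫ w' ≫ r') {e : Z₁ ⟶ Z₀} (he : e = y ≫ kw ≫ kr) :
    x ≫ e' = e ≫ n ≫ ν' := by
  rw [he', he, reassoc_of% h₅, hs]
  simp only [assoc]
  rw [reassoc_of% h, h₃, ← reassoc_of% h₄, reassoc_of% h₂, reassoc_of% h₁]

/-- `page2Iso` has three factors, each compatible with the morphism: the first page isomorphism
(`h₅`), the identification of the truncation with R^qF(X)[-q] (`h`, `h₁`, `h₂`), and the passage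
from RG of R^qF(X)[-q] to R^pG (`h₃`, `h₄`). -/
lemma grothendieckSSMap_page2Iso (X : A) (p q : ℤ) :
    (SpectralSequence.Hom.hom ((grothendieckSSMap NF NG).app X) 2).f (p, q) ≫
        (page2Iso F' G' (KA.obj X) p q).hom =
      KC.map (page2Iso F G X p q).hom ≫
        (rightDerNatTrans NG p).app ((rightDer F q).obj X) ≫
          (rightDer G' p).map ((rightDerNatTrans NF q).app X) := by
  let Z := F.rightDerivedFunctorPlus.obj ((Plus.singleFunctor A 0).obj X)
  let φ := (derivedSingle NF).app X
  let T := (Plus.TStructure.t.truncGE q).obj ((Plus.TStructure.t.truncLT (q + 1)).obj Z)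
  have m {X Y Z : Plus C'} (f : X ⟶ Y) (g : Y ⟶ Z) := (Plus.homologyFunctor C' (p + q)).map_comp f g
  have m' {X Y Z : Plus B'} (f : X ⟶ Y) (g : Y ⟶ Z) :=
    (G'.rightDerivedFunctorPlus ⋙ Plus.homologyFunctor C' (p + q)).map_comp f g
  -- The map that `truncMap_truncToSingle` finds on `H^q` is by construction the one induced by `NF`
  -- on R^qF.
  have hφ : (mapPlusHomology KB q).inv.app Z ≫ (Plus.homologyFunctor B' q).map φ =
      (rightDerNatTrans NF q).app X :=
    (whisker_eq _ ((Plus.homologyFunctor B' q).map_comp _ _)).trans (assoc _ _ _).symm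
  have h := (m' _ _).symm.trans (((G'.rightDerivedFunctorPlus ⋙
    Plus.homologyFunctor C' (p + q)).congr_map (truncMap_truncToSingle KB φ q)).trans ((m' _ _).trans
      (whisker_eq _ (m' _ _))))
  rw [hφ] at h
  have h₁ := (m _ _).symm.trans (((Plus.homologyFunctor C' (p + q)).congr_map
    ((derivedNatTrans NG).naturality (truncToSingle q Z))).trans (m _ _))
  have h₂ := (mapPlusHomology KC (p + q)).inv.naturality
    (G.rightDerivedFunctorPlus.map (truncToSingle q Z))
  have h₃ := (rightDerSingleIso G' p q (p + q) rfl).hom.naturality ((rightDerNatTrans NF q).app X)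
  have h₄ := rightDerSingleIso_comp NG ((rightDer F q).obj X) p q (p + q) rfl
  have h₅ := (grothendieckHomAlong NF NG X).pageMapX_spectralSequenceFirstPageXIso_hom
    Abelian.SpectralObject.coreE₂Cohomological (p, q) (q : EInt) ((q + 1 : ℤ) : EInt) rfl rfl
    (p + q) rfl
  exact page2_chase h h₁ h₂ h₃ h₄ (m _ _) h₅ rfl
    ((KC.map_comp _ _).trans (whisker_eq _ (KC.map_comp _ _)))

end

end SecondPage

end GrothendieckSS

/-! ### The theorem -/

theorem corollaryA {A B C A' B' C' : Type*}
    [Category* A] [Category* B] [Category* C] [Category* A'] [Category* B'] [Category* C']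
    [Abelian A] [Abelian B] [Abelian C] [Abelian A'] [Abelian B'] [Abelian C']
    [HasDerivedCategory A] [HasDerivedCategory B] [HasDerivedCategory C]
    [HasDerivedCategory A'] [HasDerivedCategory B'] [HasDerivedCategory C']
    [EnoughInjectives A] [EnoughInjectives B] [EnoughInjectives A'] [EnoughInjectives B']
    (F : A ⥤ B) (G : B ⥤ C) (F' : A' ⥤ B') (G' : B' ⥤ C')
    (KA : A ⥤ A') (KB : B ⥤ B') (KC : C ⥤ C')
    [F.Additive] [G.Additive] [F'.Additive] [G'.Additive]
    [KA.Additive] [KB.Additive] [KC.Additive]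
    [PreservesFiniteLimits F] [PreservesFiniteLimits G]
    [PreservesFiniteLimits F'] [PreservesFiniteLimits G']
    [PreservesFiniteLimits KA] [PreservesFiniteColimits KA]
    [PreservesFiniteLimits KB] [PreservesFiniteColimits KB]
    [PreservesFiniteLimits KC] [PreservesFiniteColimits KC]
    [F.PreservesInjectiveObjects] [F'.PreservesInjectiveObjects]
    (NF : F ⋙ KB ⟶ KA ⋙ F') (NG : G ⋙ KC ⟶ KB ⋙ G') :
    ∃ Φ : GrothendieckSS.grothendieckSS F G ⋙ GrothendieckSS.mapSpectralSequence KC ⟶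
        KA ⋙ GrothendieckSS.grothendieckSS F' G',
      (∀ (X : A) (p q : ℤ),
        (SpectralSequence.Hom.hom (Φ.app X) 2).f (p, q) ≫
            (GrothendieckSS.page2Iso F' G' (KA.obj X) p q).hom =
          KC.map (GrothendieckSS.page2Iso F G X p q).hom ≫
            (GrothendieckSS.rightDerNatTrans NG p).app ((GrothendieckSS.rightDer F q).obj X) ≫
              (GrothendieckSS.rightDer G' p).map
                ((GrothendieckSS.rightDerNatTrans NF q).app X)) ∧
      (∀ X : A,
        GrothendieckSS.Convergence.Compatible
          ((GrothendieckSS.grothendieckConvergence F G X).map KC)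
          (GrothendieckSS.grothendieckConvergence F' G' (KA.obj X))
          (Φ.app X)
          (fun n => (GrothendieckSS.rightDerNatTrans
            (GrothendieckSS.compNatTrans NF NG) n).app X)) := by
  exact ⟨GrothendieckSS.grothendieckSSMap NF NG, GrothendieckSS.grothendieckSSMap_page2Iso NF NG,
    GrothendieckSS.grothendieckSSMap_compatible NF NG⟩
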